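/- Let $X$ be a compact complex manifold whose Picard group $\mathrm{Pic}(X)$ (isomorphism classes of holomorphic line bundles under $\otimes$) is a free abelian group. Write $H=(\mathbb C^\times)^p$ and let $\widehat H$ be the group of holomorphic characters of $H$. For a holomorphic principal $H$-bundle $M\to X$ (with right action $m\mapsto mh$) let $\lambda_M:\widehat H\to\mathrm{Pic}(X)$, $\chi\mapsto[(M\times\mathbb C_\chi)/H]$, be its character map, where $H$ acts by $h\cdot(m,c)=(mh^{-1},\chi(h)c)$. Call $M$ a CY bundle if there are a character $\chi\in\widehat H$ and a nowhere vanishing holomorphic top form $\omega$ on $M$ with $R_h^*\omega=\chi(h)\,\omega$ for all $h\in H$, where $R_h(m)=mh$. Then $\mathrm{Pic}(X)$ is free of finite rank, i.e. it has a $\mathbb Z$-basis $[L_1],\dots,[L_p]$ for some $p\ge 0$. Moreover, for every such basis, let $L_i^\times$ be the complement of the zero section of $L_i$, and let $H=(\mathbb C^\times)^p$ act on $M:=L_1^\times\oplus\cdots\oplus L_p^\times$ by componentwise scaling. Then: 1. $M$ is a CY $H$-bundle, and its character map $\lambda_M:\widehat H\to\mathrm{Pic}(X)$ is an isomorphism of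 groups. 2. If $N\to X$ is any holomorphic principal $H$-bundle whose character map $\lambda_N$ is an isomorphism of groups, then $N$ is isomorphic to $M$ up to a twist by an automorphism of $H$: there are an automorphism $\sigma$ of the complex Lie group $H$ and a biholomorphic map $\varphi:N\to M$ over $X$ with $\varphi(nh)=\varphi(n)\sigma(h)$ for all $n\in N$, $h\in H$. -/

import Mathlib

open Bundle Set Topology Manifold
open scoped ContDiff TensorProduct

universe u v w

noncomputable section

namespace CYBundle

/-! ### Holomorphic vector bundles -/

section VectorBundles

variable (E : Type v) [NormedAddCommGroup E] [NormedSpace ℂ E]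
  (F : Type w) [NormedAddCommGroup F] [NormedSpace ℂ F]
  (X : Type u) [TopologicalSpace X] [ChartedSpace E X]

/-- A holomorphic vector bundle with typical fibre `F` over the complex manifold `X`
(modelled on `E`), as a bundled object. -/
structure HolVectorBundle where
  /-- the fibres -/
  Fib : X → Type u
  [addCommGroup : ∀ x, AddCommGroup (Fib x)]
  [module : ∀ x, Module ℂ (Fib x)]
  [topTotal : TopologicalSpace (TotalSpace F Fib)]
  [topFib : ∀ x, TopologicalSpace (Fib x)]
  [fiberBundle : FiberBundle F Fib]
  [vectorBundle : VectorBundle ℂ F Fib]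
  [holomorphic : ContMDiffVectorBundle ω F Fib 𝓘(ℂ, E)]

attribute [instance] HolVectorBundle.addCommGroup HolVectorBundle.module
  HolVectorBundle.topTotal HolVectorBundle.topFib HolVectorBundle.fiberBundle
  HolVectorBundle.vectorBundle HolVectorBundle.holomorphic

/-- Holomorphic line bundles. -/
abbrev HolLineBundle := HolVectorBundle E ℂ X

variable {E F X}

/-- The total space of a holomorphic vector bundle. -/
abbrev HolVectorBundle.Total (L : HolVectorBundle E F X) : Type u := TotalSpace F L.Fib

/-- Isomorphism of holomorphic vector bundles over `X`: a family of linear isomorphisms between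
the fibres which, together with its inverse, is holomorphic on total spaces. -/
def HolVectorBundle.Isom (L L' : HolVectorBundle E F X) : Prop :=
  ∃ φ : ∀ x, L.Fib x ≃ₗ[ℂ] L'.Fib x,
    ContMDiff (𝓘(ℂ, E).prod 𝓘(ℂ, F)) (𝓘(ℂ, E).prod 𝓘(ℂ, F)) ω
      (fun v : L.Total => (⟨v.1, φ v.1 v.2⟩ : L'.Total)) ∧
    ContMDiff (𝓘(ℂ, E).prod 𝓘(ℂ, F)) (𝓘(ℂ, E).prod 𝓘(ℂ, F)) ω
      (fun v : L'.Total => (⟨v.1, (φ v.1).symm v.2⟩ : L.Total))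

theorem HolVectorBundle.Isom.refl (L : HolVectorBundle E F X) : L.Isom L :=
  ⟨fun _ => LinearEquiv.refl _ _, contMDiff_id, contMDiff_id⟩

theorem HolVectorBundle.Isom.symm {L L' : HolVectorBundle E F X} (h : L.Isom L') : L'.Isom L := by
  obtain ⟨φ, h1, h2⟩ := h
  exact ⟨fun x => (φ x).symm, h2, h1⟩

theorem HolVectorBundle.Isom.trans {L L' L'' : HolVectorBundle E F X}
    (h : L.Isom L') (h' : L'.Isom L'') : L.Isom L'' := by
  obtain ⟨φ, h1, h2⟩ := h
  obtain ⟨ψ, h3, h4⟩ := h'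
  exact ⟨fun x => (φ x).trans (ψ x), h3.comp h1, h2.comp h4⟩

/-- Data defining a holomorphic vector bundle with prescribed fibres `V x`: around every point `a`
a family of linear isomorphisms `V x ≃ F` (`x ∈ dom a`), with holomorphic transition functions. -/
structure LocalTrivData (V : X → Type u) [∀ x, AddCommGroup (V x)] [∀ x, Module ℂ (V x)] where
  dom : X → Set X
  isOpen_dom : ∀ a, IsOpen (dom a)
  mem_dom : ∀ a, a ∈ dom a
  triv : ∀ a x, x ∈ dom a → (V x ≃ₗ[ℂ] F)
  transition : ∀ a b, ∃ g : X → F →L[ℂ] F,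
    ContMDiffOn 𝓘(ℂ, E) 𝓘(ℂ, F →L[ℂ] F) ω g (dom a ∩ dom b) ∧
      ∀ x (ha : x ∈ dom a) (hb : x ∈ dom b) (v : F),
        g x v = triv b x hb ((triv a x ha).symm v)

namespace LocalTrivData

variable {V : X → Type u} [∀ x, AddCommGroup (V x)] [∀ x, Module ℂ (V x)]
  (D : LocalTrivData (E := E) (F := F) V)

open Classical in
/-- The local trivialization attached to the point `a`. -/
def pretriv (a : X) : Pretrivialization F (π F V) where
  toFun v := (v.1, if h : v.1 ∈ D.dom a then D.triv a v.1 h v.2 else 0)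
  invFun z := ⟨z.1, if h : z.1 ∈ D.dom a then (D.triv a z.1 h).symm z.2 else 0⟩
  source := π F V ⁻¹' D.dom a
  target := D.dom a ×ˢ univ
  baseSet := D.dom a
  open_baseSet := D.isOpen_dom a
  open_target := (D.isOpen_dom a).prod isOpen_univ
  source_eq := rfl
  target_eq := rfl
  proj_toFun _ _ := rfl
  map_source' v hv := ⟨hv, mem_univ _⟩
  map_target' z hz := hz.1
  left_inv' v hv := by
    have hv' : v.1 ∈ D.dom a := hv
    simp [hv']
  right_inv' z hz := by
    have hz' : z.1 ∈ D.dom a := hz.1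
    simp [hz']

theorem pretriv_apply (a : X) {x : X} (h : x ∈ D.dom a) (v : V x) :
    D.pretriv a ⟨x, v⟩ = (x, D.triv a x h v) := by
  have h' : x ∈ D.dom a := h
  change (x, _) = _
  simp [h']

theorem pretriv_symm (a : X) {x : X} (h : x ∈ D.dom a) (v : F) :
    (D.pretriv a).symm x v = (D.triv a x h).symm v := by
  apply (D.triv a x h).injective
  have h1 := (D.pretriv a).apply_mk_symm (b := x) h v
  rw [D.pretriv_apply a h] at h1
  simpa using congrArg Prod.snd h1

/-- The topology of the fibres. -/
@[reducible] def topFib (x : X) : TopologicalSpace (V x) :=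
  TopologicalSpace.induced (D.triv x x (D.mem_dom x)) inferInstance

/-- The vector prebundle given by the local trivializations. -/
@[reducible] def prebundle :
    letI := fun x => D.topFib x
    VectorPrebundle ℂ F V :=
  letI := fun x => D.topFib x
  { pretrivializationAtlas := range D.pretriv
    pretrivialization_linear' := by
      rintro _ ⟨a, rfl⟩
      refine ⟨fun x hx => ?_⟩
      have hx' : x ∈ D.dom a := hx
      constructor
      · intro v w
        simp [D.pretriv_apply a hx']
      · intro c v
        simp [D.pretriv_apply a hx']
    pretrivializationAt := D.pretriv
    mem_base_pretrivializationAt := D.mem_dom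
    pretrivialization_mem_atlas := fun x => ⟨x, rfl⟩
    exists_coordChange := by
      rintro _ ⟨a, rfl⟩ _ ⟨b, rfl⟩
      obtain ⟨g, hg, hg'⟩ := D.transition a b
      refine ⟨g, hg.continuousOn, ?_⟩
      rintro x ⟨ha, hb⟩ v
      rw [hg' x ha hb, D.pretriv_symm a ha, D.pretriv_apply b hb]
    totalSpaceMk_isInducing := by
      intro b
      have h : (D.pretriv b ∘ TotalSpace.mk b : V b → X × F) =
          (fun z : F => (b, z)) ∘ D.triv b b (D.mem_dom b) := by
        funext v
        exact D.pretriv_apply b (D.mem_dom b) v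
      rw [h]
      exact (isInducing_prodMkRight b).comp ⟨rfl⟩ }

/-- The holomorphic vector bundle with fibres `V x` defined by the local trivializations. -/
def toBundle : HolVectorBundle E F X :=
  letI := fun x => D.topFib x
  { Fib := V
    topTotal := D.prebundle.totalSpaceTopology
    topFib := fun x => D.topFib x
    fiberBundle := D.prebundle.toFiberBundle
    vectorBundle := D.prebundle.toVectorBundle
    holomorphic := by
      have : D.prebundle.IsContMDiff 𝓘(ℂ, E) ω := by
        constructor
        rintro _ ⟨a, rfl⟩ _ ⟨b, rfl⟩
        obtain ⟨g, hg, hg'⟩ := D.transition a b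
        refine ⟨g, hg, ?_⟩
        rintro x ⟨ha, hb⟩ v
        rw [hg' x ha hb, D.pretriv_symm a ha, D.pretriv_apply b hb]
      exact D.prebundle.contMDiffVectorBundle 𝓘(ℂ, E) }

theorem toBundle_trivializationAt (a : X) {x : X} (h : x ∈ D.dom a) (v : V x) :
    (trivializationAt F D.toBundle.Fib a (⟨x, v⟩ : TotalSpace F D.toBundle.Fib)) =
      (x, D.triv a x h v) :=
  D.pretriv_apply a h v

end LocalTrivData

end VectorBundles

/-! ### The Picard group -/

section Picard

variable {E : Type v} [NormedAddCommGroup E] [NormedSpace ℂ E]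
  {X : Type u} [TopologicalSpace X] [ChartedSpace E X]

namespace HolLineBundle

/-- The fibre coordinate given by the preferred trivialization at `a`. -/
def coordAt (L : HolLineBundle E X) (a x : X) (h : x ∈ (trivializationAt ℂ L.Fib a).baseSet) :
    L.Fib x ≃ₗ[ℂ] ℂ :=
  (trivializationAt ℂ L.Fib a).linearEquivAt ℂ x h

theorem exists_transition (L : HolLineBundle E X) (a b : X) : ∃ g : X → ℂ,
    ContMDiffOn 𝓘(ℂ, E) 𝓘(ℂ, ℂ) ω g
      ((trivializationAt ℂ L.Fib a).baseSet ∩ (trivializationAt ℂ L.Fib b).baseSet) ∧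
    ∀ x ha hb, coordAt L b x hb ((coordAt L a x ha).symm 1) = g x := by
  refine ⟨fun x => ((trivializationAt ℂ L.Fib a).coordChangeL ℂ
    (trivializationAt ℂ L.Fib b) x : ℂ →L[ℂ] ℂ) 1, ?_, ?_⟩
  · exact (contMDiffOn_coordChangeL (IB := 𝓘(ℂ, E)) (n := ω)
      (trivializationAt ℂ L.Fib a) (trivializationAt ℂ L.Fib b)).clm_apply contMDiffOn_const
  · intro x ha hb
    have := (trivializationAt ℂ L.Fib a).coe_coordChangeL (R := ℂ)
      (trivializationAt ℂ L.Fib b) ⟨ha, hb⟩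
    exact (congrFun this 1).symm

/-- `LocalTrivData` for line bundles, with scalar transition functions. -/
def lineData (V : X → Type u) [∀ x, AddCommGroup (V x)] [∀ x, Module ℂ (V x)]
    (dom : X → Set X) (isOpen_dom : ∀ a, IsOpen (dom a)) (mem_dom : ∀ a, a ∈ dom a)
    (triv : ∀ a x, x ∈ dom a → (V x ≃ₗ[ℂ] ℂ))
    (transition : ∀ a b, ∃ g : X → ℂ,
      ContMDiffOn 𝓘(ℂ, E) 𝓘(ℂ, ℂ) ω g (dom a ∩ dom b) ∧
        ∀ x ha hb, triv b x hb ((triv a x ha).symm 1) = g x) :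
    LocalTrivData (E := E) (F := ℂ) V where
  dom := dom
  isOpen_dom := isOpen_dom
  mem_dom := mem_dom
  triv := triv
  transition a b := by
    obtain ⟨g, hg, hg'⟩ := transition a b
    refine ⟨fun x => g x • ContinuousLinearMap.id ℂ ℂ, hg.smul contMDiffOn_const, ?_⟩
    intro x ha hb v
    have h1 : (triv a x ha).symm v = v • (triv a x ha).symm 1 := by
      rw [← map_smul, smul_eq_mul, mul_one]
    rw [h1, map_smul, hg' x ha hb]
    simp [mul_comm]

/-- The section `s` is holomorphic near `a` and does not vanish at `a`. -/
def IsFrameAt (L : HolLineBundle E X) (a : X) (s : ∀ x, L.Fib x) : Prop :=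
  ContMDiffAt 𝓘(ℂ, E) (𝓘(ℂ, E).prod 𝓘(ℂ, ℂ)) ω (fun x => (⟨x, s x⟩ : L.Total)) a ∧ s a ≠ 0

theorem isFrameAt_iff (L : HolLineBundle E X) (a : X) (s : ∀ x, L.Fib x) :
    IsFrameAt L a s ↔ ContMDiffAt 𝓘(ℂ, E) 𝓘(ℂ, ℂ) ω
      (fun x => (trivializationAt ℂ L.Fib a (⟨x, s x⟩ : L.Total)).2) a ∧ s a ≠ 0 :=
  and_congr_left' (contMDiffAt_section a)

theorem IsFrameAt.coord_ne_zero {L : HolLineBundle E X} {a : X} {s : ∀ x, L.Fib x}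
    (h : IsFrameAt L a s) :
    (trivializationAt ℂ L.Fib a (⟨a, s a⟩ : L.Total)).2 ≠ 0 := by
  have ha := mem_baseSet_trivializationAt ℂ L.Fib a
  intro h0
  apply h.2
  apply (coordAt L a a ha).injective
  rw [map_zero]
  exact h0

theorem toBundle_isFrameAt_iff {V : X → Type u} [∀ x, AddCommGroup (V x)] [∀ x, Module ℂ (V x)]
    (D : LocalTrivData (E := E) (F := ℂ) V) (a : X) (s : ∀ x, V x) (g : X → ℂ)
    (hg : ∀ᶠ x in 𝓝 a, ∀ h : x ∈ D.dom a, D.triv a x h (s x) = g x) :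
    IsFrameAt D.toBundle a s ↔ ContMDiffAt 𝓘(ℂ, E) 𝓘(ℂ, ℂ) ω g a ∧ g a ≠ 0 := by
  refine (isFrameAt_iff D.toBundle a s).trans ?_
  have hd := (D.isOpen_dom a).mem_nhds (D.mem_dom a)
  have h0 : D.triv a a (D.mem_dom a) (s a) = g a := hg.self_of_nhds _
  refine and_congr (Filter.EventuallyEq.contMDiffAt_iff ?_) (not_congr ?_)
  · filter_upwards [hg, hd] with x hx hxd
    rw [← hx hxd]
    exact congrArg Prod.snd (D.toBundle_trivializationAt a hxd (s x))
  · rw [← h0]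
    exact (LinearEquiv.map_eq_zero_iff _).symm

theorem exists_isFrameAt (L : HolLineBundle E X) (a : X) : ∃ s, IsFrameAt L a s := by
  classical
  have ha := mem_baseSet_trivializationAt ℂ L.Fib a
  refine ⟨fun x => (trivializationAt ℂ L.Fib a).symm x 1, ?_⟩
  have h1 : ∀ x ∈ (trivializationAt ℂ L.Fib a).baseSet, (trivializationAt ℂ L.Fib a
      (⟨x, (trivializationAt ℂ L.Fib a).symm x 1⟩ : L.Total)).2 = 1 := fun x hx => by
    rw [(trivializationAt ℂ L.Fib a).apply_mk_symm hx]
  rw [isFrameAt_iff]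
  constructor
  · refine (contMDiffAt_const (c := (1 : ℂ))).congr_of_eventuallyEq ?_
    filter_upwards [(trivializationAt ℂ L.Fib a).open_baseSet.mem_nhds ha] with x hx
    exact h1 x hx
  · intro h0
    have h2 : coordAt L a a ha ((trivializationAt ℂ L.Fib a).symm a 1) = 1 := h1 a ha
    rw [h0, map_zero] at h2
    exact zero_ne_one h2

theorem contMDiffAt_of_isFrameAt {L L' : HolLineBundle E X} (φ : ∀ x, L.Fib x →ₗ[ℂ] L'.Fib x)
    (v : L.Total) (s : ∀ x, L.Fib x)
    (hs : IsFrameAt L v.1 s) (hs' : IsFrameAt L' v.1 (fun x => φ x (s x))) :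
    ContMDiffAt (𝓘(ℂ, E).prod 𝓘(ℂ, ℂ)) (𝓘(ℂ, E).prod 𝓘(ℂ, ℂ)) ω
      (fun v : L.Total => (⟨v.1, φ v.1 v.2⟩ : L'.Total)) v := by
  rw [contMDiffAt_totalSpace]
  refine ⟨contMDiffAt_proj _, ?_⟩
  obtain ⟨a, v⟩ := v
  have ha := mem_baseSet_trivializationAt ℂ L.Fib a
  have ha' := mem_baseSet_trivializationAt ℂ L'.Fib a
  have h0 := hs.coord_ne_zero
  rw [isFrameAt_iff] at hs hs'
  have hπ : ContMDiffAt (𝓘(ℂ, E).prod 𝓘(ℂ, ℂ)) 𝓘(ℂ, E) ω (π ℂ L.Fib) ⟨a, v⟩ :=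
    contMDiffAt_proj _
  have hid : ContMDiffAt (𝓘(ℂ, E).prod 𝓘(ℂ, ℂ)) (𝓘(ℂ, E).prod 𝓘(ℂ, ℂ)) ω
      (fun w : L.Total => w) ⟨a, v⟩ := contMDiffAt_id
  rw [contMDiffAt_totalSpace] at hid
  have h1 := ContMDiffAt.comp (⟨a, v⟩ : L.Total) (f := π ℂ L.Fib) hs.1 hπ
  have h2 := ContMDiffAt.comp (⟨a, v⟩ : L.Total) (f := π ℂ L.Fib) hs'.1 hπ
  have h3 := (hid.2.mul (h1.inv₀ h0)).mul h2
  refine h3.congr_of_eventuallyEq ?_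
  have hU : ∀ᶠ x in 𝓝 a, x ∈ (trivializationAt ℂ L.Fib a).baseSet ∧
      x ∈ (trivializationAt ℂ L'.Fib a).baseSet ∧
      (trivializationAt ℂ L.Fib a (⟨x, s x⟩ : L.Total)).2 ≠ 0 := by
    filter_upwards [(trivializationAt ℂ L.Fib a).open_baseSet.mem_nhds ha,
      (trivializationAt ℂ L'.Fib a).open_baseSet.mem_nhds ha',
      hs.1.continuousAt.eventually_ne h0] with x h1 h2 h3 using ⟨h1, h2, h3⟩
  filter_upwards [hπ.continuousAt.eventually hU] with w hw
  obtain ⟨x, w⟩ := w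
  obtain ⟨hx, hx', hne⟩ := hw
  change coordAt L' a x hx' (φ x w) = coordAt L a x hx w * (coordAt L a x hx (s x))⁻¹ *
    coordAt L' a x hx' (φ x (s x))
  change coordAt L a x hx (s x) ≠ 0 at hne
  have hw : w = (coordAt L a x hx w * (coordAt L a x hx (s x))⁻¹) • s x := by
    apply (coordAt L a x hx).injective
    rw [map_smul, smul_eq_mul]
    field_simp
  conv_lhs => rw [hw]
  rw [map_smul, map_smul, smul_eq_mul]

theorem isom_of_frames {L L' : HolLineBundle E X} (φ : ∀ x, L.Fib x ≃ₗ[ℂ] L'.Fib x)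
    (h : ∀ a, ∃ s, IsFrameAt L a s ∧ IsFrameAt L' a (fun x => φ x (s x))) : L.Isom L' := by
  refine ⟨φ, fun v => ?_, fun v => ?_⟩
  · obtain ⟨s, hs, hs'⟩ := h v.1
    exact contMDiffAt_of_isFrameAt (fun x => (φ x : L.Fib x →ₗ[ℂ] L'.Fib x)) v s hs hs'
  · obtain ⟨s, hs, hs'⟩ := h v.1
    refine contMDiffAt_of_isFrameAt (fun x => ((φ x).symm : L'.Fib x →ₗ[ℂ] L.Fib x)) v _ hs' ?_
    simpa using hs

theorem IsFrameAt.map {L L' : HolLineBundle E X} {φ : ∀ x, L.Fib x ≃ₗ[ℂ] L'.Fib x}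
    (hφ : ContMDiff (𝓘(ℂ, E).prod 𝓘(ℂ, ℂ)) (𝓘(ℂ, E).prod 𝓘(ℂ, ℂ)) ω
      (fun v : L.Total => (⟨v.1, φ v.1 v.2⟩ : L'.Total)))
    {a : X} {s : ∀ x, L.Fib x} (hs : IsFrameAt L a s) : IsFrameAt L' a (fun x => φ x (s x)) :=
  ⟨(hφ _).comp a hs.1, by simpa using hs.2⟩

/-! #### Tensor product -/

/-- Trivializations of the fibrewise tensor product. -/
def tensorData (L M : HolLineBundle E X) :
    LocalTrivData (E := E) (F := ℂ) (fun x => L.Fib x ⊗[ℂ] M.Fib x) :=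
  lineData _
    (fun a => (trivializationAt ℂ L.Fib a).baseSet ∩ (trivializationAt ℂ M.Fib a).baseSet)
    (fun a => (trivializationAt ℂ L.Fib a).open_baseSet.inter
      (trivializationAt ℂ M.Fib a).open_baseSet)
    (fun a => ⟨mem_baseSet_trivializationAt ℂ L.Fib a, mem_baseSet_trivializationAt ℂ M.Fib a⟩)
    (fun a x h => (TensorProduct.congr (coordAt L a x h.1) (coordAt M a x h.2)).trans
      (TensorProduct.lid ℂ ℂ))
    (fun a b => by
      obtain ⟨g, hg, hg'⟩ := exists_transition L a b
      obtain ⟨k, hk, hk'⟩ := exists_transition M a b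
      refine ⟨fun x => g x * k x, (hg.mono ?_).mul (hk.mono ?_), ?_⟩
      · exact fun x hx => ⟨hx.1.1, hx.2.1⟩
      · exact fun x hx => ⟨hx.1.2, hx.2.2⟩
      · intro x ha hb
        simp [← hg' x ha.1 hb.1, ← hk' x ha.2 hb.2])

/-- The tensor product `L ⊗ M`, with fibres `L_x ⊗ M_x`. -/
def tensor (L M : HolLineBundle E X) : HolLineBundle E X := (tensorData L M).toBundle

theorem IsFrameAt.tensor {L M : HolLineBundle E X} {a : X} {s : ∀ x, L.Fib x} {t : ∀ x, M.Fib x}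
    (hs : IsFrameAt L a s) (ht : IsFrameAt M a t) :
    IsFrameAt (tensor L M) a (fun x => s x ⊗ₜ[ℂ] t x) := by
  refine (toBundle_isFrameAt_iff (tensorData L M) a _
    (fun x => (trivializationAt ℂ L.Fib a (⟨x, s x⟩ : L.Total)).2 *
      (trivializationAt ℂ M.Fib a (⟨x, t x⟩ : M.Total)).2) ?_).2 ⟨?_, ?_⟩
  · refine Filter.Eventually.of_forall fun x hx => ?_
    change TensorProduct.lid ℂ ℂ (TensorProduct.congr (coordAt L a x hx.1) (coordAt M a x hx.2)
      (s x ⊗ₜ t x)) = _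
    simp [coordAt]
  · exact ((isFrameAt_iff L a s).1 hs).1.mul ((isFrameAt_iff M a t).1 ht).1
  · exact mul_ne_zero hs.coord_ne_zero ht.coord_ne_zero

theorem tensor_congr {L L' M M' : HolLineBundle E X} (h : L.Isom L') (h' : M.Isom M') :
    (tensor L M).Isom (tensor L' M') := by
  obtain ⟨φ, h1, -⟩ := h
  obtain ⟨ψ, h3, -⟩ := h'
  refine isom_of_frames (L := tensor L M) (L' := tensor L' M')
    (fun x => TensorProduct.congr (φ x) (ψ x)) fun a => ?_
  obtain ⟨s, hs⟩ := exists_isFrameAt L a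
  obtain ⟨t, ht⟩ := exists_isFrameAt M a
  exact ⟨_, hs.tensor ht, (hs.map h1).tensor (ht.map h3)⟩

theorem tensor_comm (L M : HolLineBundle E X) : (tensor L M).Isom (tensor M L) := by
  refine isom_of_frames (L := tensor L M) (L' := tensor M L)
    (fun x => TensorProduct.comm ℂ (L.Fib x) (M.Fib x)) fun a => ?_
  obtain ⟨s, hs⟩ := exists_isFrameAt L a
  obtain ⟨t, ht⟩ := exists_isFrameAt M a
  exact ⟨_, hs.tensor ht, ht.tensor hs⟩

theorem tensor_assoc (L M N : HolLineBundle E X) :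
    (tensor (tensor L M) N).Isom (tensor L (tensor M N)) := by
  refine isom_of_frames (L := tensor (tensor L M) N) (L' := tensor L (tensor M N))
    (fun x => TensorProduct.assoc ℂ (L.Fib x) (M.Fib x) (N.Fib x)) fun a => ?_
  obtain ⟨s, hs⟩ := exists_isFrameAt L a
  obtain ⟨t, ht⟩ := exists_isFrameAt M a
  obtain ⟨r, hr⟩ := exists_isFrameAt N a
  exact ⟨_, (hs.tensor ht).tensor hr, hs.tensor (ht.tensor hr)⟩

/-! #### Trivial bundle -/

variable (E X) in
/-- The product trivialization. -/
def trivialData : LocalTrivData (E := E) (F := ℂ) (fun _ : X => ULift.{u} ℂ) :=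
  lineData _ (fun _ => univ) (fun _ => isOpen_univ) (fun _ => mem_univ _)
    (fun _ _ _ => ULift.moduleEquiv)
    (fun _ _ => ⟨fun _ => 1, contMDiffOn_const, fun _ _ _ => by simp⟩)

variable (E X) in
/-- The trivial line bundle `X × ℂ`. -/
def trivialBundle : HolLineBundle E X := (trivialData E X).toBundle

theorem isFrameAt_trivialBundle (a : X) : IsFrameAt (trivialBundle E X) a (fun _ => (ULift.up 1 : ULift ℂ)) :=
  (toBundle_isFrameAt_iff (trivialData E X) a _ (fun _ => 1)
    (Filter.Eventually.of_forall fun _ _ => rfl)).2 ⟨contMDiffAt_const, one_ne_zero⟩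

theorem trivialBundle_tensor (L : HolLineBundle E X) : (tensor (trivialBundle E X) L).Isom L := by
  refine isom_of_frames (L := tensor (trivialBundle E X) L) (L' := L)
    (fun x => (TensorProduct.congr ULift.moduleEquiv (LinearEquiv.refl ℂ (L.Fib x))).trans
      (TensorProduct.lid ℂ (L.Fib x))) fun a => ?_
  obtain ⟨s, hs⟩ := exists_isFrameAt L a
  refine ⟨_, (isFrameAt_trivialBundle a).tensor hs, ?_⟩
  convert hs using 2 with x
  change TensorProduct.lid ℂ (L.Fib x) (TensorProduct.congr ULift.moduleEquiv
    (LinearEquiv.refl ℂ (L.Fib x)) ((ULift.up 1 : ULift.{u} ℂ) ⊗ₜ s x)) = _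
  simp

/-! #### Dual bundle -/

/-- Trivializations of the fibrewise dual. -/
def dualData (L : HolLineBundle E X) :
    LocalTrivData (E := E) (F := ℂ) (fun x => Module.Dual ℂ (L.Fib x)) :=
  lineData _
    (fun a => (trivializationAt ℂ L.Fib a).baseSet)
    (fun a => (trivializationAt ℂ L.Fib a).open_baseSet)
    (fun a => mem_baseSet_trivializationAt ℂ L.Fib a)
    (fun a x h => (coordAt L a x h).symm.dualMap.trans (LinearMap.ringLmapEquivSelf ℂ ℂ ℂ))
    (fun a b => by
      obtain ⟨g, hg, hg'⟩ := exists_transition L b a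
      refine ⟨g, hg.mono fun x hx => ⟨hx.2, hx.1⟩, ?_⟩
      intro x ha hb
      rw [← hg' x hb ha]
      simp [LinearEquiv.dualMap_symm])

/-- The dual line bundle, with fibres the dual spaces. -/
def dual (L : HolLineBundle E X) : HolLineBundle E X := (dualData L).toBundle

theorem IsFrameAt.dual {L : HolLineBundle E X} {a : X} {s : ∀ x, L.Fib x}
    (hs : IsFrameAt L a s) {t : ∀ x, Module.Dual ℂ (L.Fib x)}
    (hst : ∀ᶠ x in 𝓝 a, t x (s x) = 1) :
    IsFrameAt (dual L) a t := by
  have h0 := hs.coord_ne_zero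
  have hs' := ((isFrameAt_iff L a s).1 hs).1
  refine (toBundle_isFrameAt_iff (dualData L) a _
    (fun x => ((trivializationAt ℂ L.Fib a (⟨x, s x⟩ : L.Total)).2)⁻¹) ?_).2 ⟨?_, ?_⟩
  · filter_upwards [hst] with x hx1 hx
    change t x ((coordAt L a x hx).symm 1) = (coordAt L a x hx (s x))⁻¹
    have h2 : s x = coordAt L a x hx (s x) • (coordAt L a x hx).symm 1 := by
      rw [← map_smul, smul_eq_mul, mul_one, LinearEquiv.symm_apply_apply]
    rw [h2, map_smul, smul_eq_mul] at hx1
    exact eq_inv_of_mul_eq_one_right hx1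
  · exact hs'.inv₀ h0
  · exact inv_ne_zero h0

theorem exists_dual_frame {L : HolLineBundle E X} {a : X} {s : ∀ x, L.Fib x}
    (hs : IsFrameAt L a s) :
    ∃ t : ∀ x, Module.Dual ℂ (L.Fib x), ∀ᶠ x in 𝓝 a, t x (s x) = 1 := by
  classical
  have ha := mem_baseSet_trivializationAt ℂ L.Fib a
  have h0 := hs.coord_ne_zero
  have hs' := ((isFrameAt_iff L a s).1 hs).1
  refine ⟨fun x => if h : x ∈ (trivializationAt ℂ L.Fib a).baseSet then
    (coordAt L a x h (s x))⁻¹ • (coordAt L a x h : L.Fib x →ₗ[ℂ] ℂ) else 0, ?_⟩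
  filter_upwards [(trivializationAt ℂ L.Fib a).open_baseSet.mem_nhds ha,
    hs'.continuousAt.eventually_ne h0] with x hx hne
  change coordAt L a x hx (s x) ≠ 0 at hne
  simp [hx, hne]

theorem dual_congr {L L' : HolLineBundle E X} (h : L.Isom L') : (dual L).Isom (dual L') := by
  obtain ⟨φ, h1, -⟩ := h
  refine isom_of_frames (L := dual L) (L' := dual L')
    (fun x => (φ x).symm.dualMap) fun a => ?_
  obtain ⟨s, hs⟩ := exists_isFrameAt L a
  obtain ⟨t, ht⟩ := exists_dual_frame hs
  refine ⟨t, hs.dual ht, (hs.map h1).dual ?_⟩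
  filter_upwards [ht] with x hx
  change t x ((φ x).symm (φ x (s x))) = 1
  rwa [LinearEquiv.symm_apply_apply]

theorem dual_tensor (L : HolLineBundle E X) : (tensor (dual L) L).Isom (trivialBundle E X) := by
  have key : ∀ x, ∃ φ : (Module.Dual ℂ (L.Fib x) ⊗[ℂ] L.Fib x) ≃ₗ[ℂ] ULift.{u} ℂ,
      ∀ f v, φ (f ⊗ₜ v) = ULift.up (f v) := fun x => by
    let c := coordAt L x x (mem_baseSet_trivializationAt ℂ L.Fib x)
    refine ⟨((TensorProduct.congr (c.symm.dualMap.trans (LinearMap.ringLmapEquivSelf ℂ ℂ ℂ))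
      c).trans (TensorProduct.lid ℂ ℂ)).trans ULift.moduleEquiv.symm, fun f v => ?_⟩
    have h2 : v = c v • c.symm 1 := by
      rw [← map_smul, smul_eq_mul, mul_one, LinearEquiv.symm_apply_apply]
    conv_rhs => rw [h2, map_smul]
    apply ULift.ext
    simp [mul_comm]
  choose φ hφ using key
  refine isom_of_frames (L := tensor (dual L) L) (L' := trivialBundle E X) φ fun a => ?_
  obtain ⟨s, hs⟩ := exists_isFrameAt L a
  obtain ⟨t, ht⟩ := exists_dual_frame hs
  refine ⟨_, (hs.dual ht).tensor hs, ?_⟩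
  refine (toBundle_isFrameAt_iff (trivialData E X) a _ (fun _ => 1) ?_).2
    ⟨contMDiffAt_const, one_ne_zero⟩
  filter_upwards [ht] with x hx _
  change (φ x (t x ⊗ₜ s x)).down = 1
  rw [hφ, hx]

variable (E X) in
/-- Isomorphism as an equivalence relation on line bundles. -/
@[reducible] def isomSetoid : Setoid (HolLineBundle E X) where
  r L M := L.Isom M
  iseqv := ⟨HolVectorBundle.Isom.refl, HolVectorBundle.Isom.symm, HolVectorBundle.Isom.trans⟩

end HolLineBundle

open HolLineBundle

variable (E X) in
/-- The Picard group: isomorphism classes of holomorphic line bundles. -/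
def Pic := Quotient (isomSetoid E X)

/-- The class of a line bundle in the Picard group. -/
def Pic.mk (L : HolLineBundle E X) : Pic E X := Quotient.mk (isomSetoid E X) L

/-- The group structure is given by the tensor product. -/
instance Pic.instCommGroup : CommGroup (Pic E X) where
  mul := Quotient.map₂ tensor fun _ _ h _ _ h' => tensor_congr h h'
  one := Pic.mk (trivialBundle E X)
  inv := Quotient.map dual fun _ _ h => dual_congr h
  mul_assoc := by
    rintro ⟨L⟩ ⟨M⟩ ⟨N⟩
    exact Quotient.sound (tensor_assoc L M N)
  mul_comm := by
    rintro ⟨L⟩ ⟨M⟩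
    exact Quotient.sound (tensor_comm L M)
  one_mul := by
    rintro ⟨L⟩
    exact Quotient.sound (trivialBundle_tensor L)
  mul_one := by
    rintro ⟨L⟩
    exact Quotient.sound ((tensor_comm _ _).trans (trivialBundle_tensor L))
  inv_mul_cancel := by
    rintro ⟨L⟩
    exact Quotient.sound (dual_tensor L)

end Picard

/-! ### The torus `H = (ℂˣ)^p` and its characters -/

section Torus

/-- The algebraic torus `(ℂˣ)^p`. -/
abbrev Torus (p : ℕ) := Fin p → ℂˣ

/-- `(ℂˣ)^p` as an open subset of `ℂ^p`. -/
def torusSet (p : ℕ) : Set (Fin p → ℂ) := {z | ∀ i, z i ≠ 0}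

open Classical in
/-- The point of `(ℂˣ)^p` with coordinates `z ∈ torusSet p` (vanishing coordinates, which do not
occur for `z ∈ torusSet p`, are replaced by `1`). -/
def toTorus {p : ℕ} (z : Fin p → ℂ) : Torus p :=
  fun i => if h : z i = 0 then 1 else Units.mk0 (z i) h

/-- A map `(ℂˣ)^p → ℂˣ` is holomorphic: it is holomorphic as a function on the open subset
`torusSet p` of `ℂ^p`. -/
def IsHolomorphicOnTorus {p : ℕ} (f : Torus p → ℂˣ) : Prop :=
  ContDiffOn ℂ ω (fun z : Fin p → ℂ => (f (toTorus z) : ℂ)) (torusSet p)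

/-- The group of holomorphic characters `(ℂˣ)^p → ℂˣ`. -/
def CharGroup (p : ℕ) : Subgroup (Torus p →* ℂˣ) where
  carrier := {χ | IsHolomorphicOnTorus χ}
  mul_mem' {χ ψ} hχ hψ := by
    simp only [mem_ofPred_eq, IsHolomorphicOnTorus, MonoidHom.mul_apply, Units.val_mul] at *
    exact hχ.mul hψ
  one_mem' := by
    simp only [mem_ofPred_eq, IsHolomorphicOnTorus, MonoidHom.one_apply, Units.val_one]
    exact contDiffOn_const
  inv_mem' {χ} hχ := by
    simp only [mem_ofPred_eq, IsHolomorphicOnTorus, MonoidHom.inv_apply, Units.val_inv_eq_inv_val]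
      at *
    exact hχ.inv fun z _ => Units.ne_zero _

theorem isOpen_torusSet (p : ℕ) : IsOpen (torusSet p) := by
  have : torusSet p = ⋂ i, {z | z i ≠ 0} := by ext; simp [torusSet]
  rw [this]
  exact isOpen_iInter_of_finite fun i => isOpen_ne_fun (continuous_apply i) continuous_const

theorem val_toTorus {p : ℕ} {z : Fin p → ℂ} (hz : z ∈ torusSet p) (i : Fin p) :
    (toTorus z i : ℂ) = z i := by
  simp [toTorus, hz i]

theorem toTorus_mul {p : ℕ} {z w : Fin p → ℂ} (hz : z ∈ torusSet p) (hw : w ∈ torusSet p) :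
    toTorus (fun i => z i * w i) = toTorus z * toTorus w := by
  funext i
  apply Units.ext
  have hzw : (fun i => z i * w i) ∈ torusSet p := fun i => mul_ne_zero (hz i) (hw i)
  rw [Pi.mul_apply, Units.val_mul, val_toTorus hz, val_toTorus hw, val_toTorus hzw]

theorem toTorus_val {p : ℕ} (h : Torus p) : toTorus (fun i => (h i : ℂ)) = h := by
  funext i
  apply Units.ext
  exact val_toTorus (z := fun i => (h i : ℂ)) (fun i => (h i).ne_zero) i

theorem val_mem_torusSet {p : ℕ} (h : Torus p) : (fun i => (h i : ℂ)) ∈ torusSet p :=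
  fun i => (h i).ne_zero

/-- Automorphisms of the complex Lie group `(ℂˣ)^p`: group automorphisms which are holomorphic,
together with their inverse. -/
def IsTorusAut {p : ℕ} (σ : Torus p ≃* Torus p) : Prop :=
  (∀ i, IsHolomorphicOnTorus fun h => σ h i) ∧ (∀ i, IsHolomorphicOnTorus fun h => σ.symm h i)

end Torus

/-! ### Principal `(ℂˣ)^p`-bundles -/

section Principal

variable (E : Type v) [NormedAddCommGroup E] [NormedSpace ℂ E] (p : ℕ)
  (X : Type u) [TopologicalSpace X] [ChartedSpace E X]

/-- The model with corners of the total space of a `(ℂˣ)^p`-bundle, a complex manifold of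
dimension `dim X + p`. -/
abbrev totModel : ModelWithCorners ℂ (E × (Fin p → ℂ)) (ModelProd E (Fin p → ℂ)) :=
  𝓘(ℂ, E).prod 𝓘(ℂ, Fin p → ℂ)

/-- A holomorphic principal `(ℂˣ)^p`-bundle over `X`: a complex manifold `Tot` with a projection to
`X` and an action of `(ℂˣ)^p` preserving the fibres, which is locally over `X` equivariantly
biholomorphic to `U × (ℂˣ)^p`. As the group is commutative, the right action `m h` is written
`h • m`. Holomorphy of the projection and of the action, free and transitive action on the fibres,
and the Hausdorff property (for Hausdorff `X`) all follow from local triviality. -/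
structure TorusBundle where
  /-- the total space -/
  Tot : Type u
  [topTot : TopologicalSpace Tot]
  [chartedTot : ChartedSpace (ModelProd E (Fin p → ℂ)) Tot]
  [manifoldTot : IsManifold (totModel E p) ω Tot]
  [action : MulAction (Torus p) Tot]
  /-- the projection -/
  proj : Tot → X
  proj_smul : ∀ (h : Torus p) (m : Tot), proj (h • m) = proj m
  locallyTrivial : ∀ a : X, ∃ (U : Set X) (e : OpenPartialHomeomorph Tot (X × (Fin p → ℂ))),
    IsOpen U ∧ a ∈ U ∧ e.source = proj ⁻¹' U ∧ e.target = U ×ˢ torusSet p ∧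
    ContMDiffOn (totModel E p) (𝓘(ℂ, E).prod 𝓘(ℂ, Fin p → ℂ)) ω e e.source ∧
    ContMDiffOn (𝓘(ℂ, E).prod 𝓘(ℂ, Fin p → ℂ)) (totModel E p) ω e.symm e.target ∧
    (∀ m ∈ e.source, (e m).1 = proj m) ∧
    ∀ (h : Torus p), ∀ m ∈ e.source, ∀ i, (e (h • m)).2 i = (e m).2 i * h i

attribute [instance] TorusBundle.topTot TorusBundle.chartedTot TorusBundle.manifoldTot
  TorusBundle.action

variable {E p X}

namespace TorusBundle

variable (M N : TorusBundle E p X)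

/-- `φ : M → N` is an isomorphism up to a twist by the automorphism `σ` of `(ℂˣ)^p`, i.e. an
isomorphism of principal bundles from `M` to the bundle `N^σ`, which is `N` with the
action `(m, h) ↦ m σ(h)`. -/
def IsTwistedIso (σ : Torus p ≃* Torus p)
    (φ : Diffeomorph (totModel E p) (totModel E p) M.Tot N.Tot ω) : Prop :=
  (∀ m, N.proj (φ m) = M.proj m) ∧ ∀ (h : Torus p) m, φ (h • m) = σ h • φ m

/-- `M` is isomorphic to `N` up to a twist by an automorphism of `(ℂˣ)^p`. -/
def IsomUpToTwist : Prop :=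
  ∃ σ : Torus p ≃* Torus p, IsTorusAut σ ∧ ∃ φ, M.IsTwistedIso N σ φ

/-! #### The character map -/

/-- The domain of the chosen local trivialization around `a`. -/
def dom (a : X) : Set X := (M.locallyTrivial a).choose

/-- The chosen local trivialization around `a`. -/
def triv (a : X) : OpenPartialHomeomorph M.Tot (X × (Fin p → ℂ)) :=
  (M.locallyTrivial a).choose_spec.choose

theorem triv_spec (a : X) : IsOpen (M.dom a) ∧ a ∈ M.dom a ∧
    (M.triv a).source = M.proj ⁻¹' (M.dom a) ∧ (M.triv a).target = M.dom a ×ˢ torusSet p ∧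
    ContMDiffOn (totModel E p) (𝓘(ℂ, E).prod 𝓘(ℂ, Fin p → ℂ)) ω (M.triv a) (M.triv a).source ∧
    ContMDiffOn (𝓘(ℂ, E).prod 𝓘(ℂ, Fin p → ℂ)) (totModel E p) ω (M.triv a).symm
      (M.triv a).target ∧
    (∀ m ∈ (M.triv a).source, (M.triv a m).1 = M.proj m) ∧
    ∀ (h : Torus p), ∀ m ∈ (M.triv a).source, ∀ i,
      (M.triv a (h • m)).2 i = (M.triv a m).2 i * h i :=
  (M.locallyTrivial a).choose_spec.choose_spec

/-- The `(ℂˣ)^p`-component of the chosen local trivialization around `a`. -/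
def comp (a : X) (m : M.Tot) : Torus p := toTorus (M.triv a m).2

variable {M}

theorem triv_mem {a : X} {m : M.Tot} (hm : M.proj m ∈ M.dom a) :
    (M.triv a m).2 ∈ torusSet p := by
  have hs := M.triv_spec a
  have h1 : m ∈ (M.triv a).source := by rw [hs.2.2.1]; exact hm
  have h2 := (M.triv a).map_source h1
  rw [hs.2.2.2.1] at h2
  exact h2.2

theorem comp_smul {a : X} {m : M.Tot} (hm : M.proj m ∈ M.dom a) (h : Torus p) :
    M.comp a (h • m) = h * M.comp a m := by
  have hs := M.triv_spec a
  have h1 : m ∈ (M.triv a).source := by rw [hs.2.2.1]; exact hm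
  rw [comp, comp, mul_comm, ← toTorus_val h, ← toTorus_mul (triv_mem hm) (val_mem_torusSet h),
    toTorus_val]
  congr 1
  funext i
  exact hs.2.2.2.2.2.2.2 h m h1 i

theorem eq_of_comp_eq {a : X} {m m' : M.Tot} (hm : M.proj m ∈ M.dom a)
    (hp : M.proj m' = M.proj m) (h : M.comp a m = M.comp a m') : m = m' := by
  have hs := M.triv_spec a
  have hm' : M.proj m' ∈ M.dom a := hp ▸ hm
  have h1 : m ∈ (M.triv a).source := by rw [hs.2.2.1]; exact hm
  have h1' : m' ∈ (M.triv a).source := by rw [hs.2.2.1]; exact hm'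
  apply (M.triv a).injOn h1 h1'
  refine Prod.ext ?_ ?_
  · rw [hs.2.2.2.2.2.2.1 m h1, hs.2.2.2.2.2.2.1 m' h1', hp]
  · funext i
    rw [← val_toTorus (triv_mem hm), ← val_toTorus (triv_mem hm')]
    exact congrArg Units.val (congrFun h i)

theorem exists_smul_eq {m m' : M.Tot} (hp : M.proj m' = M.proj m) : ∃ h : Torus p, m' = h • m := by
  have hm := (M.triv_spec (M.proj m)).2.1
  refine ⟨M.comp (M.proj m) m' * (M.comp (M.proj m) m)⁻¹, ?_⟩
  refine eq_of_comp_eq (a := M.proj m) (hp ▸ hm) ?_ ?_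
  · rw [M.proj_smul, hp]
  · rw [comp_smul hm, inv_mul_cancel_right]

theorem exists_proj_eq (x : X) : ∃ m : M.Tot, M.proj m = x := by
  have hs := M.triv_spec x
  have h1 : ((x, fun _ => 1) : X × (Fin p → ℂ)) ∈ (M.triv x).target := by
    rw [hs.2.2.2.1]
    exact ⟨hs.2.1, fun i => one_ne_zero⟩
  refine ⟨(M.triv x).symm (x, fun _ => 1), ?_⟩
  rw [← hs.2.2.2.2.2.2.1 _ ((M.triv x).map_target h1), (M.triv x).right_inv h1]

variable (M)

/-- The equivalence relation `(m, c) ∼ (m h⁻¹, χ(h) c)` on `M_x × ℂ`, where `M_x` is the fibre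
over `x`. -/
def assocSetoid (χ : Torus p →* ℂˣ) (x : X) : Setoid ({m : M.Tot // M.proj m = x} × ℂ) where
  r y z := ∃ h : Torus p, z.1.1 = h⁻¹ • y.1.1 ∧ z.2 = χ h * y.2
  iseqv := by
    refine ⟨fun y => ⟨1, by simp, by simp⟩, ?_, ?_⟩
    · rintro y z ⟨h, h1, h2⟩
      exact ⟨h⁻¹, by simp [h1], by simp [h2]⟩
    · rintro y z w ⟨h, h1, h2⟩ ⟨k, k1, k2⟩
      refine ⟨k * h, ?_, ?_⟩
      · rw [k1, h1, smul_smul, mul_inv]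
      · rw [k2, h2, map_mul, Units.val_mul, mul_assoc]

/-- The fibre over `x` of `(M × ℂ_χ) / (ℂˣ)^p`. -/
def AssocFib (χ : Torus p →* ℂˣ) (x : X) : Type u := Quotient (M.assocSetoid χ x)

variable {M}

/-- The class `[m, c]`. -/
def AssocFib.mk (χ : Torus p →* ℂˣ) {x : X} (m : {m : M.Tot // M.proj m = x}) (c : ℂ) :
    M.AssocFib χ x := Quotient.mk (M.assocSetoid χ x) (m, c)

theorem AssocFib.mk_bijective (χ : Torus p →* ℂˣ) {x : X} (m : {m : M.Tot // M.proj m = x}) :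
    Function.Bijective (AssocFib.mk χ m) := by
  have hm : M.proj m.1 ∈ M.dom x := m.2.symm ▸ (M.triv_spec x).2.1
  constructor
  · intro c d hcd
    obtain ⟨h, h1, h2⟩ := Quotient.exact hcd
    have h3 := congrArg (M.comp x) h1
    rw [comp_smul hm] at h3
    have h4 : h = 1 := by simpa using h3
    simpa [h4] using h2.symm
  · rintro ⟨⟨m', c⟩⟩
    obtain ⟨h, hh⟩ := exists_smul_eq (M := M) (m'.2.trans m.2.symm)
    refine ⟨χ h * c, Quotient.sound (s := M.assocSetoid χ x) ?_⟩
    refine (M.assocSetoid χ x).symm ⟨h, ?_, rfl⟩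
    simp [hh]

/-- For a fixed point `m` of the fibre `M_x`, the bijection `c ↦ [m, c]`. -/
def AssocFib.equiv (χ : Torus p →* ℂˣ) {x : X} (m : {m : M.Tot // M.proj m = x}) :
    ℂ ≃ M.AssocFib χ x := Equiv.ofBijective _ (AssocFib.mk_bijective χ m)

/-- A point of the fibre over `x`. -/
def basePoint (M : TorusBundle E p X) (x : X) : {m : M.Tot // M.proj m = x} :=
  ⟨(exists_proj_eq x).choose, (exists_proj_eq x).choose_spec⟩

/-- The vector space structure on the fibre of the associated bundle, for which `c ↦ [m, c]` is
linear; by `AssocFib.mk_add` and `AssocFib.mk_smul` it does not depend on `m`. -/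
instance (χ : Torus p →* ℂˣ) (x : X) : AddCommGroup (M.AssocFib χ x) :=
  (AssocFib.equiv χ (M.basePoint x)).symm.addCommGroup

instance (χ : Torus p →* ℂˣ) (x : X) : Module ℂ (M.AssocFib χ x) :=
  (AssocFib.equiv χ (M.basePoint x)).symm.module ℂ

/-- `c ↦ [m, c]` as a linear isomorphism. -/
theorem AssocFib.exists_linearEquiv (χ : Torus p →* ℂˣ) {x : X} (m : {m : M.Tot // M.proj m = x}) :
    ∃ f : ℂ ≃ₗ[ℂ] M.AssocFib χ x, ∀ c, f c = AssocFib.mk χ m c := by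
  let f₀ : ℂ ≃ₗ[ℂ] M.AssocFib χ x :=
    ((AssocFib.equiv χ (M.basePoint x)).symm.linearEquiv ℂ).symm
  have hf₀ : ∀ c, f₀ c = AssocFib.mk χ (M.basePoint x) c := fun c => rfl
  obtain ⟨h, hh⟩ := exists_smul_eq (M := M) (m.2.trans (M.basePoint x).2.symm)
  refine ⟨(LinearEquiv.smulOfUnit (χ h)).trans f₀, fun c => ?_⟩
  refine (hf₀ _).trans (Quotient.sound (s := M.assocSetoid χ x) ?_)
  refine (M.assocSetoid χ x).symm ⟨h, ?_, rfl⟩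
  simp [hh]

theorem AssocFib.mk_add (χ : Torus p →* ℂˣ) {x : X} (m : {m : M.Tot // M.proj m = x}) (c d : ℂ) :
    AssocFib.mk χ m (c + d) = AssocFib.mk χ m c + AssocFib.mk χ m d := by
  obtain ⟨f, hf⟩ := AssocFib.exists_linearEquiv χ m
  rw [← hf, ← hf, ← hf, map_add]

theorem AssocFib.mk_smul (χ : Torus p →* ℂˣ) {x : X} (m : {m : M.Tot // M.proj m = x}) (c d : ℂ) :
    AssocFib.mk χ m (c * d) = c • AssocFib.mk χ m d := by
  obtain ⟨f, hf⟩ := AssocFib.exists_linearEquiv χ m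
  rw [← hf, ← hf, ← map_smul, smul_eq_mul]

/-- The local section of `M` over `dom a` with `comp a = 1`. -/
def localSec (M : TorusBundle E p X) (a x : X) (h : x ∈ M.dom a) : {m : M.Tot // M.proj m = x} :=
  ⟨(M.triv a).symm (x, fun _ => 1), by
    have hs := M.triv_spec a
    have h1 : ((x, fun _ => 1) : X × (Fin p → ℂ)) ∈ (M.triv a).target := by
      rw [hs.2.2.2.1]
      exact ⟨h, fun i => one_ne_zero⟩
    rw [← hs.2.2.2.2.2.2.1 _ ((M.triv a).map_target h1), (M.triv a).right_inv h1]⟩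

theorem comp_localSec {a x : X} (h : x ∈ M.dom a) : M.comp a (M.localSec a x h).1 = 1 := by
  have hs := M.triv_spec a
  have h1 : ((x, fun _ => 1) : X × (Fin p → ℂ)) ∈ (M.triv a).target := by
    rw [hs.2.2.2.1]
    exact ⟨h, fun i => one_ne_zero⟩
  rw [comp, localSec, (M.triv a).right_inv h1]
  exact toTorus_val (1 : Torus p)

/-- The local trivialization `[s_a(x), c] ↦ c` of the associated bundle, `s_a` being the local
section of `M` near `a`. -/
def assocTriv (χ : Torus p →* ℂˣ) (a x : X) (h : x ∈ M.dom a) : M.AssocFib χ x ≃ₗ[ℂ] ℂ :=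
  (AssocFib.exists_linearEquiv χ (M.localSec a x h)).choose.symm

theorem assocTriv_symm (χ : Torus p →* ℂˣ) (a x : X) (h : x ∈ M.dom a) (c : ℂ) :
    (M.assocTriv χ a x h).symm c = AssocFib.mk χ (M.localSec a x h) c :=
  (AssocFib.exists_linearEquiv χ (M.localSec a x h)).choose_spec c

theorem assocTriv_mk (χ : Torus p →* ℂˣ) (a x : X) (h : x ∈ M.dom a)
    (m : {m : M.Tot // M.proj m = x}) (c : ℂ) :
    M.assocTriv χ a x h (AssocFib.mk χ m c) = χ (M.comp a m.1) * c := by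
  rw [← LinearEquiv.eq_symm_apply, assocTriv_symm]
  refine Quotient.sound (s := M.assocSetoid χ x) ⟨M.comp a m.1, ?_, rfl⟩
  have hm : M.proj m.1 ∈ M.dom a := m.2.symm ▸ h
  refine eq_of_comp_eq (a := a) ((M.localSec a x h).2.symm ▸ h) ?_ ?_
  · rw [M.proj_smul]
    exact m.2.trans (M.localSec a x h).2.symm
  · rw [comp_smul hm, comp_localSec, inv_mul_cancel]

/-- Trivializations of the associated line bundle. -/
def assocData (M : TorusBundle E p X) (χ : CharGroup p) :
    LocalTrivData (E := E) (F := ℂ) (M.AssocFib χ.1) :=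
  HolLineBundle.lineData _ M.dom (fun a => (M.triv_spec a).1) (fun a => (M.triv_spec a).2.1)
    (M.assocTriv χ.1)
    (fun a b => by
      refine ⟨fun x => χ.1 (M.comp b ((M.triv a).symm (x, fun _ => 1))), ?_, ?_⟩
      · have ha := M.triv_spec a
        have hb := M.triv_spec b
        have h1 : ContMDiffOn 𝓘(ℂ, E) (𝓘(ℂ, E).prod 𝓘(ℂ, Fin p → ℂ)) ω
            (fun x : X => ((x, fun _ => 1) : X × (Fin p → ℂ))) (M.dom a ∩ M.dom b) :=
          contMDiffOn_id.prodMk contMDiffOn_const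
        have h2 := ha.2.2.2.2.2.1.comp h1 (by
          intro x hx
          rw [mem_preimage, ha.2.2.2.1]
          exact ⟨hx.1, fun i => one_ne_zero⟩)
        have hpr : ∀ x ∈ M.dom a ∩ M.dom b,
            M.proj ((M.triv a).symm (x, fun _ => 1)) ∈ M.dom b := fun x hx => by
          have := (M.localSec a x hx.1).2
          change M.proj ((M.triv a).symm (x, fun _ => 1)) = x at this
          rw [this]
          exact hx.2
        have h3 := hb.2.2.2.2.1.comp h2 (by
          intro x hx
          rw [mem_preimage, hb.2.2.1]
          exact hpr x hx)
        have h4 := contMDiff_snd.comp_contMDiffOn h3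
        have hχ := (contMDiffOn_iff_contDiffOn.2 χ.2).comp h4 (by
          intro x hx
          exact triv_mem (hpr x hx))
        exact hχ
      · intro x ha hb
        rw [assocTriv_symm, assocTriv_mk, mul_one]
        rfl)

/-- The line bundle `M ×_H ℂ_χ = (M × ℂ_χ) / H` associated with the character `χ` of
`H = (ℂˣ)^p`. -/
def assoc (M : TorusBundle E p X) (χ : CharGroup p) : HolLineBundle E X := (M.assocData χ).toBundle

/-- The character map `χ ↦ M ×_H ℂ_χ`. -/
def charMap (M : TorusBundle E p X) (χ : CharGroup p) : Pic E X := Pic.mk (M.assoc χ)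

/-- The character map is an isomorphism of groups. -/
def CharMapIsIso (M : TorusBundle E p X) : Prop :=
  ∃ f : CharGroup p ≃* Pic E X, ∀ χ, f χ = M.charMap χ

/-! #### Calabi-Yau structures -/

/-- The degree of top forms on the total space. -/
abbrev topDegree (_M : TorusBundle E p X) : ℕ := Module.finrank ℂ E + p

/-- Families of alternating forms of top degree on the tangent spaces of the total space. -/
abbrev TopForm (M : TorusBundle E p X) : Type _ :=
  ∀ m : M.Tot, TangentSpace (totModel E p) m [⋀^Fin M.topDegree]→L[ℂ] ℂ

/-- The expression of a form in the preferred chart at `m₀`: its pullback under the inverse of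
the chart. -/
def TopForm.inChart {M : TorusBundle E p X} (η : M.TopForm) (m₀ : M.Tot) (z : E × (Fin p → ℂ)) :
    (E × (Fin p → ℂ)) [⋀^Fin M.topDegree]→L[ℂ] ℂ :=
  (η ((extChartAt (totModel E p) m₀).symm z)).compContinuousLinearMap
    (mfderiv 𝓘(ℂ, E × (Fin p → ℂ)) (totModel E p) (extChartAt (totModel E p) m₀).symm z)

/-- A form is holomorphic if it is so in every chart. -/
def TopForm.IsHolomorphic {M : TorusBundle E p X} (η : M.TopForm) : Prop :=
  ∀ m₀ : M.Tot, ContDiffOn ℂ ω (η.inChart m₀) (extChartAt (totModel E p) m₀).target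

/-- The pullback of a form under the right translation `m ↦ m h`. -/
def TopForm.translate {M : TorusBundle E p X} (h : Torus p) (η : M.TopForm) : M.TopForm :=
  fun m => (η (h • m)).compContinuousLinearMap
    (mfderiv (totModel E p) (totModel E p) (fun m' : M.Tot => h • m') m)

/-- `M` is a CY bundle: there are a holomorphic character `χ` of `(ℂˣ)^p` and a nowhere vanishing
holomorphic top form `η` on `M` with `Γ_h η = χ(h) η` for all `h`. -/
def IsCY (M : TorusBundle E p X) : Prop :=
  ∃ (χ : CharGroup p) (η : M.TopForm), η.IsHolomorphic ∧ (∀ m, η m ≠ 0) ∧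
    ∀ (h : Torus p) m, η.translate h m = (χ.1 h : ℂ) • η m

end TorusBundle

end Principal

/-! ### The bundle `L₁ˣ ⊕ ⋯ ⊕ L_pˣ` -/

section WhitneySum

variable {E : Type v} [NormedAddCommGroup E] [NormedSpace ℂ E] {p : ℕ}
  {X : Type u} [TopologicalSpace X] [ChartedSpace E X]

/-- Trivializations of the fibrewise direct sum. -/
def directSumData (L : Fin p → HolLineBundle E X) :
    LocalTrivData (E := E) (F := Fin p → ℂ) (fun x => ∀ i, (L i).Fib x) where
  dom a := ⋂ i, (trivializationAt ℂ (L i).Fib a).baseSet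
  isOpen_dom a := isOpen_iInter_of_finite fun i => (trivializationAt ℂ (L i).Fib a).open_baseSet
  mem_dom a := mem_iInter.2 fun i => mem_baseSet_trivializationAt ℂ (L i).Fib a
  triv a x h := LinearEquiv.piCongrRight fun i => HolLineBundle.coordAt (L i) a x (mem_iInter.1 h i)
  transition a b := by
    choose g hg hg' using fun i => HolLineBundle.exists_transition (L i) a b
    refine ⟨fun x => ∑ i, g i x • ((ContinuousLinearMap.single ℂ (fun _ : Fin p => ℂ) i).comp
      (ContinuousLinearMap.proj i)), ?_, ?_⟩
    · refine contMDiffOn_finsetSum fun i _ => ContMDiffOn.smul ((hg i).mono ?_) contMDiffOn_const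
      exact fun x hx => ⟨mem_iInter.1 hx.1 i, mem_iInter.1 hx.2 i⟩
    · intro x ha hb v
      funext j
      have h1 : (HolLineBundle.coordAt (L j) a x (mem_iInter.1 ha j)).symm (v j) =
          v j • (HolLineBundle.coordAt (L j) a x (mem_iInter.1 ha j)).symm 1 := by
        rw [← map_smul, smul_eq_mul, mul_one]
      change _ = HolLineBundle.coordAt (L j) b x (mem_iInter.1 hb j)
        ((HolLineBundle.coordAt (L j) a x (mem_iInter.1 ha j)).symm (v j))
      rw [h1, map_smul, hg' j x (mem_iInter.1 ha j) (mem_iInter.1 hb j)]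
      simp [Finset.sum_apply, Pi.single_apply, mul_comm]

/-- The direct sum `L₁ ⊕ ⋯ ⊕ L_p`, a vector bundle of rank `p`. -/
def directSum (L : Fin p → HolLineBundle E X) : HolVectorBundle E (Fin p → ℂ) X :=
  (directSumData L).toBundle

theorem directSum_mem (L : Fin p → HolLineBundle E X) (a : X) (v : (directSum L).Total)
    (h : v.1 ∈ (directSumData L).dom a) :
    (trivializationAt (Fin p → ℂ) (directSum L).Fib a v).2 ∈ torusSet p ↔
      ∀ i, (v.2 : ∀ i, (L i).Fib v.1) i ≠ 0 := by
  obtain ⟨x, v⟩ := v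
  have h1 := (directSumData L).toBundle_trivializationAt a h v
  refine (iff_of_eq (congrArg (fun z => z.2 ∈ torusSet p) h1)).trans ?_
  refine forall_congr' fun i => not_congr ?_
  exact LinearEquiv.map_eq_zero_iff (HolLineBundle.coordAt (L i) a x (mem_iInter.1 h i))

/-- The total space of `L₁ˣ ⊕ ⋯ ⊕ L_pˣ`: the open subset of the total space of
`L₁ ⊕ ⋯ ⊕ L_p` where all components are nonzero. -/
def sumTimesTot (L : Fin p → HolLineBundle E X) :
    TopologicalSpace.Opens (directSum L).Total where
  carrier := {v | ∀ i, (v.2 : ∀ i, (L i).Fib v.1) i ≠ 0}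
  is_open' := by
    rw [isOpen_iff_mem_nhds]
    intro v hv
    have hs := mem_baseSet_trivializationAt (Fin p → ℂ) (directSum L).Fib v.1
    have h2 : ContinuousAt (trivializationAt (Fin p → ℂ) (directSum L).Fib v.1) v :=
      (trivializationAt (Fin p → ℂ) (directSum L).Fib v.1).continuousAt
        ((trivializationAt (Fin p → ℂ) (directSum L).Fib v.1).mem_source.2 hs)
    have h3 := (continuous_snd.continuousAt.comp h2).preimage_mem_nhds
      ((isOpen_torusSet p).mem_nhds ((directSum_mem L v.1 v ((directSumData L).mem_dom v.1)).2 hv))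
    have h4 := ((FiberBundle.continuous_proj (Fin p → ℂ) (directSum L).Fib).continuousAt
      (x := v)).preimage_mem_nhds
      (((directSumData L).isOpen_dom v.1).mem_nhds ((directSumData L).mem_dom v.1))
    filter_upwards [h3, h4] with w hw hw'
    exact (directSum_mem L v.1 w hw').1 hw

/-- The action of `(ℂˣ)^p` on `L₁ˣ ⊕ ⋯ ⊕ L_pˣ` by componentwise scaling. -/
instance (L : Fin p → HolLineBundle E X) : MulAction (Torus p) (sumTimesTot L) where
  smul h v := ⟨⟨v.1.1, fun i => (h i : ℂ) • (v.1.2 : ∀ i, (L i).Fib v.1.1) i⟩,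
    fun i => smul_ne_zero (h i).ne_zero (v.2 i)⟩
  one_smul v := by
    apply Subtype.ext
    refine congrArg (TotalSpace.mk v.1.1) ?_
    funext i
    exact one_smul ℂ _
  mul_smul h k v := by
    apply Subtype.ext
    refine congrArg (TotalSpace.mk v.1.1) ?_
    funext i
    exact mul_smul (h i : ℂ) (k i : ℂ) _

theorem sumTimes_locallyTrivial [IsManifold 𝓘(ℂ, E) ω X] (L : Fin p → HolLineBundle E X) (a : X) :
    ∃ (U : Set X) (e : OpenPartialHomeomorph (sumTimesTot L) (X × (Fin p → ℂ))),
    IsOpen U ∧ a ∈ U ∧ e.source = (fun v => v.1.1) ⁻¹' U ∧ e.target = U ×ˢ torusSet p ∧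
    ContMDiffOn (totModel E p) (𝓘(ℂ, E).prod 𝓘(ℂ, Fin p → ℂ)) ω e e.source ∧
    ContMDiffOn (𝓘(ℂ, E).prod 𝓘(ℂ, Fin p → ℂ)) (totModel E p) ω e.symm e.target ∧
    (∀ m ∈ e.source, (e m).1 = m.1.1) ∧
    ∀ (h : Torus p), ∀ m ∈ e.source, ∀ i, (e (h • m)).2 i = (e m).2 i * h i := by
  let t := trivializationAt (Fin p → ℂ) (directSum L).Fib a
  have ht : t.baseSet = (directSumData L).dom a := rfl
  have hne : Nonempty (sumTimesTot L) := by
    have ha := (directSumData L).mem_dom a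
    let w : (directSum L).Total := ⟨a, ((directSumData L).triv a a ha).symm fun _ => 1⟩
    refine ⟨⟨w, (directSum_mem L a w ha).1 ?_⟩⟩
    have h1 := (directSumData L).toBundle_trivializationAt a ha w.2
    refine (iff_of_eq (congrArg (fun z => z.2 ∈ torusSet p) h1)).2 ?_
    intro i
    rw [LinearEquiv.apply_symm_apply]
    exact one_ne_zero
  let e := t.toOpenPartialHomeomorph.subtypeRestr hne
  have hsrc : e.source = (fun v : sumTimesTot L => v.1.1) ⁻¹' (directSumData L).dom a := by
    ext v
    simp [e, ← ht, t.mem_source]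
  have hval : ∀ z ∈ e.target, ((e.symm z).1 : (directSum L).Total) =
      t.toOpenPartialHomeomorph.symm z :=
    fun z hz => t.toOpenPartialHomeomorph.subtypeRestr_symm_apply hne hz
  have hfst : ∀ m ∈ e.source, (e m).1 = m.1.1 := by
    intro m hm
    rw [hsrc] at hm
    exact t.coe_fst' hm
  have happ : ∀ (m : sumTimesTot L) (hm : m.1.1 ∈ (directSumData L).dom a),
      e m = (m.1.1, (directSumData L).triv a m.1.1 hm m.1.2) := fun m hm =>
    (directSumData L).toBundle_trivializationAt a hm m.1.2
  refine ⟨(directSumData L).dom a, e, (directSumData L).isOpen_dom a, (directSumData L).mem_dom a,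
    hsrc, ?_, ?_, ?_, hfst, ?_⟩
  · ext z
    constructor
    · intro hz
      have h1 := e.map_target hz
      have h2 := hfst _ h1
      rw [hsrc] at h1
      have h3 := (directSum_mem L a (e.symm z).1 h1).2 (e.symm z).2
      change (e (e.symm z)).2 ∈ torusSet p at h3
      rw [e.right_inv hz] at h2 h3
      refine ⟨?_, h3⟩
      rw [h2]
      exact h1
    · rintro ⟨hz1, hz2⟩
      let w : (directSum L).Total := t.toOpenPartialHomeomorph.symm z
      have hzt : z ∈ t.target := t.mem_target.2 hz1
      have hw1 : w.1 = z.1 := t.proj_symm_apply hzt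
      have hw2 : t w = z := t.apply_symm_apply hzt
      have hwd : w.1 ∈ (directSumData L).dom a := hw1.symm ▸ hz1
      have hwm : w ∈ sumTimesTot L := by
        refine (directSum_mem L a w hwd).1 ?_
        change (t w).2 ∈ torusSet p
        rw [hw2]
        exact hz2
      have h1 : (⟨w, hwm⟩ : sumTimesTot L) ∈ e.source := by
        rw [hsrc]
        exact hwd
      have h2 := e.map_source h1
      have h3 : e (⟨w, hwm⟩ : sumTimesTot L) = z := hw2
      rwa [h3] at h2
  · have h1 := (Trivialization.contMDiffOn (n := ω) (IB := 𝓘(ℂ, E)) t).comp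
      (contMDiff_subtype_val (I := totModel E p) (n := ω)
        (U := sumTimesTot L)).contMDiffOn (s := e.source) (by
          intro v hv
          rw [hsrc] at hv
          exact t.mem_source.2 hv)
    exact h1
  · intro z hz
    have h1 := (Trivialization.contMDiffOn_symm (n := ω) (IB := 𝓘(ℂ, E)) t) z hz.1
    have h2 := (h1.mono (fun y hy => hy.1 : e.target ⊆ t.target)).congr hval (hval z hz)
    exact (ChartedSpace.liftPropWithinAt_subtypeVal_comp_iff (U := sumTimesTot L) e.symm e.target z).1 h2
  · intro h m hm i
    rw [hsrc] at hm
    have hm' : (h • m : sumTimesTot L).1.1 ∈ (directSumData L).dom a := hm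
    rw [happ m hm, happ (h • m) hm']
    change HolLineBundle.coordAt (L i) a m.1.1 (mem_iInter.1 hm i)
        ((h i : ℂ) • (m.1.2 : ∀ i, (L i).Fib m.1.1) i) =
      HolLineBundle.coordAt (L i) a m.1.1 (mem_iInter.1 hm i)
        ((m.1.2 : ∀ i, (L i).Fib m.1.1) i) * _
    rw [map_smul, smul_eq_mul, mul_comm]

/-- The principal `(ℂˣ)^p`-bundle `L₁ˣ ⊕ ⋯ ⊕ L_pˣ`. -/
def sumTimes [IsManifold 𝓘(ℂ, E) ω X] (L : Fin p → HolLineBundle E X) : TorusBundle E p X where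
  Tot := sumTimesTot L
  proj v := v.1.1
  proj_smul _ _ := rfl
  locallyTrivial := sumTimes_locallyTrivial L

end WhitneySum

/-- The classes of `L₁, …, L_p` form a `ℤ`-basis of the Picard group. -/
def IsPicBasis {E : Type v} [NormedAddCommGroup E] [NormedSpace ℂ E]
    {X : Type u} [TopologicalSpace X] [ChartedSpace E X] {p : ℕ}
    (L : Fin p → HolLineBundle E X) : Prop :=
  ∃ b : Module.Basis (Fin p) ℤ (Additive (Pic E X)), ∀ i, b i = Additive.ofMul (Pic.mk (L i))

end CYBundle

end

/-! Finite rank. Classically, a free Picard group has trivial $\mathrm{Pic}^0$ (a quotient of the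
vector space $H^1(X,\mathcal O)$, hence divisible) and so embeds in the finitely generated group
$H^2(X,\mathbb Z)$. The proof follows this pattern by elementary means.

A topologically trivial holomorphic line bundle has a topologically trivial holomorphic square root.
If a global continuous frame is locally $s=e^{k_a}t_a$ with $t_a$ holomorphic, then $e^{k_b-k_a}$ is
a holomorphic transition function, and its continuous square root $e^{(k_b-k_a)/2}$ is again
holomorphic and a cocycle (`IsContFrameOn.exists_sqrt`). The class is therefore divisible by every
power of 2, and in a free abelian group it vanishes (`Pic.mk_eq_one_of_isContFrameOn`).

For finite generation, three nested finite covers by cells encode a line bundle by finitely many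
integers: frames on the cells of `U`, logarithms of their ratios on the cells of `V`, and the $2\pi
i\mathbb Z$-valued ambiguities of these logarithms, read off at points of the cells of `T` and `V`.
If all integers vanish, the logarithms form an additive cocycle, which a partition of unity splits,
and the bundle is topologically trivial (`IsCechData.exists_isContFrameOn`), hence trivial. So the
group of pairs (integers, class) embeds in some $\mathbb Z^N$ and maps onto the Picard group
(`Pic.finite`).

Character map. Holomorphic characters of the torus are Laurent monomials, so $\widehat H$ is free on
the coordinate characters (`exists_charBasis`). For $M=\bigoplus L_i^\times$ the map $[m,1]\mapsto
m_i$ identifies the bundle of the $i$-th coordinate character with $L_i$. Thus $\lambda_M$ carries a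
basis to a basis.

Uniqueness. If $\lambda_N$ is an isomorphism, $\alpha=\lambda_N^{-1}\lambda_M$ is an automorphism of
$\widehat H$, and the bundle of $\alpha(\chi_i)$ over $N$ is $L_i$. The vectors $[n,1]$ in these
bundles are the components of a map $N\to M$, equivariant up to the automorphism of $H$ dual to
$\alpha$ (`isomUpToTwist_sumTimes`).

Calabi-Yau form. Since $\lambda_M$ is onto, $K_X=\lambda_M(\chi)$ for some $\chi$. The tautological
section $m\mapsto[m,1]$ is then a nowhere vanishing section of the pullback of $K_X$ to $M$, of
weight $\chi$. Its product with $dt_1/t_1\wedge\dots\wedge dt_p/t_p$ is a well defined top form: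
changing the trivialization alters each $dt_i/t_i$ only by a form from the base (`dens_change`), and
the torus leaves it invariant (`dens_smul`). -/

noncomputable section

namespace CYBundle

/-! ### Holomorphic and continuous frames of line bundles -/

section Frames

variable {E : Type v} [NormedAddCommGroup E] [NormedSpace ℂ E]
  {X : Type u} [TopologicalSpace X] [ChartedSpace E X]

namespace HolLineBundle

/-- In a line bundle, every vector is a multiple of a given nonzero vector of the same fibre. -/
theorem exists_smul_eq (L : HolLineBundle E X) {x : X} {v : L.Fib x} (hv : v ≠ 0) (w : L.Fib x) :
    ∃ c : ℂ, w = c • v := by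
  let k := coordAt L x x (mem_baseSet_trivializationAt ℂ L.Fib x)
  have h0 : k v ≠ 0 := fun h => hv (k.injective (by rw [h, map_zero]))
  refine ⟨k w / k v, k.injective ?_⟩
  rw [map_smul, smul_eq_mul, div_mul_cancel₀ _ h0]

/-- Two sections that are holomorphic frames at `a` differ by a nonvanishing holomorphic
function. -/
theorem IsFrameAt.exists_ratio {L : HolLineBundle E X} {a : X} {s t : ∀ x, L.Fib x}
    (hs : IsFrameAt L a s) (ht : IsFrameAt L a t) :
    ∃ g : X → ℂ, ContMDiffAt 𝓘(ℂ, E) 𝓘(ℂ, ℂ) ω g a ∧ g a ≠ 0 ∧ ∀ᶠ x in 𝓝 a, s x = g x • t x := by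
  have ha := mem_baseSet_trivializationAt ℂ L.Fib a
  have h0 := hs.coord_ne_zero
  have h0' := ht.coord_ne_zero
  have h1 := ((isFrameAt_iff L a s).1 hs).1
  have h1' := ((isFrameAt_iff L a t).1 ht).1
  refine ⟨fun x => (trivializationAt ℂ L.Fib a (⟨x, s x⟩ : L.Total)).2 *
    (trivializationAt ℂ L.Fib a (⟨x, t x⟩ : L.Total)).2⁻¹, h1.mul (h1'.inv₀ h0'),
    mul_ne_zero h0 (inv_ne_zero h0'), ?_⟩
  filter_upwards [(trivializationAt ℂ L.Fib a).open_baseSet.mem_nhds ha,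
    h1'.continuousAt.eventually_ne h0'] with x hx hne
  apply (coordAt L a x hx).injective
  rw [map_smul, smul_eq_mul]
  change coordAt L a x hx (t x) ≠ 0 at hne
  change coordAt L a x hx (s x) = coordAt L a x hx (s x) * (coordAt L a x hx (t x))⁻¹ * _
  rw [inv_mul_cancel_right₀ hne]

theorem IsFrameAt.smul {L : HolLineBundle E X} {a : X} {s : ∀ x, L.Fib x}
    (hs : IsFrameAt L a s) {g : X → ℂ} (hg : ContMDiffAt 𝓘(ℂ, E) 𝓘(ℂ, ℂ) ω g a) (h0 : g a ≠ 0)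
    {t : ∀ x, L.Fib x} (ht : ∀ᶠ x in 𝓝 a, t x = g x • s x) : IsFrameAt L a t := by
  rw [isFrameAt_iff] at hs ⊢
  refine ⟨(hg.mul hs.1).congr_of_eventuallyEq ?_, ?_⟩
  · have ha := mem_baseSet_trivializationAt ℂ L.Fib a
    filter_upwards [(trivializationAt ℂ L.Fib a).open_baseSet.mem_nhds ha, ht] with x hx hxt
    change coordAt L a x hx (t x) = g x * coordAt L a x hx (s x)
    rw [hxt, map_smul, smul_eq_mul]
  · rw [ht.self_of_nhds]
    exact smul_ne_zero h0 hs.2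

theorem IsFrameAt.eventually_ne_zero {L : HolLineBundle E X} {a : X} {s : ∀ x, L.Fib x}
    (hs : IsFrameAt L a s) : ∀ᶠ b in 𝓝 a, s b ≠ 0 := by
  have ha := mem_baseSet_trivializationAt ℂ L.Fib a
  filter_upwards [(trivializationAt ℂ L.Fib a).open_baseSet.mem_nhds ha,
    ((isFrameAt_iff L a s).1 hs).1.continuousAt.eventually_ne hs.coord_ne_zero] with x hx hne
  change coordAt L a x hx (s x) ≠ 0 at hne
  intro h
  rw [h, map_zero] at hne
  exact hne rfl

theorem IsFrameAt.eventually [IsManifold 𝓘(ℂ, E) ω X] {L : HolLineBundle E X} {a : X}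
    {s : ∀ x, L.Fib x} (hs : IsFrameAt L a s) : ∀ᶠ b in 𝓝 a, IsFrameAt L b s := by
  have h1 := (contMDiffAt_iff_contMDiffAt_nhds (by simp)).1 hs.1
  filter_upwards [h1, hs.eventually_ne_zero] with b hb hb' using ⟨hb, hb'⟩

/-- The section `s` is continuous within `K` at `a`, and does not vanish at `a`. -/
def IsContFrameWithinAt (L : HolLineBundle E X) (K : Set X) (a : X) (s : ∀ x, L.Fib x) : Prop :=
  ∃ (t : ∀ x, L.Fib x) (f : X → ℂ), IsFrameAt L a t ∧ ContinuousWithinAt f K a ∧ f a ≠ 0 ∧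
    s a = f a • t a ∧ ∀ᶠ x in 𝓝[K] a, s x = f x • t x

/-- A continuous nowhere vanishing section over `K`. -/
def IsContFrameOn (L : HolLineBundle E X) (K : Set X) (s : ∀ x, L.Fib x) : Prop :=
  ∀ a ∈ K, IsContFrameWithinAt L K a s

theorem IsFrameAt.isContFrameWithinAt {L : HolLineBundle E X} {a : X} {s : ∀ x, L.Fib x}
    (hs : IsFrameAt L a s) (K : Set X) : IsContFrameWithinAt L K a s :=
  ⟨s, fun _ => 1, hs, continuousWithinAt_const, one_ne_zero, by simp, by simp⟩

namespace IsContFrameWithinAt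

variable {L M : HolLineBundle E X} {K K' : Set X} {a : X} {s s' : ∀ x, L.Fib x}

theorem ne_zero (h : IsContFrameWithinAt L K a s) : s a ≠ 0 := by
  obtain ⟨t, f, ht, -, h0, h1, -⟩ := h
  rw [h1]
  exact smul_ne_zero h0 ht.2

theorem mono (h : IsContFrameWithinAt L K a s) (hK : K' ⊆ K) : IsContFrameWithinAt L K' a s := by
  obtain ⟨t, f, ht, hf, h0, h1, h2⟩ := h
  exact ⟨t, f, ht, hf.mono hK, h0, h1, h2.filter_mono (nhdsWithin_mono _ hK)⟩

theorem smul (h : IsContFrameWithinAt L K a s) {g : X → ℂ} (hg : ContinuousWithinAt g K a)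
    (h0 : g a ≠ 0) (hs : s' a = g a • s a) (hs' : ∀ᶠ x in 𝓝[K] a, s' x = g x • s x) :
    IsContFrameWithinAt L K a s' := by
  obtain ⟨t, f, ht, hf, hf0, h1, h2⟩ := h
  refine ⟨t, fun x => g x * f x, ht, hg.mul hf, mul_ne_zero h0 hf0, ?_, ?_⟩
  · rw [hs, h1, smul_smul]
  · filter_upwards [h2, hs'] with x hx hx'
    rw [hx', hx, smul_smul]

theorem congr (h : IsContFrameWithinAt L K a s) (hs : s' a = s a)
    (hs' : ∀ᶠ x in 𝓝[K] a, s' x = s x) : IsContFrameWithinAt L K a s' :=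
  h.smul (g := fun _ => 1) continuousWithinAt_const one_ne_zero (by simpa using hs)
    (by simpa using hs')

/-- The two reference frames differ near `a` by a holomorphic factor, so both hypotheses speak about
one coefficient `c` of `s` along `t`, and continuity within two sets gives continuity within their
union. The point `a` need not lie in either set; this is why a continuous frame records the value at
`a` separately. -/
theorem union (h : IsContFrameWithinAt L K a s) (h' : IsContFrameWithinAt L K' a s) :
    IsContFrameWithinAt L (K ∪ K') a s := by
  obtain ⟨t, f, ht, hf, hf0, h1, h2⟩ := h
  obtain ⟨t', f', ht', hf', hf0', h1', h2'⟩ := h'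
  obtain ⟨g, hg, hg0, hgt⟩ := ht'.exists_ratio ht
  classical
  have key : ∀ x, ∃ c : ℂ, t x ≠ 0 → s x = c • t x := fun x => by
    by_cases hx : t x = 0
    · exact ⟨0, fun h => absurd hx h⟩
    · obtain ⟨c, hc⟩ := exists_smul_eq L hx (s x)
      exact ⟨c, fun _ => hc⟩
  choose c hc using key
  have hne := ht.eventually_ne_zero
  have hinj : ∀ x, t x ≠ 0 → ∀ c d : ℂ, c • t x = d • t x → c = d :=
    fun x hx c d h => smul_left_injective ℂ hx h
  have e1 : c a = f a := hinj a ht.2 _ _ (by rw [← hc a ht.2, h1])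
  have e2 : ∀ᶠ x in 𝓝[K] a, c x = f x := by
    filter_upwards [h2, hne.filter_mono nhdsWithin_le_nhds] with x hx hx0
    exact hinj x hx0 _ _ (by rw [← hc x hx0, hx])
  have e3 : ∀ᶠ x in 𝓝[K'] a, c x = f' x * g x := by
    filter_upwards [h2', hne.filter_mono nhdsWithin_le_nhds, hgt.filter_mono nhdsWithin_le_nhds]
      with x hx hx0 hxg
    exact hinj x hx0 _ _ (by rw [← hc x hx0, hx, hxg, smul_smul])
  have e4 : c a = f' a * g a :=
    hinj a ht.2 _ _ (by rw [← hc a ht.2, h1', hgt.self_of_nhds, smul_smul])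
  refine ⟨t, c, ht, (hf.congr_of_eventuallyEq e2 e1).union
    ((hf'.mul hg.continuousAt.continuousWithinAt).congr_of_eventuallyEq e3 e4),
    e1 ▸ hf0, hc a ht.2, ?_⟩
  filter_upwards [hne.filter_mono nhdsWithin_le_nhds] with x hx using hc x hx

/-- The factor is `f' * k / f`, where `f`, `f'` are the coefficients along the two reference frames
and `k` is the ratio of those frames. -/
theorem continuousWithinAt_ratio (h : IsContFrameWithinAt L K a s)
    (h' : IsContFrameWithinAt L K a s') {g : X → ℂ} (hs : s' a = g a • s a)
    (hs' : ∀ᶠ x in 𝓝[K] a, s' x = g x • s x) : ContinuousWithinAt g K a ∧ g a ≠ 0 := by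
  obtain ⟨t, f, ht, hf, hf0, h1, h2⟩ := h
  have h0' := h'.ne_zero
  obtain ⟨t', f', ht', hf', hf0', h1', h2'⟩ := h'
  obtain ⟨k, hk, hk0, hkt⟩ := ht'.exists_ratio ht
  have hne := ht.eventually_ne_zero
  have hinj : ∀ x, t x ≠ 0 → ∀ c d : ℂ, c • t x = d • t x → c = d :=
    fun x hx c d h => smul_left_injective ℂ hx h
  have e1 : g a = f' a * k a / f a := by
    rw [eq_div_iff hf0]
    refine hinj a ht.2 _ _ ?_
    rw [mul_smul, ← h1, ← hs, h1', hkt.self_of_nhds, smul_smul]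
  refine ⟨((hf'.mul hk.continuousAt.continuousWithinAt).div hf hf0).congr_of_eventuallyEq ?_ e1, ?_⟩
  · filter_upwards [h2, h2', hs', hf.eventually_ne hf0, hne.filter_mono nhdsWithin_le_nhds,
      hkt.filter_mono nhdsWithin_le_nhds] with x h1 h1' hs hf0 hne hk
    change g x = f' x * k x / f x
    rw [eq_div_iff hf0]
    refine hinj x hne _ _ ?_
    rw [mul_smul, ← h1, ← hs, h1', hk, smul_smul]
  · intro h
    rw [hs, h, zero_smul] at h0'
    exact h0' rfl

theorem tensor (h : IsContFrameWithinAt L K a s) {t : ∀ x, M.Fib x}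
    (h' : IsContFrameWithinAt M K a t) :
    IsContFrameWithinAt (tensor L M) K a (fun x => s x ⊗ₜ[ℂ] t x) := by
  obtain ⟨r, f, hr, hf, hf0, h1, h2⟩ := h
  obtain ⟨r', f', hr', hf', hf0', h1', h2'⟩ := h'
  refine ⟨_, fun x => f x * f' x, hr.tensor hr', hf.mul hf', mul_ne_zero hf0 hf0', ?_, ?_⟩
  · change s a ⊗ₜ[ℂ] t a = (f a * f' a) • (r a ⊗ₜ[ℂ] r' a)
    rw [h1, h1', TensorProduct.smul_tmul_smul]
  · filter_upwards [h2, h2'] with x hx hx'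
    change s x ⊗ₜ[ℂ] t x = (f x * f' x) • (r x ⊗ₜ[ℂ] r' x)
    rw [hx, hx', TensorProduct.smul_tmul_smul]

theorem dual (h : IsContFrameWithinAt L K a s) {t : ∀ x, Module.Dual ℂ (L.Fib x)}
    (hst : t a (s a) = 1) (hst' : ∀ᶠ x in 𝓝[K] a, t x (s x) = 1) :
    IsContFrameWithinAt (dual L) K a t := by
  obtain ⟨r, f, hr, hf, hf0, h1, h2⟩ := h
  obtain ⟨r', hr'⟩ := exists_dual_frame hr
  have hne : ∀ᶠ x in 𝓝 a, r x ≠ 0 := hr'.mono fun x hx h => by simp [h] at hx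
  have key : ∀ x, r' x (r x) = 1 → t x (s x) = 1 → f x ≠ 0 → s x = f x • r x →
      t x = (f x)⁻¹ • r' x := fun x hx hts hf hs => by
    have hr0 : r x ≠ 0 := fun h => by simp [h] at hx
    apply LinearMap.ext
    intro v
    obtain ⟨c, rfl⟩ := exists_smul_eq L hr0 v
    rw [hs, map_smul, smul_eq_mul] at hts
    rw [map_smul, LinearMap.smul_apply, map_smul, hx, eq_inv_of_mul_eq_one_right hts]
    simp [mul_comm]
  refine ⟨r', fun x => (f x)⁻¹, hr.dual hr', hf.inv₀ hf0, inv_ne_zero hf0, ?_, ?_⟩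
  · exact key a hr'.self_of_nhds hst hf0 h1
  · filter_upwards [h2, hst', hf.eventually_ne hf0, hr'.filter_mono nhdsWithin_le_nhds]
      with x h2 h3 h4 h5
    exact key x h5 h3 h4 h2

end IsContFrameWithinAt

end HolLineBundle

end Frames

/-! ### Topologically trivial bundles are 2-divisible, hence trivial when the Picard group is free
-/

section SquareRoot

variable {E : Type v} [NormedAddCommGroup E] [NormedSpace ℂ E]
  {X : Type u} [TopologicalSpace X] [ChartedSpace E X]

/-- A continuous square root of a nonvanishing holomorphic function is holomorphic. -/
theorem contMDiffAt_of_sq {g q : X → ℂ} {a : X} (hg : ContinuousAt g a) (h0 : g a ≠ 0)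
    (hq : ContMDiffAt 𝓘(ℂ, E) 𝓘(ℂ, ℂ) ω q a) (hgq : ∀ᶠ x in 𝓝 a, g x ^ 2 = q x) :
    ContMDiffAt 𝓘(ℂ, E) 𝓘(ℂ, ℂ) ω g a := by
  -- Continuity keeps `g / g a` in the right half plane near `a`, where a number is the principal
  -- square root of its square; this fixes the sign.
  have h1 : ContinuousAt (fun x => (g x / g a).re) a :=
    Complex.continuous_re.continuousAt.comp (hg.div_const _)
  have h2 : ∀ᶠ x in 𝓝 a, 0 < (g x / g a).re :=
    h1.eventually (lt_mem_nhds (by simp [div_self h0]))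
  have hqa : q a ≠ 0 := by
    rw [← hgq.self_of_nhds]
    exact pow_ne_zero 2 h0
  -- The branch of the square root with value `g a` at `q a`. Dividing by `q a` moves the base point
  -- to 1, where the principal logarithm is holomorphic.
  have h3 : ContDiffAt ℂ ω (fun z : ℂ => g a * Complex.exp (Complex.log (z / q a) / 2)) (q a) := by
    have : ContDiffAt ℂ ω (fun z : ℂ => z / q a) (q a) := contDiffAt_id.div_const _
    refine contDiffAt_const.mul (ContDiffAt.cexp (ContDiffAt.div_const ?_ _))
    refine ContDiffAt.comp (q a) (Complex.contDiffAt_log ?_) this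
    simp [div_self hqa]
  refine (ContMDiffAt.comp a h3.contMDiffAt hq).congr_of_eventuallyEq ?_
  filter_upwards [hgq, h2] with x hx hre
  have h4 : q x / q a = (g x / g a) ^ 2 := by
    rw [← hx, ← hgq.self_of_nhds, div_pow]
  change g x = g a * Complex.exp (Complex.log (q x / q a) / 2)
  have h5 := Complex.sq_cpow_two_inv hre
  have h6 : g x / g a ≠ 0 := fun h => by simp [h] at hre
  rw [Complex.cpow_def_of_ne_zero (pow_ne_zero 2 h6), ← div_eq_mul_inv] at h5
  rw [h4, h5, mul_div_cancel₀ _ h0]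

namespace HolLineBundle

/-- Multiplication by a nonzero vector of a fibre. -/
def fibEquiv (L : HolLineBundle E X) {x : X} {v : L.Fib x} (hv : v ≠ 0) : ℂ ≃ₗ[ℂ] L.Fib x :=
  LinearEquiv.ofBijective (LinearMap.toSpanSingleton ℂ (L.Fib x) v)
    ⟨smul_left_injective ℂ hv, fun w => by
      obtain ⟨c, hc⟩ := exists_smul_eq L hv w
      exact ⟨c, hc.symm⟩⟩

theorem fibEquiv_apply (L : HolLineBundle E X) {x : X} {v : L.Fib x} (hv : v ≠ 0) (c : ℂ) :
    fibEquiv L hv c = c • v := rfl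

/-- Around every point, a global continuous frame is `exp k` times a holomorphic frame, for a
continuous function `k`. -/
theorem IsContFrameOn.exists_log [IsManifold 𝓘(ℂ, E) ω X] {L : HolLineBundle E X}
    {s : ∀ x, L.Fib x} (hs : IsContFrameOn L univ s) (a : X) :
    ∃ (U : Set X) (t : ∀ x, L.Fib x) (k : X → ℂ), IsOpen U ∧ a ∈ U ∧ ∀ x ∈ U,
      IsFrameAt L x t ∧ ContinuousAt k x ∧ s x = Complex.exp (k x) • t x := by
  obtain ⟨t, f, ht, hf, h0, h1, h2⟩ := hs a (mem_univ a)
  rw [continuousWithinAt_univ] at hf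
  rw [nhdsWithin_univ] at h2
  have hr : ContinuousAt (fun x => f x / f a) a := hf.div_const _
  have h3 : ∀ᶠ x in 𝓝 a, f x / f a ∈ Complex.slitPlane :=
    hr.eventually (Complex.isOpen_slitPlane.mem_nhds (by simp [div_self h0]))
  obtain ⟨U, hU, hUo, haU⟩ := mem_nhds_iff.1 (ht.eventually.and (h2.and h3))
  have hfa : f a • t a ≠ 0 := smul_ne_zero h0 ht.2
  -- Rescaling the frame by the constant `f a` makes the remaining factor equal to 1 at `a`, so the
  -- principal logarithm applies nearby.
  refine ⟨U, fun x => f a • t x, fun x => Complex.log (f x / f a), hUo, haU, fun x hx => ?_⟩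
  obtain ⟨k1, k2, k3⟩ := hU hx
  -- The coefficient `f` is known to be continuous at `a` only. At other points of `U` it is the
  -- ratio of two continuous frames.
  have k4 : ContinuousAt f x := by
    have := (((k1.isContFrameWithinAt univ).continuousWithinAt_ratio (hs x (mem_univ x)) k2) ?_).1
    · rwa [continuousWithinAt_univ] at this
    · rw [nhdsWithin_univ]
      filter_upwards [hUo.mem_nhds hx] with y hy using (hU hy).2.1
  refine ⟨k1.smul (g := fun _ => f a) contMDiffAt_const h0 (Filter.Eventually.of_forall fun _ => rfl),
    (k4.div_const _).clog k3, ?_⟩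
  rw [Complex.exp_log (Complex.slitPlane_ne_zero k3), smul_smul, div_mul_cancel₀ _ h0]
  exact k2

/-- A topologically trivial holomorphic line bundle has a topologically trivial square root. -/
theorem IsContFrameOn.exists_sqrt [IsManifold 𝓘(ℂ, E) ω X] {L : HolLineBundle E X}
    {s : ∀ x, L.Fib x} (hs : IsContFrameOn L univ s) :
    ∃ (M : HolLineBundle E X) (t : ∀ x, M.Fib x), IsContFrameOn M univ t ∧
      (HolLineBundle.tensor M M).Isom L := by
  choose U t k hU haU h using hs.exists_log
  -- The square root is the product bundle as a topological bundle, with a new holomorphic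
  -- structure: the trivialization at `a` multiplies by `exp (k a / 2)`.
  let D : LocalTrivData (E := E) (F := ℂ) (fun _ : X => ULift.{u} ℂ) :=
    lineData _ U hU haU (fun a x _ => ULift.moduleEquiv.trans
      (LinearEquiv.smulOfUnit (Units.mk0 (Complex.exp (k a x / 2)) (Complex.exp_ne_zero _))))
      (fun a b => by
        refine ⟨fun x => Complex.exp (k b x / 2) * (Complex.exp (k a x / 2))⁻¹, fun x hx => ?_,
          fun x _ _ => ?_⟩
        · obtain ⟨ha1, ha2, ha3⟩ := h a x hx.1
          obtain ⟨hb1, hb2, hb3⟩ := h b x hx.2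
          obtain ⟨q, hq, hq0, hqt⟩ := ha1.exists_ratio hb1
          -- The function is continuous, and its square is the holomorphic ratio `q` with `t a = q •
          -- t b`, since `exp (k a) • t a = s = exp (k b) • t b`.
          refine (contMDiffAt_of_sq ?_ ?_ hq ?_).contMDiffWithinAt
          · exact (hb2.div_const _).cexp.mul ((ha2.div_const _).cexp.inv₀ (Complex.exp_ne_zero _))
          · exact mul_ne_zero (Complex.exp_ne_zero _) (inv_ne_zero (Complex.exp_ne_zero _))
          · filter_upwards [hqt, (hU a).mem_nhds hx.1, (hU b).mem_nhds hx.2] with y hy hya hyb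
            have e1 := (h a y hya).2.2
            rw [(h b y hyb).2.2, hy, smul_smul] at e1
            have e2 := smul_left_injective ℂ (h b y hyb).1.2 e1
            rw [mul_pow, inv_pow, ← Complex.exp_nat_mul, ← Complex.exp_nat_mul]
            push_cast
            rw [mul_div_cancel₀ _ two_ne_zero, mul_div_cancel₀ _ two_ne_zero, e2,
              mul_comm, inv_mul_cancel_left₀ (Complex.exp_ne_zero _)]
        · have e : (LinearEquiv.smulOfUnit (Units.mk0 (Complex.exp (k a x / 2))
              (Complex.exp_ne_zero _)) : ℂ ≃ₗ[ℂ] ℂ).symm 1 = (Complex.exp (k a x / 2))⁻¹ := by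
            rw [LinearEquiv.symm_apply_eq]
            exact (mul_inv_cancel₀ (Complex.exp_ne_zero _)).symm
          simp only [LinearEquiv.trans_symm, LinearEquiv.trans_apply, e]
          rfl)
  have hfr : ∀ a, IsFrameAt D.toBundle a
      (fun x => (ULift.up (Complex.exp (k a x / 2))⁻¹ : ULift.{u} ℂ)) := fun a =>
    (toBundle_isFrameAt_iff D a _ (fun _ => 1) (Filter.Eventually.of_forall fun x _ => by
      change Complex.exp (k a x / 2) * (Complex.exp (k a x / 2))⁻¹ = 1
      exact mul_inv_cancel₀ (Complex.exp_ne_zero _))).2 ⟨contMDiffAt_const, one_ne_zero⟩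
  refine ⟨D.toBundle, fun _ => (ULift.up 1 : ULift.{u} ℂ), fun a _ => ?_, ?_⟩
  · have h2 : ∀ x, (ULift.up 1 : ULift.{u} ℂ) = Complex.exp (k a x / 2) •
        (ULift.up (Complex.exp (k a x / 2))⁻¹ : ULift.{u} ℂ) := fun x => by
      apply ULift.ext
      exact (mul_inv_cancel₀ (Complex.exp_ne_zero _)).symm
    refine ⟨_, fun x => Complex.exp (k a x / 2), hfr a, ?_, Complex.exp_ne_zero _, h2 a,
      Filter.Eventually.of_forall h2⟩
    exact ((h a a (haU a)).2.1.div_const _).cexp.continuousWithinAt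
  -- The isomorphism sends `1 ⊗ 1` to `s`. The square of the local frame `exp (-k a / 2)` then goes
  -- to `exp (-k a) • s = t a`, which is holomorphic.
  · refine isom_of_frames (L := HolLineBundle.tensor D.toBundle D.toBundle) (L' := L) (fun x =>
      ((TensorProduct.congr ULift.moduleEquiv ULift.moduleEquiv).trans
        (TensorProduct.lid ℂ ℂ)).trans (fibEquiv L (hs x (mem_univ x)).ne_zero)) fun a => ?_
    refine ⟨_, (hfr a).tensor (hfr a), ?_⟩
    refine (h a a (haU a)).1.smul (g := fun _ => 1) contMDiffAt_const one_ne_zero ?_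
    filter_upwards [(hU a).mem_nhds (haU a)] with x hx
    change ((Complex.exp (k a x / 2))⁻¹ * (Complex.exp (k a x / 2))⁻¹) • s x = (1 : ℂ) • t a x
    rw [(h a x hx).2.2, smul_smul, ← Complex.exp_neg, ← Complex.exp_add, ← Complex.exp_add]
    congr 1
    rw [← Complex.exp_zero]
    congr 1
    ring

end HolLineBundle

/-- In a free abelian group, an element that can be halved infinitely often vanishes. -/
theorem eq_zero_of_infinitely_halvable {A : Type*} [AddCommGroup A] [Module.Free ℤ A] {D : Set A}
    (hD : ∀ a ∈ D, ∃ b ∈ D, b + b = a) {a : A} (ha : a ∈ D) : a = 0 := by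
  have h1 : ∀ (n : ℕ), ∃ b ∈ D, (2 ^ n : ℤ) • b = a := by
    intro n
    induction n with
    | zero => exact ⟨a, ha, by simp⟩
    | succ n ih =>
      obtain ⟨b, hb, rfl⟩ := ih
      obtain ⟨c, hc, rfl⟩ := hD b hb
      exact ⟨c, hc, by rw [pow_succ, mul_smul, two_smul]⟩
  have B := Module.Free.chooseBasis ℤ A
  refine B.ext_elem fun i => ?_
  rw [map_zero, Finsupp.zero_apply]
  by_contra hne
  -- A coordinate `c ≠ 0` is divisible by every power of 2; the exponent `|c|` already contradicts
  -- `|c| < 2 ^ |c|`.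
  obtain ⟨b, -, hb⟩ := h1 (B.repr a i).natAbs
  have h2 : (2 ^ (B.repr a i).natAbs : ℤ) ∣ B.repr a i :=
    ⟨B.repr b i, by conv_lhs => rw [← hb, map_smul, Finsupp.smul_apply, smul_eq_mul]⟩
  have h3 := Int.natAbs_dvd_natAbs.2 h2
  rw [Int.natAbs_pow] at h3
  have h4 := Nat.le_of_dvd (Int.natAbs_pos.2 hne) h3
  exact absurd h4 (not_le.2 (Nat.lt_pow_self (by norm_num)))

/-- If the Picard group is free, topologically trivial line bundles are trivial. -/
theorem Pic.mk_eq_one_of_isContFrameOn [IsManifold 𝓘(ℂ, E) ω X]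
    [Module.Free ℤ (Additive (Pic E X))] {L : HolLineBundle E X} {s : ∀ x, L.Fib x}
    (hs : HolLineBundle.IsContFrameOn L univ s) : Pic.mk L = 1 := by
  -- The set of topologically trivial classes. Only its closure under halving is needed, not that it
  -- is a subgroup.
  let D : Set (Additive (Pic E X)) := {a | ∃ (M : HolLineBundle E X) (t : ∀ x, M.Fib x),
    HolLineBundle.IsContFrameOn M univ t ∧ Additive.ofMul (Pic.mk M) = a}
  have h1 : ∀ a ∈ D, ∃ b ∈ D, b + b = a := by
    rintro _ ⟨M, t, ht, rfl⟩
    obtain ⟨N, r, hr, hN⟩ := ht.exists_sqrt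
    exact ⟨_, ⟨N, r, hr, rfl⟩, congrArg Additive.ofMul (Quotient.sound hN :
      Pic.mk (HolLineBundle.tensor N N) = Pic.mk M)⟩
  exact congrArg Additive.toMul (eq_zero_of_infinitely_halvable h1 (⟨L, s, hs, rfl⟩ :
    Additive.ofMul (Pic.mk L) ∈ D))

end SquareRoot

/-! ### Induction over boxes, and logarithms on convex sets -/

section Boxes

/-- To prove a property of a box in `ℝ^m`, it suffices to prove it for small boxes and to glue along
coordinate hyperplanes. -/
theorem box_induction {m : ℕ} (P : (Fin m → ℝ) → (Fin m → ℝ) → Prop) {a b : Fin m → ℝ}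
    (hab : a ≤ b)
    (glue : ∀ c d k t, a ≤ c → d ≤ b → c ≤ d → c k ≤ t → t ≤ d k → P c (Function.update d k t) →
      P (Function.update c k t) d → P c d)
    (loc : ∀ x ∈ Icc a b, ∃ U ∈ 𝓝 x, ∀ c d, a ≤ c → d ≤ b → Icc c d ⊆ U → P c d) : P a b := by
  choose! U hU hUP using loc
  obtain ⟨δ, hδ, hδU⟩ := lebesgue_number_lemma_of_metric (isCompact_Icc (a := a) (b := b))
    (c := fun x : Icc a b => interior (U x)) (fun _ => isOpen_interior)
    (fun x hx => mem_iUnion.2 ⟨⟨x, hx⟩, mem_interior_iff_mem_nhds.2 (hU x hx)⟩)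
  have small : ∀ c d, a ≤ c → d ≤ b → c ≤ d → (∀ i, d i - c i < δ) → P c d := by
    intro c d hc hd hcd h
    obtain ⟨y, hy⟩ := hδU c ⟨hc, hcd.trans hd⟩
    refine hUP y y.2 c d hc hd fun z hz => interior_subset (hy ?_)
    rw [Metric.mem_ball, dist_pi_lt_iff hδ]
    intro i
    rw [Real.dist_eq, abs_of_nonneg (sub_nonneg.2 (hz.1 i))]
    linarith [hz.2 i, h i]
  -- `S` is the set of directions in which the box may still be longer than the Lebesgue number `δ`.
  have key : ∀ S : Finset (Fin m), ∀ c d, a ≤ c → d ≤ b → c ≤ d → (∀ i ∉ S, d i - c i < δ) →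
      P c d := by
    intro S
    induction S using Finset.induction_on with
    | empty => exact fun c d hc hd hcd h => small c d hc hd hcd fun i => h i (Finset.notMem_empty i)
    | insert k S _ ih =>
      -- Slabs of width `δ / 2` are cut off in direction `k` one at a time, and `n` bounds how many
      -- cuts remain. The width is `δ / 2` rather than `δ` because smallness is a strict inequality.
      have step : ∀ n : ℕ, ∀ c d, a ≤ c → d ≤ b → c ≤ d → (∀ i ∉ insert k S, d i - c i < δ) →
          d k - c k < (n + 1) * (δ / 2) → P c d := by
        intro n
        induction n with
        | zero =>
          intro c d hc hd hcd h hk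
          refine ih c d hc hd hcd fun i hi => ?_
          by_cases hik : i = k
          · subst hik
            norm_num at hk
            linarith
          · exact h i (by simp [hik, hi])
        | succ n ihn =>
          intro c d hc hd hcd h hk
          by_cases hle : c k + δ / 2 ≤ d k
          · refine glue c d k (c k + δ / 2) hc hd hcd (by linarith) hle ?_ ?_
            · refine ih _ _ hc ?_ ?_ fun i hi => ?_
              · refine (update_le_iff.2 ⟨hle, fun _ _ => le_rfl⟩).trans hd
              · exact le_update_iff.2 ⟨by linarith, fun i _ => hcd i⟩
              · by_cases hik : i = k
                · subst hik
                  rw [Function.update_self]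
                  linarith
                · rw [Function.update_of_ne hik]
                  exact h i (by simp [hik, hi])
            · refine ihn _ _ ?_ hd ?_ (fun i hi => ?_) ?_
              · exact hc.trans (le_update_iff.2 ⟨by linarith, fun _ _ => le_rfl⟩)
              · exact update_le_iff.2 ⟨hle, fun i _ => hcd i⟩
              · rw [Function.update_of_ne (by rintro rfl; simp at hi)]
                exact h i hi
              · rw [Function.update_self]
                push_cast at hk
                linarith
          · refine ih c d hc hd hcd fun i hi => ?_
            by_cases hik : i = k
            · subst hik
              linarith
            · exact h i (by simp [hik, hi])
      intro c d hc hd hcd h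
      obtain ⟨n, hn⟩ := exists_nat_gt ((d k - c k) / (δ / 2))
      refine step n c d hc hd hcd h ?_
      rw [div_lt_iff₀ (by positivity)] at hn
      linarith
  exact key Finset.univ a b le_rfl le_rfl hab fun i hi => absurd (Finset.mem_univ i) hi

/-- A nonvanishing continuous function on a convex open set has a continuous logarithm. -/
theorem exists_continuousOn_log {V : Type*} [NormedAddCommGroup V] [NormedSpace ℝ V]
    {B : Set V} (hB : IsOpen B) (hc : Convex ℝ B) {g : V → ℂ}
    (hg : ContinuousOn g B) (h0 : ∀ x ∈ B, g x ≠ 0) :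
    ∃ h : V → ℂ, ContinuousOn h B ∧ ∀ x ∈ B, Complex.exp (h x) = g x := by
  classical
  rcases B.eq_empty_or_nonempty with rfl | ⟨a, ha⟩
  · exact ⟨0, continuousOn_empty _, fun x hx => hx.elim⟩
  -- A contractible, locally path connected domain lets `g` lift through the covering `exp : ℂ → ℂ \
  -- {0}`.
  have : ContractibleSpace B := hc.contractibleSpace ⟨a, ha⟩
  have : LocallyPathConnectedSpace B := hB.locallyPathConnectedSpace
  obtain ⟨F, ⟨-, hF⟩, -⟩ := Complex.isCoveringMapOn_exp.existsUnique_continuousMap_lifts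
    (⟨B.domRestrict g, hg.domRestrict⟩ : C(B, ℂ)) (a₀ := ⟨a, ha⟩) (e₀ := Complex.log (g a))
    (Complex.exp_log (h0 a ha)) (fun x => h0 x x.2)
  refine ⟨fun x => if hx : x ∈ B then F ⟨x, hx⟩ else 0, ?_, fun x hx => ?_⟩
  · rw [continuousOn_iff_continuous_domRestrict]
    convert F.continuous using 1
    funext x
    simp
  · simp only [dif_pos hx]
    exact congrFun hF ⟨x, hx⟩

end Boxes

/-! ### Continuous frames over boxes in charts -/

section Cells

variable {E : Type v} [NormedAddCommGroup E] [NormedSpace ℂ E]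
  {X : Type u} [TopologicalSpace X] [ChartedSpace E X]

namespace HolLineBundle

/-- Serves at points having a neighbourhood disjoint from `K`, where the continuity condition is
void. -/
theorem IsContFrameWithinAt.of_nhdsWithin_eq_bot {L : HolLineBundle E X} {K : Set X} {a : X}
    {s : ∀ x, L.Fib x} (h : 𝓝[K] a = ⊥) (h0 : s a ≠ 0) : IsContFrameWithinAt L K a s := by
  obtain ⟨t, ht⟩ := exists_isFrameAt L a
  obtain ⟨c, hc⟩ := exists_smul_eq L ht.2 (s a)
  refine ⟨t, fun _ => c, ht, continuousWithinAt_const, ?_, hc, by simp [h]⟩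
  rintro rfl
  rw [zero_smul] at hc
  exact h0 hc

/-- The hyperplane where the `k`-th coordinate equals `r` cuts the box in two halves. On this wall
the frames differ by a nonvanishing continuous factor `u`. Retracting the second half onto the wall
extends `u` to all of it, and `s₂` multiplied by the extended factor agrees with `s₁` on the wall.
-/
theorem IsContFrameOn.glue {L : HolLineBundle E X} {m : ℕ}
    {φ : OpenPartialHomeomorph X (Fin m → ℝ)} {c d : Fin m → ℝ} (hφ : Icc c d ⊆ φ.target)
    {k : Fin m} {r : ℝ} (hc : c k ≤ r) (hd : r ≤ d k) {s₁ s₂ : ∀ x, L.Fib x}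
    (h₁ : IsContFrameOn L (φ.source ∩ φ ⁻¹' Icc c (Function.update d k r)) s₁)
    (h₂ : IsContFrameOn L (φ.source ∩ φ ⁻¹' Icc (Function.update c k r) d) s₂) :
    ∃ s, IsContFrameOn L (φ.source ∩ φ ⁻¹' Icc c d) s := by
  classical
  set K₁ := φ.source ∩ φ ⁻¹' Icc c (Function.update d k r) with hK₁
  set K₂ := φ.source ∩ φ ⁻¹' Icc (Function.update c k r) d with hK₂
  have m1 : ∀ x, x ∈ K₁ ↔ x ∈ φ.source ∧ φ x ∈ Icc c d ∧ φ x k ≤ r := by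
    intro x
    simp only [hK₁, mem_inter_iff, mem_preimage, mem_Icc, le_update_iff]
    constructor
    · rintro ⟨h1, h2, h3, h4⟩
      refine ⟨h1, ⟨h2, fun i => ?_⟩, h3⟩
      by_cases hi : i = k
      · subst hi; linarith
      · exact h4 i hi
    · rintro ⟨h1, ⟨h2, h3⟩, h4⟩
      exact ⟨h1, h2, h4, fun i _ => h3 i⟩
  have m2 : ∀ x, x ∈ K₂ ↔ x ∈ φ.source ∧ φ x ∈ Icc c d ∧ r ≤ φ x k := by
    intro x
    simp only [hK₂, mem_inter_iff, mem_preimage, mem_Icc, update_le_iff]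
    constructor
    · rintro ⟨h1, ⟨h3, h4⟩, h2⟩
      refine ⟨h1, ⟨fun i => ?_, h2⟩, h3⟩
      by_cases hi : i = k
      · subst hi; linarith
      · exact h4 i hi
    · rintro ⟨h1, ⟨h2, h3⟩, h4⟩
      exact ⟨h1, ⟨h4, fun i _ => h2 i⟩, h3⟩
  have hun : φ.source ∩ φ ⁻¹' Icc c d = K₁ ∪ K₂ := by
    ext x
    rw [mem_union, m1, m2]
    constructor
    · rintro ⟨h1, h2⟩
      exact (le_total (φ x k) r).imp (fun h => ⟨h1, h2, h⟩) (fun h => ⟨h1, h2, h⟩)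
    · rintro (⟨h1, h2, -⟩ | ⟨h1, h2, -⟩) <;> exact ⟨h1, h2⟩
  -- The retraction onto the wall: it resets the `k`-th coordinate to `r`.
  let ρ : X → X := fun x => φ.symm (Function.update (φ x) k r)
  have hup : ∀ x ∈ K₂, Function.update (φ x) k r ∈ Icc c d := fun x hx => by
    obtain ⟨-, ⟨h2, h3⟩, -⟩ := (m2 x).1 hx
    exact ⟨le_update_iff.2 ⟨hc, fun i _ => h2 i⟩,
      update_le_iff.2 ⟨hd, fun i _ => h3 i⟩⟩
  have hρ : ∀ x ∈ K₂, ρ x ∈ K₁ ∩ K₂ := fun x hx => by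
    have h1 := hup x hx
    have h2 : φ (ρ x) = Function.update (φ x) k r := φ.right_inv (hφ h1)
    have h3 := φ.map_target (hφ h1)
    rw [mem_inter_iff, m1, m2, h2, Function.update_self]
    exact ⟨⟨h3, h1, le_rfl⟩, ⟨h3, h1, le_rfl⟩⟩
  have hρc : ContinuousOn ρ K₂ := by
    refine φ.continuousOn_symm.comp ?_ fun x hx => hφ (hup x hx)
    have h4 : Continuous fun z : Fin m → ℝ => Function.update z k r := by fun_prop
    exact h4.comp_continuousOn (φ.continuousOn.mono fun x hx => hx.1)
  have key : ∀ x, ∃ c : ℂ, s₂ x ≠ 0 → s₁ x = c • s₂ x := fun x => by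
    by_cases hx : s₂ x = 0
    · exact ⟨0, fun h => absurd hx h⟩
    · obtain ⟨c, hc⟩ := exists_smul_eq L hx (s₁ x)
      exact ⟨c, fun _ => hc⟩
  choose u hu using key
  have huc : ∀ x ∈ K₁ ∩ K₂, ContinuousWithinAt u (K₁ ∩ K₂) x ∧ u x ≠ 0 := fun x hx =>
    ((h₂ x hx.2).mono inter_subset_right).continuousWithinAt_ratio
      ((h₁ x hx.1).mono inter_subset_left) (hu x (h₂ x hx.2).ne_zero) (by
        filter_upwards [self_mem_nhdsWithin] with y hy using hu y (h₂ y hy.2).ne_zero)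
  let s : ∀ x, L.Fib x := fun x => if φ x k ≤ r then s₁ x else u (ρ x) • s₂ x
  have e1 : ∀ x ∈ K₁, s x = s₁ x := fun x hx => if_pos ((m1 x).1 hx).2.2
  have e2 : ∀ x ∈ K₂, s x = u (ρ x) • s₂ x := fun x hx => by
    by_cases h : φ x k ≤ r
    · have h5 : φ x k = r := le_antisymm h ((m2 x).1 hx).2.2
      have h6 : ρ x = x := by
        change φ.symm (Function.update (φ x) k r) = x
        rw [← h5, Function.update_eq_self]
        exact φ.left_inv hx.1
      rw [h6, ← hu x (h₂ x hx).ne_zero]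
      exact if_pos h
    · exact if_neg h
  have f1 : ∀ a ∈ K₁, IsContFrameWithinAt L K₁ a s := fun a ha =>
    (h₁ a ha).congr (e1 a ha) (by filter_upwards [self_mem_nhdsWithin] with y hy using e1 y hy)
  have f2 : ∀ a ∈ K₂, IsContFrameWithinAt L K₂ a s := fun a ha => by
    refine (h₂ a ha).smul (g := fun x => u (ρ x)) ?_ (huc _ (hρ a ha)).2 (e2 a ha)
      (by filter_upwards [self_mem_nhdsWithin] with y hy using e2 y hy)
    exact (huc _ (hρ a ha)).1.comp (hρc a ha) hρ
  -- The preimage of a closed box is closed relative to the chart domain, so a point of the chart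
  -- outside it has a neighbourhood avoiding it.
  have cl : ∀ (B : Set (Fin m → ℝ)), IsClosed B → ∀ a ∈ φ.source, a ∉ φ.source ∩ φ ⁻¹' B →
      𝓝[φ.source ∩ φ ⁻¹' B] a = ⊥ := by
    intro B hB a ha haB
    have h1 := φ.continuousOn.isOpen_inter_preimage φ.open_source hB.isOpen_compl
    refine Filter.empty_mem_iff_bot.1 (mem_nhdsWithin.2 ⟨_, h1, ⟨ha, fun h => haB ⟨ha, h⟩⟩, ?_⟩)
    rintro y ⟨⟨-, hy⟩, -, hy'⟩
    exact hy hy'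
  refine ⟨s, fun a ha => ?_⟩
  have has := ha.1
  rw [hun] at ha ⊢
  rcases ha with ha | ha
  · refine (f1 a ha).union ?_
    by_cases ha2 : a ∈ K₂
    · exact f2 a ha2
    · exact .of_nhdsWithin_eq_bot (cl _ isClosed_Icc a has ha2) (f1 a ha).ne_zero
  · refine IsContFrameWithinAt.union ?_ (f2 a ha)
    by_cases ha2 : a ∈ K₁
    · exact f1 a ha2
    · exact .of_nhdsWithin_eq_bot (cl _ isClosed_Icc a has ha2) (f2 a ha).ne_zero

/-- Line bundles are topologically trivial over closed boxes in charts. -/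
theorem exists_isContFrameOn_box [IsManifold 𝓘(ℂ, E) ω X] (L : HolLineBundle E X) {m : ℕ}
    (φ : OpenPartialHomeomorph X (Fin m → ℝ)) {a b : Fin m → ℝ} (hab : a ≤ b)
    (hφ : Icc a b ⊆ φ.target) : ∃ s, IsContFrameOn L (φ.source ∩ φ ⁻¹' Icc a b) s := by
  refine box_induction (fun c d => ∃ s, IsContFrameOn L (φ.source ∩ φ ⁻¹' Icc c d) s) hab ?_ ?_
  · rintro c d k r hc hd - hcr hrd ⟨s₁, h₁⟩ ⟨s₂, h₂⟩
    exact IsContFrameOn.glue ((Icc_subset_Icc hc hd).trans hφ) hcr hrd h₁ h₂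
  · intro x hx
    obtain ⟨t, ht⟩ := exists_isFrameAt L (φ.symm x)
    refine ⟨_, (φ.continuousAt_symm (hφ hx)).eventually ht.eventually, fun c d _ _ hU => ⟨t, ?_⟩⟩
    rintro y ⟨hy, hy'⟩
    have h1 := hU hy'
    simp only [mem_ofPred_eq, φ.left_inv hy] at h1
    exact h1.isContFrameWithinAt _

end HolLineBundle

/-- Every point of an open set `W` has a connected neighbourhood over which all line bundles are
topologically trivial and all nonvanishing continuous functions on `W` have logarithms. -/
theorem exists_cell [FiniteDimensional ℂ E] [IsManifold 𝓘(ℂ, E) ω X] {W : Set X} (hW : IsOpen W)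
    {x : X} (hx : x ∈ W) :
    ∃ O : Set X, IsOpen O ∧ x ∈ O ∧ O ⊆ W ∧ IsPreconnected O ∧
      (∀ L : HolLineBundle E X, ∃ s, HolLineBundle.IsContFrameOn L O s) ∧
      ∀ g : X → ℂ, ContinuousOn g W → (∀ y ∈ W, g y ≠ 0) →
        ∃ h : X → ℂ, ContinuousOn h O ∧ ∀ y ∈ O, Complex.exp (h y) = g y := by
  -- The boxes are real, so the complex chart is read in real coordinates.
  have : FiniteDimensional ℝ E := FiniteDimensional.complexToReal E
  let e : E ≃L[ℝ] (Fin (Module.finrank ℝ E) → ℝ) :=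
    ContinuousLinearEquiv.ofFinrankEq (by simp)
  let φ : OpenPartialHomeomorph X (Fin (Module.finrank ℝ E) → ℝ) :=
    ((chartAt E x).trans e.toHomeomorph.toOpenPartialHomeomorph).restrOpen W hW
  have hxs : x ∈ φ.source := by simp [φ, hx]
  have hsW : φ.source ⊆ W := fun y hy => by
    simp [φ] at hy
    exact hy.2
  obtain ⟨ε, hε, hεφ⟩ := Metric.isOpen_iff.1 φ.open_target _ (φ.map_source hxs)
  -- Frames are constructed on a closed cube, which must still lie in the chart; hence `δ < ε`. The
  -- cell itself is the open cube inside it, a ball of the sup metric.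
  obtain ⟨δ, hδ, hδε⟩ := exists_between hε
  have hball : Metric.ball (φ x) δ ⊆ Icc (fun i => φ x i - δ) (fun i => φ x i + δ) := by
    intro z hz
    rw [Metric.mem_ball, dist_pi_lt_iff hδ] at hz
    refine ⟨fun i => ?_, fun i => ?_⟩ <;>
    · have := hz i
      rw [Real.dist_eq, abs_lt] at this
      dsimp only
      linarith [this.1, this.2]
  have hIcc : Icc (fun i => φ x i - δ) (fun i => φ x i + δ) ⊆ φ.target := by
    refine Subset.trans ?_ hεφ
    intro z hz
    rw [Metric.mem_ball, dist_pi_lt_iff hε]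
    intro i
    rw [Real.dist_eq, abs_lt]
    have h1 := hz.1 i
    have h2 := hz.2 i
    dsimp only at h1 h2
    constructor <;> linarith
  have hbt := hball.trans hIcc
  have himg := φ.symm_image_eq_source_inter_preimage hbt
  refine ⟨φ.source ∩ φ ⁻¹' Metric.ball (φ x) δ,
    φ.continuousOn.isOpen_inter_preimage φ.open_source Metric.isOpen_ball,
    ⟨hxs, Metric.mem_ball_self hδ⟩, fun y hy => hsW hy.1, ?_, fun L => ?_, fun g hg h0 => ?_⟩
  · rw [← himg]
    exact (convex_ball _ _).isPreconnected.image _ (φ.continuousOn_symm.mono hbt)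
  · obtain ⟨s, hs⟩ := L.exists_isContFrameOn_box φ (fun i => by linarith) hIcc
    exact ⟨s, fun y hy => (hs y ⟨hy.1, hball hy.2⟩).mono fun z hz => ⟨hz.1, hball hz.2⟩⟩
  · obtain ⟨h, hh, hh'⟩ := exists_continuousOn_log (g := g ∘ φ.symm)
      (Metric.isOpen_ball (x := φ x) (ε := δ)) (convex_ball _ _)
      (hg.comp (φ.continuousOn_symm.mono hbt) fun z hz => hsW (φ.map_target (hbt hz)))
      (fun z hz => h0 _ (hsW (φ.map_target (hbt hz))))
    refine ⟨h ∘ φ, hh.comp (φ.continuousOn.mono inter_subset_left) fun y hy => hy.2,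
      fun y hy => ?_⟩
    rw [Function.comp_apply, hh' _ hy.2, Function.comp_apply, φ.left_inv hy.1]

end Cells

/-! ### Finite covers by cells, with refinements -/

section Covers

variable (E : Type v) [NormedAddCommGroup E] [NormedSpace ℂ E]
  (X : Type u) [TopologicalSpace X] [ChartedSpace E X]

/-- A finite cover of `X` by connected open sets `O k`, each contained in an open set `W k` and
containing a closed set `C k`, such that the interiors of the `C k` still cover. Line bundles are
topologically trivial over `O k`, and nonvanishing functions on `W k` have logarithms on `O k`. -/
structure CellCover where
  ι : Type u
  [fintype : Fintype ι]
  W : ι → Set X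
  O : ι → Set X
  C : ι → Set X
  pt : ι → X
  isOpen_O : ∀ k, IsOpen (O k)
  isClosed_C : ∀ k, IsClosed (C k)
  C_subset : ∀ k, C k ⊆ O k
  O_subset : ∀ k, O k ⊆ W k
  pt_mem : ∀ k, pt k ∈ O k
  covers : ∀ x, ∃ k, x ∈ interior (C k)
  isPreconnected : ∀ k, IsPreconnected (O k)
  exists_frame : ∀ k (L : HolLineBundle E X), ∃ s, HolLineBundle.IsContFrameOn L (O k) s
  exists_log : ∀ k (g : X → ℂ), ContinuousOn g (W k) → (∀ y ∈ W k, g y ≠ 0) →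
    ∃ h : X → ℂ, ContinuousOn h (O k) ∧ ∀ y ∈ O k, Complex.exp (h y) = g y

attribute [instance] CellCover.fintype

/-- There are arbitrarily fine cell covers. -/
theorem exists_cellCover [FiniteDimensional ℂ E] [IsManifold 𝓘(ℂ, E) ω X] [T2Space X]
    [CompactSpace X] {ι : Type*} [Finite ι] {U C : ι → Set X} (hU : ∀ i, IsOpen (U i))
    (hC : ∀ i, IsClosed (C i)) (hCU : ∀ i, C i ⊆ U i) :
    ∃ V : CellCover E X, ∀ k i, V.W k ⊆ U i ∨ Disjoint (V.W k) (C i) := by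
  have hW : ∀ x : X, ∃ W : Set X, IsOpen W ∧ x ∈ W ∧ ∀ i, W ⊆ U i ∨ Disjoint W (C i) := by
    intro x
    -- Either `x` lies in `C i` and `U i` is a suitable neighbourhood, or the open complement of `C
    -- i` is. Finiteness of the index set lets one neighbourhood serve all `i`.
    have h1 : ∀ i, ∃ W : Set X, IsOpen W ∧ x ∈ W ∧ (W ⊆ U i ∨ Disjoint W (C i)) := fun i => by
      by_cases hx : x ∈ C i
      · exact ⟨U i, hU i, hCU i hx, Or.inl Subset.rfl⟩
      · exact ⟨(C i)ᶜ, (hC i).isOpen_compl, hx, Or.inr disjoint_compl_left⟩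
    choose W h2 h3 h4 using h1
    refine ⟨⋂ i, W i, isOpen_iInter_of_finite h2, mem_iInter.2 h3, fun i => ?_⟩
    exact (h4 i).imp (iInter_subset W i).trans fun h => h.mono_left (iInter_subset W i)
  choose W hWo hWx hWi using hW
  choose O hO hxO hOW hOc hOf hOl using fun x => exists_cell (E := E) (hWo x) (hWx x)
  choose D hD hDc hDO using fun x => exists_mem_nhds_isClosed_subset ((hO x).mem_nhds (hxO x))
  obtain ⟨t, ht⟩ := CompactSpace.elim_nhds_subcover (fun x => interior (D x))
    fun x => interior_mem_nhds.2 (hD x)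
  refine ⟨{ ι := t, W := fun x => W x, O := fun x => O x, C := fun x => D x, pt := fun x => x
            isOpen_O := fun x => hO x, isClosed_C := fun x => hDc x
            C_subset := fun x => hDO x, O_subset := fun x => hOW x, pt_mem := fun x => hxO x
            covers := fun x => ?_, isPreconnected := fun x => hOc x
            exists_frame := fun x => hOf x, exists_log := fun x => hOl x },
    fun k i => hWi k i⟩
  have : x ∈ ⋃ y ∈ t, interior (D y) := ht ▸ mem_univ x
  obtain ⟨y, hy, hxy⟩ := mem_iUnion₂.1 this
  exact ⟨⟨y, hy⟩, hxy⟩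

end Covers

/-! ### Čech data of a line bundle and their integral invariants -/

section CechData

variable {E : Type v} [NormedAddCommGroup E] [NormedSpace ℂ E]
  {X : Type u} [TopologicalSpace X] [ChartedSpace E X]

open HolLineBundle

open Classical in
/-- The section of the dual bundle taking the value `1` on `s` where `s` does not vanish. -/
def dualSec {L : HolLineBundle E X} (s : ∀ x, L.Fib x) (x : X) : Module.Dual ℂ (L.Fib x) :=
  if h : s x ≠ 0 then ((fibEquiv L h).symm : L.Fib x →ₗ[ℂ] ℂ) else 0

theorem dualSec_apply {L : HolLineBundle E X} {s : ∀ x, L.Fib x} {x : X} (h : s x ≠ 0) :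
    dualSec s x (s x) = 1 := by
  have : (fibEquiv L h).symm (s x) = 1 := by
    rw [LinearEquiv.symm_apply_eq, fibEquiv_apply, one_smul]
  simpa [dualSec, h] using this

theorem dualSec_eq {L : HolLineBundle E X} {s t : ∀ x, L.Fib x} {x : X} (ht : t x ≠ 0)
    {c : ℂ} (hc : c ≠ 0) (hst : s x = c • t x) : dualSec s x = c⁻¹ • dualSec t x := by
  have hs : s x ≠ 0 := hst ▸ smul_ne_zero hc ht
  apply LinearMap.ext
  intro v
  obtain ⟨b, rfl⟩ := exists_smul_eq L ht v
  have h1 : dualSec s x (t x) = c⁻¹ := by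
    have := dualSec_apply hs
    conv_lhs at this => rw [hst, map_smul, smul_eq_mul]
    exact eq_inv_of_mul_eq_one_right this
  rw [map_smul, map_smul, LinearMap.smul_apply, h1, dualSec_apply ht]
  simp

/-- Continuous frames `s i` of `L` over the sets `U.O i`, and logarithms `h i j k` of the transition
functions over the sets `V.O k`. -/
structure IsCechData (U V : CellCover E X) (L : HolLineBundle E X) (s : U.ι → ∀ x, L.Fib x)
    (h : U.ι → U.ι → V.ι → X → ℂ) : Prop where
  frame : ∀ i, IsContFrameOn L (U.O i) (s i)
  cont : ∀ i j k, V.W k ⊆ U.O i → V.W k ⊆ U.O j → ContinuousOn (h i j k) (V.O k)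
  eq : ∀ i j k, V.W k ⊆ U.O i → V.W k ⊆ U.O j → ∀ x ∈ V.O k,
    s i x = Complex.exp (h i j k x) • s j x

variable {U V T : CellCover E X}

/-- The ratio of two frames is a nonvanishing continuous function on `V.W k` whenever this set lies
in both domains, so it has a logarithm on the cell `V.O k`. For the other indices nothing is
required and the function 0 is taken. -/
theorem exists_isCechData (U V : CellCover E X) (L : HolLineBundle E X) :
    ∃ s h, IsCechData U V L s h := by
  choose s hs using fun i => U.exists_frame i L
  have key : ∀ i j k, ∃ h : X → ℂ, V.W k ⊆ U.O i → V.W k ⊆ U.O j → ContinuousOn h (V.O k) ∧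
      ∀ x ∈ V.O k, s i x = Complex.exp (h x) • s j x := by
    intro i j k
    by_cases hi : V.W k ⊆ U.O i
    · by_cases hj : V.W k ⊆ U.O j
      · have h1 : ∀ x, ∃ c : ℂ, s j x ≠ 0 → s i x = c • s j x := fun x => by
          by_cases hx : s j x = 0
          · exact ⟨0, fun h => absurd hx h⟩
          · obtain ⟨c, hc⟩ := exists_smul_eq L hx (s i x)
            exact ⟨c, fun _ => hc⟩
        choose g hg using h1
        have h2 : ∀ x ∈ V.W k, ContinuousWithinAt g (V.W k) x ∧ g x ≠ 0 := fun x hx =>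
          ((hs j x (hj hx)).mono hj).continuousWithinAt_ratio ((hs i x (hi hx)).mono hi)
            (hg x (hs j x (hj hx)).ne_zero) (by
              filter_upwards [self_mem_nhdsWithin] with y hy using hg y (hs j y (hj hy)).ne_zero)
        obtain ⟨h, hh, hh'⟩ := V.exists_log k g (fun x hx => (h2 x hx).1) fun x hx => (h2 x hx).2
        refine ⟨h, fun _ _ => ⟨hh, fun x hx => ?_⟩⟩
        rw [hh' x hx]
        exact hg x (hs j x (hj (V.O_subset k hx))).ne_zero
      · exact ⟨0, fun _ h => absurd h hj⟩
    · exact ⟨0, fun h => absurd h hi⟩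
  choose h hh using key
  exact ⟨s, h, hs, fun i j k hi hj => (hh i j k hi hj).1, fun i j k hi hj => (hh i j k hi hj).2⟩

namespace IsCechData

variable {L M : HolLineBundle E X} {s : U.ι → ∀ x, L.Fib x} {t : U.ι → ∀ x, M.Fib x}
  {h h' : U.ι → U.ι → V.ι → X → ℂ}

theorem tensor (H : IsCechData U V L s h) (H' : IsCechData U V M t h') :
    IsCechData U V (HolLineBundle.tensor L M) (fun i x => s i x ⊗ₜ[ℂ] t i x) (h + h') where
  frame i x hx := (H.frame i x hx).tensor (H'.frame i x hx)
  cont i j k hi hj := (H.cont i j k hi hj).add (H'.cont i j k hi hj)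
  eq i j k hi hj x hx := by
    have h1 := H.eq i j k hi hj x hx
    have h2 := H'.eq i j k hi hj x hx
    change s i x ⊗ₜ[ℂ] t i x = Complex.exp (h i j k x + h' i j k x) • (s j x ⊗ₜ[ℂ] t j x)
    rw [h1, h2, TensorProduct.smul_tmul_smul, Complex.exp_add]

theorem dual (H : IsCechData U V L s h) :
    IsCechData U V (HolLineBundle.dual L) (fun i => dualSec (s i)) (-h) where
  frame i x hx := (H.frame i x hx).dual (dualSec_apply (H.frame i x hx).ne_zero) (by
    filter_upwards [self_mem_nhdsWithin] with y hy using dualSec_apply (H.frame i y hy).ne_zero)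
  cont i j k hi hj := (H.cont i j k hi hj).neg
  eq i j k hi hj x hx := by
    change dualSec (s i) x = Complex.exp (-h i j k x) • dualSec (s j) x
    rw [Complex.exp_neg]
    exact dualSec_eq (H.frame j x (hj (V.O_subset k hx))).ne_zero (Complex.exp_ne_zero _)
      (H.eq i j k hi hj x hx)

theorem trivial : IsCechData U V (trivialBundle E X) (fun _ _ => (ULift.up 1 : ULift.{u} ℂ)) 0 where
  frame i x _ := (isFrameAt_trivialBundle x).isContFrameWithinAt _
  cont i j k _ _ := continuousOn_const
  eq i j k _ _ x _ := by
    change _ = Complex.exp 0 • _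
    rw [Complex.exp_zero]
    exact (one_smul ℂ (ULift.up 1 : ULift.{u} ℂ)).symm

theorem ne_zero (H : IsCechData U V L s h) {i : U.ι} {k : V.ι} (hi : V.W k ⊆ U.O i) {x : X}
    (hx : x ∈ V.O k) : s i x ≠ 0 :=
  (H.frame i x (hi (V.O_subset k hx))).ne_zero

/-- Both logarithms exponentiate to the ratio of `s i` to `s j`. -/
theorem exp_sub (H : IsCechData U V L s h) {i j : U.ι} {k k' : V.ι} (hi : V.W k ⊆ U.O i)
    (hj : V.W k ⊆ U.O j) (hi' : V.W k' ⊆ U.O i) (hj' : V.W k' ⊆ U.O j) {x : X}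
    (hx : x ∈ V.O k) (hx' : x ∈ V.O k') : Complex.exp (h i j k x - h i j k' x) = 1 := by
  have h1 := H.eq i j k hi hj x hx
  rw [H.eq i j k' hi' hj' x hx'] at h1
  rw [Complex.exp_sub, ← smul_left_injective ℂ (H.ne_zero hj hx) h1,
    div_self (Complex.exp_ne_zero _)]

/-- The ratios of the frames satisfy the multiplicative cocycle identity. -/
theorem exp_cocycle (H : IsCechData U V L s h) {i j l : U.ι} {k : V.ι} (hi : V.W k ⊆ U.O i)
    (hj : V.W k ⊆ U.O j) (hl : V.W k ⊆ U.O l) {x : X} (hx : x ∈ V.O k) :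
    Complex.exp (h i j k x + h j l k x - h i l k x) = 1 := by
  have h1 := H.eq i l k hi hl x hx
  rw [H.eq i j k hi hj x hx, H.eq j l k hj hl x hx, smul_smul] at h1
  rw [Complex.exp_sub, Complex.exp_add, smul_left_injective ℂ (H.ne_zero hl hx) h1,
    div_self (Complex.exp_ne_zero _)]

end IsCechData

/-- A continuous logarithm of `1` on a connected set vanishes if it does so at one point. -/
theorem eq_zero_of_exp_eq_one {O : Set X} (hO : IsPreconnected O) {f : X → ℂ}
    (hf : ContinuousOn f O) (h1 : ∀ x ∈ O, Complex.exp (f x) = 1) {z : X} (hz : z ∈ O)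
    (hfz : f z = 0) {x : X} (hx : x ∈ O) : f x = 0 := by
  have : DiscreteTopology (AddSubgroup.zmultiples (2 * Real.pi * Complex.I) : Set ℂ) :=
    NormedSpace.discreteTopology_zmultiples _
  rw [← hfz]
  refine hO.constant_of_mapsTo ⟨this⟩ hf (T := (AddSubgroup.zmultiples (2 * Real.pi * Complex.I) : Set ℂ))
    (fun y hy => ?_) hx hz
  obtain ⟨n, hn⟩ := Complex.exp_eq_one_iff.1 (h1 y hy)
  exact AddSubgroup.mem_zmultiples_iff.2 ⟨n, by rw [hn, zsmul_eq_mul]⟩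

/-- The discrete invariants of Čech data. -/
def HasInvariants (T : CellCover E X) (h : U.ι → U.ι → V.ι → X → ℂ)
    (n : (U.ι → U.ι → V.ι → V.ι → T.ι → ℤ) × (U.ι → U.ι → U.ι → V.ι → ℤ)) : Prop :=
  (∀ i j k k' z, V.W k ⊆ U.O i → V.W k ⊆ U.O j → V.W k' ⊆ U.O i → V.W k' ⊆ U.O j →
    T.O z ⊆ V.O k → T.O z ⊆ V.O k' →
    h i j k (T.pt z) - h i j k' (T.pt z) = n.1 i j k k' z * (2 * Real.pi * Complex.I)) ∧
  ∀ i j l k, V.W k ⊆ U.O i → V.W k ⊆ U.O j → V.W k ⊆ U.O l →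
    h i j k (V.pt k) + h j l k (V.pt k) - h i l k (V.pt k) =
      n.2 i j l k * (2 * Real.pi * Complex.I)

/-- The first family compares the logarithms of one transition function on two cells of `V`; the
second measures the failure of the additive cocycle identity, as for a Čech representative of the
Chern class. These differences are continuous with values in $2\pi i\mathbb Z$, hence constant on
connected cells, so one sample point per cell suffices. The integers at indices violating the
inclusions are arbitrary. -/
theorem IsCechData.exists_hasInvariants {L : HolLineBundle E X} {s : U.ι → ∀ x, L.Fib x}
    {h : U.ι → U.ι → V.ι → X → ℂ} (H : IsCechData U V L s h) (T : CellCover E X) :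
    ∃ n, HasInvariants T h n := by
  have h1 : ∀ i j k k' z, ∃ n : ℤ, V.W k ⊆ U.O i → V.W k ⊆ U.O j → V.W k' ⊆ U.O i →
      V.W k' ⊆ U.O j → T.O z ⊆ V.O k → T.O z ⊆ V.O k' →
      h i j k (T.pt z) - h i j k' (T.pt z) = n * (2 * Real.pi * Complex.I) := by
    intro i j k k' z
    by_cases hc : Complex.exp (h i j k (T.pt z) - h i j k' (T.pt z)) = 1
    · obtain ⟨n, hn⟩ := Complex.exp_eq_one_iff.1 hc
      exact ⟨n, fun _ _ _ _ _ _ => hn⟩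
    · exact ⟨0, fun a b c d e f => absurd (H.exp_sub a b c d (e (T.pt_mem z)) (f (T.pt_mem z))) hc⟩
  have h2 : ∀ i j l k, ∃ n : ℤ, V.W k ⊆ U.O i → V.W k ⊆ U.O j → V.W k ⊆ U.O l →
      h i j k (V.pt k) + h j l k (V.pt k) - h i l k (V.pt k) =
        n * (2 * Real.pi * Complex.I) := by
    intro i j l k
    by_cases hc : Complex.exp (h i j k (V.pt k) + h j l k (V.pt k) - h i l k (V.pt k)) = 1
    · obtain ⟨n, hn⟩ := Complex.exp_eq_one_iff.1 hc
      exact ⟨n, fun _ _ _ => hn⟩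
    · exact ⟨0, fun a b c => absurd (H.exp_cocycle a b c (V.pt_mem k)) hc⟩
  choose n1 hn1 using h1
  choose n2 hn2 using h2
  exact ⟨(n1, n2), hn1, hn2⟩

variable (U V T) in
/-- The correspondence between invariants of Čech data and classes of line bundles. -/
def invariantGroup : AddSubgroup
    (((U.ι → U.ι → V.ι → V.ι → T.ι → ℤ) × (U.ι → U.ι → U.ι → V.ι → ℤ)) × Additive (Pic E X)) where
  carrier := {r | ∃ (L : HolLineBundle E X) (s : U.ι → ∀ x, L.Fib x)
    (h : U.ι → U.ι → V.ι → X → ℂ), IsCechData U V L s h ∧ HasInvariants T h r.1 ∧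
      r.2 = Additive.ofMul (Pic.mk L)}
  zero_mem' := ⟨trivialBundle E X, _, _, IsCechData.trivial,
    ⟨fun _ _ _ _ _ _ _ _ _ _ _ => by simp, fun _ _ _ _ _ _ _ => by simp⟩, rfl⟩
  add_mem' := by
    rintro ⟨n, a⟩ ⟨n', a'⟩ ⟨L, s, h, H, hn, ha⟩ ⟨L', s', h', H', hn', ha'⟩
    refine ⟨_, _, _, H.tensor H', ⟨?_, ?_⟩, ?_⟩
    · intro i j k k' z a b c d e f
      have e1 := hn.1 i j k k' z a b c d e f
      have e2 := hn'.1 i j k k' z a b c d e f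
      simp only [Pi.add_apply, Prod.fst_add, Int.cast_add]
      linear_combination e1 + e2
    · intro i j l k a b c
      have e1 := hn.2 i j l k a b c
      have e2 := hn'.2 i j l k a b c
      simp only [Pi.add_apply, Prod.snd_add, Prod.fst_add, Int.cast_add]
      linear_combination e1 + e2
    · exact congrArg₂ (· + ·) ha ha'
  neg_mem' := by
    rintro ⟨n, a⟩ ⟨L, s, h, H, hn, ha⟩
    refine ⟨_, _, _, H.dual, ⟨?_, ?_⟩, ?_⟩
    · intro i j k k' z a b c d e f
      have e1 := hn.1 i j k k' z a b c d e f
      simp only [Pi.neg_apply, Prod.fst_neg, Int.cast_neg]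
      linear_combination -e1
    · intro i j l k a b c
      have e1 := hn.2 i j l k a b c
      simp only [Pi.neg_apply, Prod.snd_neg, Prod.fst_neg, Int.cast_neg]
      linear_combination -e1
    · exact congrArg (- ·) ha

end CechData

/-! ### Vanishing invariants, and finite generation of the Picard group -/

section FiniteGeneration

variable {E : Type v} [NormedAddCommGroup E] [NormedSpace ℂ E]
  {X : Type u} [TopologicalSpace X] [ChartedSpace E X]

open HolLineBundle

variable {U V T : CellCover E X}

/-- `V` refines `U`: every `V.W k` is contained in `U.O i` or disjoint from `U.C i`. -/
def CellCover.Refines (V U : CellCover E X) : Prop :=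
  ∀ k i, V.W k ⊆ U.O i ∨ Disjoint (V.W k) (U.C i)

/-- Meeting the closed set `U.C i` in one point forces the whole of `V.W k` into `U.O i`. Thus, at a
point of the sets `C`, all inclusions required in Čech data hold automatically. -/
theorem CellCover.Refines.subset (hVU : V.Refines U) {k : V.ι} {i : U.ι} {x : X}
    (hx : x ∈ V.O k) (hx' : x ∈ U.C i) : V.W k ⊆ U.O i :=
  (hVU k i).resolve_right fun h => disjoint_left.1 h (V.O_subset k hx) hx'

theorem CellCover.exists_mem (V : CellCover E X) (x : X) : ∃ k, x ∈ V.C k :=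
  (V.covers x).imp fun _ h => interior_subset h

namespace IsCechData

variable {L : HolLineBundle E X} {s : U.ι → ∀ x, L.Fib x} {h : U.ι → U.ι → V.ι → X → ℂ}

/-- On the cell of `T` around `x` the difference of the two logarithms is continuous with values in
$2\pi i\mathbb Z$ and vanishes at the sample point; the cell is connected. -/
theorem eq_of_invariants_eq_zero (H : IsCechData U V L s h) (hn : HasInvariants T h 0)
    (hVU : V.Refines U) (hTV : T.Refines V) {i j : U.ι} {k k' : V.ι} {x : X}
    (hi : x ∈ U.C i) (hj : x ∈ U.C j) (hk : x ∈ V.C k) (hk' : x ∈ V.C k') :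
    h i j k x = h i j k' x := by
  obtain ⟨z, hz⟩ := T.exists_mem x
  have hzO := T.C_subset z hz
  have a := hVU.subset (V.C_subset k hk) hi
  have b := hVU.subset (V.C_subset k hk) hj
  have a' := hVU.subset (V.C_subset k' hk') hi
  have b' := hVU.subset (V.C_subset k' hk') hj
  have c := (T.O_subset z).trans (hTV.subset hzO hk)
  have c' := (T.O_subset z).trans (hTV.subset hzO hk')
  have h0 := hn.1 i j k k' z a b a' b' c c'
  simp only [Prod.fst_zero, Pi.zero_apply, Int.cast_zero, zero_mul] at h0
  exact sub_eq_zero.1 (eq_zero_of_exp_eq_one (T.isPreconnected z)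
    (((H.cont i j k a b).mono c).sub ((H.cont i j k' a' b').mono c'))
    (fun y hy => H.exp_sub a b a' b' (c hy) (c' hy)) (T.pt_mem z) h0 hzO)

/-- The same connectedness argument as for `eq_of_invariants_eq_zero`, now on the cell `V.O k`
itself. -/
theorem cocycle_of_invariants_eq_zero (H : IsCechData U V L s h) (hn : HasInvariants T h 0)
    (hVU : V.Refines U) {i j l : U.ι} {k : V.ι} {x : X}
    (hi : x ∈ U.C i) (hj : x ∈ U.C j) (hl : x ∈ U.C l) (hk : x ∈ V.C k) :
    h i j k x + h j l k x = h i l k x := by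
  have hO := V.C_subset k hk
  have a := hVU.subset hO hi
  have b := hVU.subset hO hj
  have c := hVU.subset hO hl
  have h0 := hn.2 i j l k a b c
  simp only [Prod.snd_zero, Pi.zero_apply, Int.cast_zero, zero_mul] at h0
  exact sub_eq_zero.1 (eq_zero_of_exp_eq_one (V.isPreconnected k)
    (((H.cont i j k a b).add (H.cont j l k b c)).sub (H.cont i l k a c))
    (fun y hy => H.exp_cocycle a b c hy) (V.pt_mem k) h0 hO)

/-- A line bundle whose Čech data have vanishing invariants is topologically trivial. -/
theorem exists_isContFrameOn [NormalSpace X] (H : IsCechData U V L s h) (hn : HasInvariants T h 0)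
    (hVU : V.Refines U) (hTV : T.Refines V) : ∃ t, IsContFrameOn L univ t := by
  obtain ⟨ρ, hρ⟩ := PartitionOfUnity.exists_isSubordinate_of_locallyFinite isClosed_univ
    (fun i => interior (U.C i)) (fun _ => isOpen_interior) (locallyFinite_of_finite _)
    (fun x _ => mem_iUnion.2 (U.covers x))
  choose κ hκ using V.exists_mem
  choose ι hι using U.covers
  -- The choice of the cell `κ x` does not matter where `g` is used, so `g` is an additive cocycle.
  -- The weighted sum `S` splits it: `S i - S l = g i l` on `U.C i ∩ U.C l`.
  let g : U.ι → U.ι → X → ℂ := fun i j x => h i j (κ x) x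
  let S : U.ι → X → ℂ := fun i x => ∑ j, (ρ j x : ℂ) * g i j x
  have hS : ∀ i l x, x ∈ U.C i → x ∈ U.C l → S i x = g i l x + S l x := by
    intro i l x hi hl
    have h1 : ∑ j, (ρ j x : ℂ) = 1 := by
      have := ρ.sum_eq_one (mem_univ x)
      rw [finsum_eq_sum_of_fintype] at this
      exact_mod_cast this
    rw [← one_mul (g i l x), ← h1, Finset.sum_mul, ← Finset.sum_add_distrib]
    refine Finset.sum_congr rfl fun j _ => ?_
    by_cases hj : ρ j x = 0
    · simp [hj]
    · have hxj : x ∈ U.C j := interior_subset (hρ j (subset_tsupport _ hj))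
      rw [← mul_add]
      congr 1
      exact (H.cocycle_of_invariants_eq_zero hn hVU hi hl hxj (hκ x)).symm
  have hSc : ∀ i x, x ∈ interior (U.C i) → ContinuousAt (S i) x := by
    intro i x hi
    refine tendsto_finsetSum _ fun j _ => ?_
    -- The index `κ` may jump, but on the support of `ρ j` the function `g i j` agrees near `x` with
    -- the logarithm on one fixed cell. Off the support the summand vanishes near `x`.
    by_cases hj : x ∈ tsupport (ρ j)
    · have hxj := hρ j hj
      obtain ⟨k, hk⟩ := V.covers x
      have hkC := interior_subset hk
      have hkO := V.C_subset k hkC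
      have h2 : ContinuousAt (h i j k) x :=
        (H.cont i j k (hVU.subset hkO (interior_subset hi)) (hVU.subset hkO
          (interior_subset hxj))).continuousAt ((V.isOpen_O k).mem_nhds hkO)
      have h3 : ContinuousAt (g i j) x := by
        refine h2.congr ?_
        filter_upwards [isOpen_interior.mem_nhds hi, isOpen_interior.mem_nhds hxj,
          isOpen_interior.mem_nhds hk] with y hyi hyj hyk
        exact H.eq_of_invariants_eq_zero hn hVU hTV (interior_subset hyi) (interior_subset hyj)
          (interior_subset hyk) (hκ y)
      exact ((Complex.continuous_ofReal.comp (ρ j).continuous).continuousAt).mul h3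
    · have h4 : (fun y => (ρ j y : ℂ) * g i j y) =ᶠ[𝓝 x] fun _ => 0 := by
        filter_upwards [notMem_tsupport_iff_eventuallyEq.1 hj] with y hy
        simp [hy]
      exact (continuousAt_const.congr h4.symm : ContinuousAt (fun y => (ρ j y : ℂ) * g i j y) x)
  -- The correction `exp (-S i)` makes the local frames `s i` agree on overlaps; `ι` merely selects
  -- an index to define the value.
  let t : ∀ x, L.Fib x := fun x => Complex.exp (-S (ι x) x) • s (ι x) x
  have ht : ∀ i x, x ∈ U.C i → t x = Complex.exp (-S i x) • s i x := by
    intro i x hi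
    have hx := interior_subset (hι x)
    have hO := V.C_subset _ (hκ x)
    change Complex.exp (-S (ι x) x) • s (ι x) x = _
    rw [H.eq (ι x) i (κ x) (hVU.subset hO hx) (hVU.subset hO hi) x hO, smul_smul,
      ← Complex.exp_add, hS (ι x) i x hx hi]
    congr 2
    simp only [g]
    ring
  refine ⟨t, fun x _ => ?_⟩
  have hx := hι x
  have hxO := U.C_subset _ (interior_subset hx)
  have h5 : IsContFrameWithinAt L (interior (U.C (ι x))) x t :=
    ((H.frame (ι x) x hxO).mono (interior_subset.trans (U.C_subset _))).smul
      (hSc _ x hx).neg.cexp.continuousWithinAt (Complex.exp_ne_zero _) rfl (by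
        filter_upwards [self_mem_nhdsWithin] with y hy using ht _ y (interior_subset hy))
  obtain ⟨r, f, hr, hf, hf0, e1, e2⟩ := h5
  rw [isOpen_interior.nhdsWithin_eq hx] at e2
  exact ⟨r, f, hr, (hf.continuousAt (isOpen_interior.mem_nhds hx)).continuousWithinAt, hf0, e1,
    e2.filter_mono nhdsWithin_le_nhds⟩

end IsCechData

variable (E X) in
/-- The Picard group of a compact complex manifold is finitely generated if it is free. -/
theorem Pic.finite [FiniteDimensional ℂ E] [IsManifold 𝓘(ℂ, E) ω X] [T2Space X] [CompactSpace X]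
    [Module.Free ℤ (Additive (Pic E X))] : Module.Finite ℤ (Additive (Pic E X)) := by
  -- The first cover has nothing to refine.
  obtain ⟨U, -⟩ := exists_cellCover E X (ι := Empty) (U := fun _ => univ) (C := fun _ => univ)
    (fun _ => isOpen_univ) (fun _ => isClosed_univ) (fun _ => Subset.rfl)
  obtain ⟨V, hVU⟩ := exists_cellCover E X U.isOpen_O U.isClosed_C U.C_subset
  obtain ⟨T, hTV⟩ := exists_cellCover E X V.isOpen_O V.isClosed_C V.C_subset
  -- The invariants depend on the chosen frames and logarithms, so they are related to classes by a
  -- subgroup of the product and not by a homomorphism.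
  let R := AddSubgroup.toIntSubmodule (invariantGroup U V T)
  -- Zero invariants force the class to be trivial, so `R` embeds in a finitely generated free group
  -- and is itself finitely generated.
  have h1 : Function.Injective ((LinearMap.fst ℤ _ _).comp R.subtype) := by
    rw [← LinearMap.ker_eq_bot, LinearMap.ker_eq_bot']
    rintro ⟨⟨n, a⟩, ⟨L, s, h, H, hn, ha⟩⟩ h0
    obtain rfl : n = 0 := h0
    obtain ⟨t, ht⟩ := H.exists_isContFrameOn hn hVU hTV
    obtain rfl : a = 0 := ha.trans (congrArg Additive.ofMul (Pic.mk_eq_one_of_isContFrameOn ht))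
    rfl
  have h2 : Function.Surjective ((LinearMap.snd ℤ _ _).comp R.subtype) := by
    intro a
    obtain ⟨L, hL⟩ := Quotient.exists_rep (Additive.toMul a)
    obtain ⟨s, h, H⟩ := exists_isCechData U V L
    obtain ⟨n, hn⟩ := H.exists_hasInvariants T
    exact ⟨⟨(n, a), ⟨L, s, h, H, hn, congrArg Additive.ofMul hL.symm⟩⟩, rfl⟩
  have := Module.Finite.of_injective _ h1
  exact Module.Finite.of_surjective _ h2

/-- A free Picard group of a compact complex manifold has a finite basis. -/
theorem exists_isPicBasis [FiniteDimensional ℂ E] [IsManifold 𝓘(ℂ, E) ω X] [T2Space X]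
    [CompactSpace X] [Module.Free ℤ (Additive (Pic E X))] :
    ∃ (p : ℕ) (L : Fin p → HolLineBundle E X), IsPicBasis L := by
  have := Pic.finite E X
  let b := Module.finBasis ℤ (Additive (Pic E X))
  choose L hL using fun i => Quotient.exists_rep (Additive.toMul (b i))
  exact ⟨_, L, b, fun i => congrArg Additive.ofMul (hL i).symm⟩

end FiniteGeneration

/-! ### Characters of the torus are Laurent monomials; duality of automorphisms -/

section Characters

variable {p : ℕ}

/-- The coordinate characters of `(ℂˣ)^p`. -/
def coordChar (p : ℕ) (i : Fin p) : CharGroup p :=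
  ⟨Pi.evalMonoidHom (fun _ => ℂˣ) i, by
    have h1 : ContDiffOn ℂ ω (fun z : Fin p → ℂ => z i) (torusSet p) :=
      (contDiff_apply ℂ ℂ i).contDiffOn
    exact h1.congr fun z hz => val_toTorus hz i⟩

theorem coordChar_apply (i : Fin p) (h : Torus p) : (coordChar p i).1 h = h i := rfl

/-- The nonzero complex number `exp t`. -/
def expUnit (t : ℂ) : ℂˣ := Units.mk0 (Complex.exp t) (Complex.exp_ne_zero t)

theorem expUnit_add (s t : ℂ) : expUnit (s + t) = expUnit s * expUnit t :=
  Units.ext (Complex.exp_add s t)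

/-- A holomorphic homomorphism `ℂ → ℂˣ` is of the form `t ↦ exp (c t)`. -/
theorem exists_eq_exp_mul {G : ℂ → ℂ} (hd : Differentiable ℂ G) (hG : ∀ s t, G (s + t) = G s * G t)
    (h0 : G 0 = 1) : ∃ c, ∀ t, G t = Complex.exp (c * t) := by
  let c := deriv G 0
  have h1 : ∀ t, HasDerivAt G (G t * c) t := by
    intro t
    -- The identity `G s = G t * G (s - t)` carries the derivative from 0 to `t`, which gives the
    -- equation `G' = c G`.
    have h2 : HasDerivAt (fun s => G t * G (s - t)) (G t * c) t := by
      have h3 : HasDerivAt G c (t - t) := by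
        rw [sub_self]
        exact (hd 0).hasDerivAt
      exact (h3.comp_sub_const t t).const_mul (G t)
    have h5 : (fun s => G t * G (s - t)) = G := by
      funext s
      rw [← hG, add_sub_cancel]
    rwa [h5] at h2
  have h6 : ∀ t, HasDerivAt (fun t => G t * Complex.exp (-(c * t))) 0 t := by
    intro t
    have h7 : HasDerivAt (fun t => -(c * t)) (-c) t := by
      have := ((hasDerivAt_id' t).const_mul c).neg
      rw [mul_one] at this
      exact this
    refine ((h1 t).mul h7.cexp).congr_deriv ?_
    ring
  have h8 := is_const_of_deriv_eq_zero (fun t => (h6 t).differentiableAt) fun t => (h6 t).deriv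
  refine ⟨c, fun t => ?_⟩
  have h9 := h8 t 0
  simp only [mul_zero, neg_zero, Complex.exp_zero, mul_one, h0] at h9
  rw [Complex.exp_neg] at h9
  exact eq_of_mul_inv_eq_one h9

/-- The restriction of a holomorphic character to a coordinate axis is a power map. -/
theorem CharGroup.exists_zpow (χ : CharGroup p) (i : Fin p) :
    ∃ n : ℤ, ∀ z : ℂˣ, χ.1 (Pi.mulSingle i z) = z ^ n := by
  -- The character restricted to the `i`-th axis is pulled back along `exp`, becoming an entire
  -- homomorphism to the multiplicative group.
  let G : ℂ → ℂ := fun t => χ.1 (Pi.mulSingle i (expUnit t))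
  have hd : Differentiable ℂ G := by
    let k : ℂ → Fin p → ℂ := fun t j => if j = i then Complex.exp t else 1
    have hk : ∀ t, k t ∈ torusSet p := fun t j => by
      by_cases h : j = i <;> simp [k, h, Complex.exp_ne_zero]
    have hk2 : ∀ t, toTorus (k t) = Pi.mulSingle i (expUnit t) := fun t => by
      funext j
      apply Units.ext
      rw [val_toTorus (hk t)]
      by_cases h : j = i
      · subst h; simp [k, expUnit]
      · simp [k, h]
    have hkd : Differentiable ℂ k := differentiable_pi.2 fun j => by
      by_cases h : j = i
      · simp only [k, h, if_true]
        exact Complex.differentiable_exp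
      · simp [k, h]
    intro t
    have h1 := (χ.2.differentiableOn (by simp) (k t) (hk t)).differentiableAt
      ((isOpen_torusSet p).mem_nhds (hk t))
    have h2 := h1.comp t (hkd t)
    refine h2.congr_of_eventuallyEq (Filter.Eventually.of_forall fun s => ?_)
    simp only [G, Function.comp_apply, hk2]
  obtain ⟨c, hc⟩ := exists_eq_exp_mul hd (fun s t => by
    simp only [G, expUnit_add, Pi.mulSingle_mul, map_mul, Units.val_mul]) (by
    have : expUnit 0 = 1 := Units.ext Complex.exp_zero
    simp [G, this])
  -- The period of `exp` forces the exponent `c` to be an integer.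
  have h1 : G (2 * Real.pi * Complex.I) = 1 := by
    have : expUnit (2 * Real.pi * Complex.I) = 1 := Units.ext Complex.exp_two_pi_mul_I
    simp [G, this]
  rw [hc] at h1
  obtain ⟨n, hn⟩ := Complex.exp_eq_one_iff.1 h1
  have hcn := mul_right_cancel₀ Complex.two_pi_I_ne_zero hn
  refine ⟨n, fun z => Units.ext ?_⟩
  have hz : expUnit (Complex.log z) = z := Units.ext (Complex.exp_log z.ne_zero)
  conv_lhs => rw [← hz]
  refine (hc (Complex.log z)).trans ?_
  rw [hcn, Complex.exp_int_mul, Complex.exp_log z.ne_zero, Units.val_zpow_eq_zpow_val]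

/-- Holomorphic characters of `(ℂˣ)^p` are Laurent monomials. -/
theorem CharGroup.exists_eq_prod (χ : CharGroup p) :
    ∃ n : Fin p → ℤ, χ = ∏ i, coordChar p i ^ n i := by
  choose n hn using CharGroup.exists_zpow χ
  refine ⟨n, Subtype.ext (MonoidHom.ext fun h => ?_)⟩
  have h1 : (∏ i, coordChar p i ^ n i).1 h = ∏ i, h i ^ n i := by
    simp [MonoidHom.finsetProd_apply, coordChar_apply]
  rw [h1]
  conv_lhs => rw [← Finset.univ_prod_mulSingle h, map_prod]
  exact Finset.prod_congr rfl fun i _ => hn i (h i)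

variable (p) in
/-- The coordinate characters form a basis of the character group. -/
theorem exists_charBasis : ∃ b : Module.Basis (Fin p) ℤ (Additive (CharGroup p)),
    ∀ i, b i = Additive.ofMul (coordChar p i) := by
  refine ⟨Module.Basis.mk (v := fun i => Additive.ofMul (coordChar p i)) ?_ ?_,
    fun i => Module.Basis.mk_apply _ _ i⟩
  · rw [Fintype.linearIndependent_iff]
    intro g hg i
    have h1 : ∏ i, coordChar p i ^ g i = 1 := by
      have := congrArg Additive.toMul hg
      simpa using this
    -- Any number of absolute value other than 1 would do: its powers detect the exponent `g i`.
    let t : ℂˣ := Units.mk0 2 two_ne_zero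
    have h2 : (∏ i, coordChar p i ^ g i).1 (Pi.mulSingle i t) = t ^ g i := by
      simp only [Subgroup.val_finsetProd, MonoidHom.finsetProd_apply, Subgroup.coe_zpow,
        MonoidHom.zpow_apply, coordChar_apply]
      rw [Finset.prod_eq_single i]
      · simp
      · intro j _ hj
        simp [hj]
      · simp
    rw [h1] at h2
    have h3 : (2 : ℝ) ^ g i = 1 := by
      have := congrArg (fun z : ℂˣ => ‖(z : ℂ)‖) h2
      simpa [t] using this.symm
    exact (zpow_eq_one_iff_right₀ (by norm_num) (by norm_num)).1 h3
  · rintro χ -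
    obtain ⟨n, hn⟩ := CharGroup.exists_eq_prod (Additive.toMul χ)
    have h1 : χ = ∑ i, n i • Additive.ofMul (coordChar p i) := by
      apply Additive.toMul.injective
      rw [hn]
      simp
    rw [h1]
    exact Submodule.sum_mem _ fun i _ =>
      Submodule.smul_mem _ _ (Submodule.subset_span (mem_range_self i))

/-- Homomorphisms on the character group are determined by the coordinate characters. -/
theorem charGroup_hom_ext {A : Type*} [CommGroup A] {f g : CharGroup p →* A}
    (h : ∀ i, f (coordChar p i) = g (coordChar p i)) : f = g := by
  ext χ
  obtain ⟨n, rfl⟩ := CharGroup.exists_eq_prod χ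
  simp [map_prod, h]

/-- The endomorphism of `(ℂˣ)^p` dual to an endomorphism of the character group. -/
def dualHom (α : CharGroup p →* CharGroup p) : Torus p →* Torus p :=
  MonoidHom.pi fun i => (α (coordChar p i)).1

/-- Both sides are multiplicative in `χ` and agree on coordinate characters by definition of
`dualHom`. -/
theorem apply_dualHom (α : CharGroup p →* CharGroup p) (χ : CharGroup p) (h : Torus p) :
    χ.1 (dualHom α h) = (α χ).1 h := by
  let f : CharGroup p →* ℂˣ := (MonoidHom.eval (dualHom α h)).comp (CharGroup p).subtype
  let g : CharGroup p →* ℂˣ := ((MonoidHom.eval h).comp (CharGroup p).subtype).comp α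
  have hfg : f = g := charGroup_hom_ext fun i => rfl
  exact DFunLike.congr_fun hfg χ

/-- The automorphism of `(ℂˣ)^p` dual to an automorphism of the character group. -/
def dualEquiv (α : CharGroup p ≃* CharGroup p) : Torus p ≃* Torus p :=
  { dualHom α.toMonoidHom with
    invFun := dualHom α.symm.toMonoidHom
    left_inv := fun h => funext fun i =>
      (apply_dualHom α.toMonoidHom (α.symm (coordChar p i)) h).trans (by
        rw [MulEquiv.coe_toMonoidHom, MulEquiv.apply_symm_apply, coordChar_apply])
    right_inv := fun h => funext fun i =>
      (apply_dualHom α.symm.toMonoidHom (α (coordChar p i)) h).trans (by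
        rw [MulEquiv.coe_toMonoidHom, MulEquiv.symm_apply_apply, coordChar_apply]) }

theorem isTorusAut_dualEquiv (α : CharGroup p ≃* CharGroup p) : IsTorusAut (dualEquiv α) :=
  ⟨fun i => (α (coordChar p i)).2, fun i => (α.symm (coordChar p i)).2⟩

end Characters

/-! ### Associated line bundles and the character map -/

section CharMap

variable {E : Type v} [NormedAddCommGroup E] [NormedSpace ℂ E] {p : ℕ}
  {X : Type u} [TopologicalSpace X] [ChartedSpace E X]

open HolLineBundle

namespace TorusBundle

variable {M : TorusBundle E p X}

theorem mem_triv_source {a : X} {m : M.Tot} (hm : M.proj m ∈ M.dom a) : m ∈ (M.triv a).source := by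
  rw [(M.triv_spec a).2.2.1]
  exact hm

theorem mk_mem_triv_target {a x : X} (hx : x ∈ M.dom a) (h : Torus p) :
    ((x, fun i => (h i : ℂ)) : X × (Fin p → ℂ)) ∈ (M.triv a).target := by
  rw [(M.triv_spec a).2.2.2.1]
  exact ⟨hx, val_mem_torusSet h⟩

theorem contMDiffAt_triv {a : X} {m : M.Tot} (hm : M.proj m ∈ M.dom a) :
    ContMDiffAt (totModel E p) (𝓘(ℂ, E).prod 𝓘(ℂ, Fin p → ℂ)) ω (M.triv a) m :=
  (M.triv_spec a).2.2.2.2.1.contMDiffAt ((M.triv a).open_source.mem_nhds (mem_triv_source hm))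

theorem contMDiffAt_proj (m : M.Tot) : ContMDiffAt (totModel E p) 𝓘(ℂ, E) ω M.proj m := by
  have hm : M.proj m ∈ M.dom (M.proj m) := (M.triv_spec (M.proj m)).2.1
  refine (contMDiff_fst.contMDiffAt.comp m (contMDiffAt_triv hm)).congr_of_eventuallyEq ?_
  filter_upwards [(M.triv (M.proj m)).open_source.mem_nhds (mem_triv_source hm)] with y hy
  exact ((M.triv_spec (M.proj m)).2.2.2.2.2.2.1 y hy).symm

theorem eventually_proj_mem {a : X} {m : M.Tot} (hm : M.proj m ∈ M.dom a) :
    ∀ᶠ y in 𝓝 m, M.proj y ∈ M.dom a :=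
  (contMDiffAt_proj m).continuousAt.eventually ((M.triv_spec a).1.mem_nhds hm)

/-- The components of the chosen local trivializations are holomorphic. -/
theorem contMDiffAt_char_comp (χ : CharGroup p) {a : X} {m : M.Tot} (hm : M.proj m ∈ M.dom a) :
    ContMDiffAt (totModel E p) 𝓘(ℂ, ℂ) ω (fun y => (χ.1 (M.comp a y) : ℂ)) m := by
  have h1 : ContDiffAt ℂ ω (fun z : Fin p → ℂ => (χ.1 (toTorus z) : ℂ)) (M.triv a m).2 :=
    ContDiffOn.contDiffAt χ.2 ((isOpen_torusSet p).mem_nhds (triv_mem hm))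
  exact ContMDiffAt.comp m (g := fun z : Fin p → ℂ => (χ.1 (toTorus z) : ℂ))
    h1.contMDiffAt (contMDiff_snd.contMDiffAt.comp m (contMDiffAt_triv hm))

/-- The local section `localSec` is holomorphic. -/
theorem contMDiffAt_localSec {a x : X} (hx : x ∈ M.dom a) :
    ContMDiffAt 𝓘(ℂ, E) (totModel E p) ω (fun y => (M.triv a).symm (y, fun _ => 1)) x := by
  have h1 := (M.triv_spec a).2.2.2.2.2.1.contMDiffAt
    ((M.triv a).open_target.mem_nhds (mk_mem_triv_target hx (1 : Torus p)))
  exact ContMDiffAt.comp x (g := (M.triv a).symm) (f := fun y => ((y, fun _ => 1) :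
    X × (Fin p → ℂ))) h1 (contMDiffAt_id.prodMk contMDiffAt_const)

theorem AssocFib.mk_smul_left (χ : Torus p →* ℂˣ) {x : X} {m m' : {m : M.Tot // M.proj m = x}}
    {h : Torus p} (hm : m'.1 = h • m.1) (c : ℂ) :
    AssocFib.mk χ m' c = AssocFib.mk χ m (χ h * c) :=
  Quotient.sound (s := M.assocSetoid χ x) ⟨h, by rw [hm, inv_smul_smul], rfl⟩

/-- The linear isomorphism `c ↦ [m, c]`. -/
def assocEquiv (χ : Torus p →* ℂˣ) {x : X} (m : {m : M.Tot // M.proj m = x}) :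
    ℂ ≃ₗ[ℂ] M.AssocFib χ x := (AssocFib.exists_linearEquiv χ m).choose

theorem assocEquiv_apply (χ : Torus p →* ℂˣ) {x : X} (m : {m : M.Tot // M.proj m = x}) (c : ℂ) :
    assocEquiv χ m c = AssocFib.mk χ m c := (AssocFib.exists_linearEquiv χ m).choose_spec c

theorem AssocFib.mk_one_ne_zero (χ : Torus p →* ℂˣ) {x : X} (m : {m : M.Tot // M.proj m = x}) :
    AssocFib.mk χ m 1 ≠ 0 := by
  rw [← assocEquiv_apply]
  exact (map_ne_zero_iff _ (assocEquiv χ m).injective).2 one_ne_zero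

/-- The linear map out of a fibre of an associated bundle defined by an equivariant family of
vectors. -/
theorem exists_assocFib_equiv (χ : Torus p →* ℂˣ) {x : X} {V : Type*} [AddCommGroup V] [Module ℂ V]
    (f : {m : M.Tot // M.proj m = x} → (ℂ ≃ₗ[ℂ] V))
    (hf : ∀ (m m' : {m : M.Tot // M.proj m = x}) (h : Torus p), m'.1 = h • m.1 →
      f m' 1 = (χ h : ℂ) • f m 1) :
    ∃ φ : M.AssocFib χ x ≃ₗ[ℂ] V, ∀ m, φ (AssocFib.mk χ m 1) = f m 1 := by
  let m₀ := M.basePoint x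
  refine ⟨(assocEquiv χ m₀).symm.trans (f m₀), fun m => ?_⟩
  obtain ⟨h, hh⟩ := TorusBundle.exists_smul_eq (M := M) (m.2.trans m₀.2.symm)
  rw [hf m₀ m h hh, AssocFib.mk_smul_left χ hh, mul_one, ← assocEquiv_apply,
    LinearEquiv.trans_apply, LinearEquiv.symm_apply_apply, ← map_smul, smul_eq_mul, mul_one]

open Classical in
/-- The local frame `[localSec a, 1]` of an associated bundle. -/
def assocFrame (M : TorusBundle E p X) (χ : CharGroup p) (a x : X) : M.AssocFib χ.1 x :=
  if h : x ∈ M.dom a then AssocFib.mk χ.1 (M.localSec a x h) 1 else 0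

theorem assocFrame_eq (χ : CharGroup p) {a x : X} (h : x ∈ M.dom a) :
    M.assocFrame χ a x = AssocFib.mk χ.1 (M.localSec a x h) 1 := dif_pos h

theorem isFrameAt_assocFrame (χ : CharGroup p) (a : X) :
    IsFrameAt (M.assoc χ) a (M.assocFrame χ a) :=
  (toBundle_isFrameAt_iff (M.assocData χ) a _ (fun _ => 1)
    (Filter.Eventually.of_forall fun x hx => by
      have hx' : x ∈ M.dom a := hx
      change M.assocTriv χ.1 a x hx' (M.assocFrame χ a x) = 1
      rw [assocFrame_eq χ hx', assocTriv_mk, comp_localSec]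
      simp)).2 ⟨contMDiffAt_const, one_ne_zero⟩

/-- The assignment `[m, 1] ↦ [m, 1] ⊗ [m, 1]` does not depend on `m`: replacing `m` by `h • m`
scales both sides by `χ h * ψ h`. It matches the frames coming from a local section of `M`. -/
theorem charMap_mul (M : TorusBundle E p X) (χ ψ : CharGroup p) :
    M.charMap (χ * ψ) = M.charMap χ * M.charMap ψ := by
  have key : ∀ x, ∃ φ : M.AssocFib (χ * ψ).1 x ≃ₗ[ℂ] M.AssocFib χ.1 x ⊗[ℂ] M.AssocFib ψ.1 x,
      ∀ m, φ (AssocFib.mk _ m 1) = AssocFib.mk χ.1 m 1 ⊗ₜ AssocFib.mk ψ.1 m 1 := fun x => by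
    obtain ⟨φ, hφ⟩ := exists_assocFib_equiv (M := M) (χ * ψ).1 (x := x) (fun m =>
      (TensorProduct.lid ℂ ℂ).symm.trans
        (TensorProduct.congr (assocEquiv χ.1 m) (assocEquiv ψ.1 m))) (by
      intro m m' h hh
      simp only [LinearEquiv.trans_apply, TensorProduct.lid_symm_apply, TensorProduct.congr_tmul,
        assocEquiv_apply]
      rw [AssocFib.mk_smul_left χ.1 hh, AssocFib.mk_smul_left ψ.1 hh, AssocFib.mk_smul,
        AssocFib.mk_smul, TensorProduct.smul_tmul_smul]
      rfl)
    refine ⟨φ, fun m => ?_⟩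
    rw [hφ]
    simp only [LinearEquiv.trans_apply, TensorProduct.lid_symm_apply, TensorProduct.congr_tmul,
      assocEquiv_apply]
  choose φ hφ using key
  refine Quotient.sound (isom_of_frames (L := M.assoc (χ * ψ))
    (L' := HolLineBundle.tensor (M.assoc χ) (M.assoc ψ)) φ fun a => ?_)
  refine ⟨M.assocFrame (χ * ψ) a, isFrameAt_assocFrame _ a, ?_⟩
  refine ((isFrameAt_assocFrame χ a).tensor (isFrameAt_assocFrame ψ a)).smul (g := fun _ => 1)
    contMDiffAt_const one_ne_zero ?_
  filter_upwards [(M.triv_spec a).1.mem_nhds (M.triv_spec a).2.1] with x hx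
  refine Eq.trans ?_ (one_smul ℂ (M.assocFrame χ a x ⊗ₜ[ℂ] M.assocFrame ψ a x)).symm
  rw [assocFrame_eq _ hx, assocFrame_eq _ hx, assocFrame_eq _ hx]
  exact hφ x _

/-- The character map as a homomorphism. -/
def charHom (M : TorusBundle E p X) : CharGroup p →* Pic E X := MonoidHom.mk' M.charMap M.charMap_mul

/-- The tautological section `m ↦ [m, 1]` is holomorphic. -/
theorem contMDiff_assocMk (χ : CharGroup p) :
    ContMDiff (totModel E p) (𝓘(ℂ, E).prod 𝓘(ℂ, ℂ)) ω
      (fun m : M.Tot => (⟨M.proj m, AssocFib.mk χ.1 ⟨m, rfl⟩ 1⟩ : (M.assoc χ).Total)) := by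
  intro m
  rw [contMDiffAt_totalSpace]
  refine ⟨contMDiffAt_proj m, ?_⟩
  have hm : M.proj m ∈ M.dom (M.proj m) := (M.triv_spec (M.proj m)).2.1
  refine (contMDiffAt_char_comp χ hm).congr_of_eventuallyEq ?_
  filter_upwards [eventually_proj_mem hm] with y hy
  refine (congrArg Prod.snd ((M.assocData χ).toBundle_trivializationAt (M.proj m) hy
    (AssocFib.mk χ.1 ⟨y, rfl⟩ 1))).trans ?_
  change M.assocTriv χ.1 _ _ hy _ = _
  rw [assocTriv_mk, mul_one]

end TorusBundle

/-! ### The character map of a sum of line bundles -/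

/-- The projections of a direct sum of line bundles are holomorphic. -/
theorem contMDiff_directSum_proj (L : Fin p → HolLineBundle E X) (i : Fin p) :
    ContMDiff (𝓘(ℂ, E).prod 𝓘(ℂ, Fin p → ℂ)) (𝓘(ℂ, E).prod 𝓘(ℂ, ℂ)) ω
      (fun v : (directSum L).Total => (⟨v.1, (v.2 : ∀ i, (L i).Fib v.1) i⟩ : (L i).Total)) := by
  intro v
  rw [contMDiffAt_totalSpace]
  have hid : ContMDiffAt (𝓘(ℂ, E).prod 𝓘(ℂ, Fin p → ℂ)) (𝓘(ℂ, E).prod 𝓘(ℂ, Fin p → ℂ)) ω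
      (fun w : (directSum L).Total => w) v := contMDiffAt_id
  rw [contMDiffAt_totalSpace] at hid
  refine ⟨hid.1, ?_⟩
  have h1 : ContMDiffAt 𝓘(ℂ, Fin p → ℂ) 𝓘(ℂ, ℂ) ω (fun z : Fin p → ℂ => z i)
      (trivializationAt (Fin p → ℂ) (directSum L).Fib v.1 v).2 :=
    (contDiff_apply ℂ ℂ i).contDiffAt.contMDiffAt
  refine (ContMDiffAt.comp v h1 hid.2).congr_of_eventuallyEq ?_
  have h2 := (directSumData L).mem_dom v.1
  filter_upwards [hid.1.continuousAt.eventually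
    (((directSumData L).isOpen_dom v.1).mem_nhds h2)] with w hw
  exact (congrFun (congrArg Prod.snd ((directSumData L).toBundle_trivializationAt v.1 hw w.2)) i).symm

/-- A map into a direct sum of line bundles is holomorphic if its components are. -/
theorem contMDiffAt_directSum {L : Fin p → HolLineBundle E X}
    {F H : Type*} [NormedAddCommGroup F] [NormedSpace ℂ F] [TopologicalSpace H]
    {I : ModelWithCorners ℂ F H} {Y : Type*} [TopologicalSpace Y] [ChartedSpace H Y]
    {f : Y → (directSum L).Total} {y : Y}
    (hf : ContMDiffAt I 𝓘(ℂ, E) ω (fun y => (f y).1) y)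
    (hf' : ∀ i, ContMDiffAt I (𝓘(ℂ, E).prod 𝓘(ℂ, ℂ)) ω
      (fun y => (⟨(f y).1, ((f y).2 : ∀ i, (L i).Fib (f y).1) i⟩ : (L i).Total)) y) :
    ContMDiffAt I (𝓘(ℂ, E).prod 𝓘(ℂ, Fin p → ℂ)) ω f y := by
  rw [contMDiffAt_totalSpace]
  refine ⟨hf, ?_⟩
  rw [contMDiffAt_pi_space]
  intro i
  have h1 := hf' i
  rw [contMDiffAt_totalSpace] at h1
  refine h1.2.congr_of_eventuallyEq ?_
  have h2 := (directSumData L).mem_dom (f y).1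
  filter_upwards [hf.continuousAt.eventually
    (((directSumData L).isOpen_dom (f y).1).mem_nhds h2)] with w hw
  exact congrFun (congrArg Prod.snd ((directSumData L).toBundle_trivializationAt (f y).1 hw (f w).2)) i

variable [IsManifold 𝓘(ℂ, E) ω X]

/-- The components of a point of `L₁ˣ ⊕ ⋯ ⊕ L_pˣ` over `x`. -/
def sumTimesComp (L : Fin p → HolLineBundle E X) {x : X}
    (m : {m : (sumTimes L).Tot // (sumTimes L).proj m = x}) (i : Fin p) : (L i).Fib x :=
  m.2 ▸ (m.1.1.2 : ∀ i, (L i).Fib m.1.1.1) i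

/-- Passing to the total space, where holomorphy is formulated, removes the transport between
fibres. -/
theorem sumTimesComp_total (L : Fin p → HolLineBundle E X) {x : X}
    (m : {m : (sumTimes L).Tot // (sumTimes L).proj m = x}) (i : Fin p) :
    (⟨x, sumTimesComp L m i⟩ : (L i).Total) =
      ⟨m.1.1.1, (m.1.1.2 : ∀ i, (L i).Fib m.1.1.1) i⟩ := by
  obtain ⟨m, rfl⟩ := m
  rfl

theorem sumTimesComp_ne_zero (L : Fin p → HolLineBundle E X) {x : X}
    (m : {m : (sumTimes L).Tot // (sumTimes L).proj m = x}) (i : Fin p) :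
    sumTimesComp L m i ≠ 0 := by
  obtain ⟨m, rfl⟩ := m
  exact m.2 i

theorem sumTimesComp_smul (L : Fin p → HolLineBundle E X) {x : X}
    {m m' : {m : (sumTimes L).Tot // (sumTimes L).proj m = x}} {h : Torus p} (hm : m'.1 = h • m.1)
    (i : Fin p) : sumTimesComp L m' i = (h i : ℂ) • sumTimesComp L m i := by
  obtain ⟨m, rfl⟩ := m
  obtain ⟨m', h'⟩ := m'
  dsimp only at hm
  subst hm
  rfl

/-- The line bundle associated with the `i`-th coordinate character is `L i`. -/
theorem charMap_sumTimes_coordChar (L : Fin p → HolLineBundle E X) (i : Fin p) :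
    (sumTimes L).charMap (coordChar p i) = Pic.mk (L i) := by
  have key : ∀ x, ∃ φ : (sumTimes L).AssocFib (coordChar p i).1 x ≃ₗ[ℂ] (L i).Fib x,
      ∀ m, φ (TorusBundle.AssocFib.mk _ m 1) = sumTimesComp L m i := fun x => by
    -- The rule `[m, 1] ↦ mᵢ` is well defined, since both sides are scaled by `h i` when `m` is
    -- replaced by `h • m`.
    obtain ⟨φ, hφ⟩ := TorusBundle.exists_assocFib_equiv (M := sumTimes L) (coordChar p i).1 (x := x)
      (fun m => fibEquiv (L i) (sumTimesComp_ne_zero L m i)) (by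
        intro m m' h hh
        rw [fibEquiv_apply, fibEquiv_apply, one_smul, one_smul, sumTimesComp_smul L hh]
        rfl)
    exact ⟨φ, fun m => by rw [hφ, fibEquiv_apply, one_smul]⟩
  choose φ hφ using key
  refine Quotient.sound (isom_of_frames (L := (sumTimes L).assoc (coordChar p i)) (L' := L i)
    φ fun a => ⟨_, TorusBundle.isFrameAt_assocFrame _ a, ?_⟩)
  have ha := ((sumTimes L).triv_spec a).2.1
  have e : ∀ x (hx : x ∈ (sumTimes L).dom a), φ x ((sumTimes L).assocFrame (coordChar p i) a x) =
      sumTimesComp L ((sumTimes L).localSec a x hx) i := fun x hx =>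
    (congrArg (φ x) (TorusBundle.assocFrame_eq _ hx)).trans (hφ x _)
  constructor
  · have h1 := TorusBundle.contMDiffAt_localSec (M := sumTimes L) ha
    have h2 := (contMDiff_subtype_val (I := totModel E p) (n := ω)
      (U := sumTimesTot L)).contMDiffAt.comp a h1
    have h3 := (contMDiff_directSum_proj L i).contMDiffAt.comp a h2
    refine h3.congr_of_eventuallyEq ?_
    filter_upwards [((sumTimes L).triv_spec a).1.mem_nhds ha] with x hx
    exact (congrArg (TotalSpace.mk x) (e x hx)).trans (sumTimesComp_total L _ i)
  · exact fun h => sumTimesComp_ne_zero L _ i ((e a ha).symm.trans h)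

/-- If the classes of `L₁, …, L_p` form a basis of the Picard group, then the character map of
`L₁ˣ ⊕ ⋯ ⊕ L_pˣ` is an isomorphism. -/
theorem charMapIsIso_sumTimes {L : Fin p → HolLineBundle E X} (hL : IsPicBasis L) :
    (sumTimes L).CharMapIsIso := by
  obtain ⟨b, hb⟩ := hL
  obtain ⟨c, hc⟩ := exists_charBasis p
  let e := c.equiv b (Equiv.refl _)
  let f : CharGroup p ≃* Pic E X := MulEquiv.toAdditive.symm e.toAddEquiv
  refine ⟨f, fun χ => ?_⟩
  have : f.toMonoidHom = (sumTimes L).charHom := charGroup_hom_ext fun i => by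
    have h1 : e (Additive.ofMul (coordChar p i)) = Additive.ofMul (Pic.mk (L i)) := by
      rw [← hc, ← hb]
      exact c.equiv_apply i b _
    exact (congrArg Additive.toMul h1).trans (charMap_sumTimes_coordChar L i).symm
  exact DFunLike.congr_fun this χ

end CharMap

/-! ### Uniqueness up to a twist -/

section Uniqueness

variable {E : Type v} [NormedAddCommGroup E] [NormedSpace ℂ E] {p : ℕ}
  {X : Type u} [TopologicalSpace X] [ChartedSpace E X]

open HolLineBundle

namespace TorusBundle

variable {M N : TorusBundle E p X}

/-- By equivariance of the trivialization, the point with fibre coordinates `h` is the translate by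
`h` of the point with coordinates 1. -/
theorem triv_symm_eq {a x : X} (hx : x ∈ M.dom a) (h : Torus p) :
    (M.triv a).symm (x, fun i => (h i : ℂ)) = h • (M.localSec a x hx).1 := by
  have h1 : M.proj (M.localSec a x hx).1 ∈ M.dom a := (M.localSec a x hx).2.symm ▸ hx
  have h2 : M.proj (h • (M.localSec a x hx).1) ∈ M.dom a := by rwa [M.proj_smul]
  have hs := (M.triv_spec a).2.2.2.2.2.2
  rw [← (M.triv a).left_inv (mem_triv_source h2)]
  congr 1
  refine Prod.ext ?_ ?_
  · rw [hs.1 _ (mem_triv_source h2), M.proj_smul]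
    exact (M.localSec a x hx).2.symm
  · funext i
    rw [hs.2 h _ (mem_triv_source h1)]
    have h3 : M.triv a (M.localSec a x hx).1 = (x, fun _ => 1) :=
      (M.triv a).right_inv (mk_mem_triv_target hx (1 : Torus p))
    rw [h3, one_mul]

theorem smul_left_cancel {m : M.Tot} {h k : Torus p} (hm : h • m = k • m) : h = k := by
  have h1 : M.proj m ∈ M.dom (M.proj m) := (M.triv_spec (M.proj m)).2.1
  have h2 := congrArg (M.comp (M.proj m)) hm
  rw [comp_smul h1, comp_smul h1] at h2
  exact mul_right_cancel h2

/-- A holomorphic map of principal bundles over the identity of `X` which is equivariant up to an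
automorphism of the torus is biholomorphic. -/
theorem exists_isTwistedIso {σ : Torus p ≃* Torus p} (hσ : IsTorusAut σ) {f : M.Tot → N.Tot}
    (hf : ContMDiff (totModel E p) (totModel E p) ω f) (hp : ∀ m, N.proj (f m) = M.proj m)
    (hfσ : ∀ (h : Torus p) m, f (h • m) = σ h • f m) : ∃ φ, M.IsTwistedIso N σ φ := by
  have hinj : Function.Injective f := by
    intro m m' hm
    obtain ⟨h, rfl⟩ := TorusBundle.exists_smul_eq (M := M) (m := m) (m' := m')
      (by rw [← hp, ← hp, hm])
    rw [hfσ] at hm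
    have h1 : σ h = 1 := smul_left_cancel (m := f m) (by rw [← hm, one_smul])
    rw [(MulEquiv.map_eq_one_iff σ).1 h1, one_smul]
  have hsurj : Function.Surjective f := by
    intro n
    obtain ⟨m, hm⟩ := exists_proj_eq (M := M) (N.proj n)
    obtain ⟨h, rfl⟩ := TorusBundle.exists_smul_eq (M := N) (m := f m) (m' := n) (by rw [hp, hm])
    exact ⟨σ.symm h • m, by rw [hfσ, MulEquiv.apply_symm_apply]⟩
  let e := Equiv.ofBijective f ⟨hinj, hsurj⟩
  have he : ContMDiff (totModel E p) (totModel E p) ω e.symm := by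
    intro n
    let a := N.proj n
    have haM : a ∈ M.dom a := (M.triv_spec a).2.1
    have haN : a ∈ N.dom a := (N.triv_spec a).2.1
    let ℓ : X → M.Tot := fun x => (M.triv a).symm (x, fun _ => 1)
    let χ : Fin p → CharGroup p := fun i => ⟨(Pi.evalMonoidHom (fun _ => ℂˣ) i).comp σ.symm.toMonoidHom, hσ.2 i⟩
    -- The inverse image of `y` is `h y • ℓ (N.proj y)`: the torus element carrying `f (ℓ (N.proj
    -- y))` to `y` is a quotient of two fibre components, and `σ.symm` transfers it to `M`.
    -- Holomorphy of the inverse therefore rests on holomorphy of `σ.symm`.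
    let h : N.Tot → Torus p := fun y => σ.symm (N.comp a y * (N.comp a (f (ℓ (N.proj y))))⁻¹)
    have hℓ : ∀ x (hx : x ∈ M.dom a), M.proj (ℓ x) = x := fun x hx => (M.localSec a x hx).2
    have e1 : ∀ᶠ y in 𝓝 n, e.symm y = (M.triv a).symm (N.proj y, fun i => (h y i : ℂ)) := by
      filter_upwards [eventually_proj_mem haN, (contMDiffAt_proj n).continuousAt.eventually
        ((M.triv_spec a).1.mem_nhds haM)] with y hyN hyM
      rw [Equiv.symm_apply_eq, triv_symm_eq hyM]
      change y = f (h y • ℓ (N.proj y))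
      rw [hfσ, MulEquiv.apply_symm_apply]
      have h1 : N.proj (f (ℓ (N.proj y))) = N.proj y := by rw [hp, hℓ _ hyM]
      refine eq_of_comp_eq hyN ?_ ?_
      · rw [N.proj_smul, h1]
      · rw [comp_smul (h1.symm ▸ hyN), inv_mul_cancel_right]
    have h2 : ContMDiffAt (totModel E p) (totModel E p) ω (fun y => f (ℓ (N.proj y))) n :=
      hf.contMDiffAt.comp n ((contMDiffAt_localSec haM).comp n (contMDiffAt_proj n))
    have h3 : N.proj (f (ℓ (N.proj n))) ∈ N.dom a := by
      rw [hp, hℓ _ haM]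
      exact haN
    have h4 : ∀ i, ContMDiffAt (totModel E p) 𝓘(ℂ, ℂ) ω (fun y => (h y i : ℂ)) n := by
      intro i
      have h5 := (contMDiffAt_char_comp (χ i) h3).comp n h2
      have h6 := (contMDiffAt_char_comp (χ i) haN).mul (h5.inv₀ (Units.ne_zero _))
      refine h6.congr_of_eventuallyEq (Filter.Eventually.of_forall fun y => ?_)
      simp only [h, map_mul, map_inv, Pi.mul_apply, Pi.inv_apply, Units.val_mul,
        Units.val_inv_eq_inv_val]
      rfl
    have h7 : ContMDiffAt (totModel E p) (𝓘(ℂ, E).prod 𝓘(ℂ, Fin p → ℂ)) ω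
        (fun y => ((N.proj y, fun i => (h y i : ℂ)) : X × (Fin p → ℂ))) n :=
      (contMDiffAt_proj n).prodMk (contMDiffAt_pi_space.2 h4)
    have h8 := (M.triv_spec a).2.2.2.2.2.1.contMDiffAt
      ((M.triv a).open_target.mem_nhds (mk_mem_triv_target haM (h n)))
    exact (h8.comp n h7).congr_of_eventuallyEq e1
  exact ⟨⟨e, hf, he⟩, hp, hfσ⟩

end TorusBundle

variable [IsManifold 𝓘(ℂ, E) ω X]

/-- If the line bundles associated with `N` along an automorphism of the character group are
`L₁, …, L_p`, then `N` is a twist of `L₁ˣ ⊕ ⋯ ⊕ L_pˣ`. -/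
theorem isomUpToTwist_sumTimes (N : TorusBundle E p X) (L : Fin p → HolLineBundle E X)
    (α : CharGroup p ≃* CharGroup p)
    (hα : ∀ i, N.charMap (α (coordChar p i)) = Pic.mk (L i)) :
    N.IsomUpToTwist (sumTimes L) := by
  have h1 : ∀ i, (N.assoc (α (coordChar p i))).Isom (L i) := fun i => Quotient.exact (hα i)
  choose Φ hΦ _ using h1
  -- The `i`-th component of the map to the direct sum is the tautological vector `[n, 1]`, read in
  -- `L i`.
  let c : ∀ (n : N.Tot) (i : Fin p), (L i).Fib (N.proj n) := fun n i =>
    Φ i (N.proj n) (TorusBundle.AssocFib.mk (α (coordChar p i)).1 ⟨n, rfl⟩ 1)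
  have hc0 : ∀ n i, c n i ≠ 0 := fun n i => (map_ne_zero_iff _ (Φ i (N.proj n)).injective).2
    (TorusBundle.AssocFib.mk_one_ne_zero _ _)
  let f : N.Tot → (sumTimes L).Tot := fun n => ⟨⟨N.proj n, c n⟩, hc0 n⟩
  refine ⟨dualEquiv α, isTorusAut_dualEquiv α,
    TorusBundle.exists_isTwistedIso (isTorusAut_dualEquiv α) (f := f) ?_ (fun _ => rfl) ?_⟩
  · intro n
    have h2 : ContMDiffAt (totModel E p) (totModel E p) ω
        (fun n => (⟨N.proj n, c n⟩ : (directSum L).Total)) n :=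
      contMDiffAt_directSum (TorusBundle.contMDiffAt_proj n) fun i =>
        (hΦ i).contMDiffAt.comp n (TorusBundle.contMDiff_assocMk (α (coordChar p i))).contMDiffAt
    exact (ChartedSpace.liftPropWithinAt_subtypeVal_comp_iff (U := sumTimesTot L) f univ n).1 h2
  · intro h n
    -- The base point `x` is kept as a variable because `N.proj (h • n)` and `N.proj n` are not
    -- definitionally equal.
    have h3 : ∀ (x : X) (m m' : {m : N.Tot // N.proj m = x}) (_ : m'.1 = h • m.1),
        (fun i => Φ i x (TorusBundle.AssocFib.mk (α (coordChar p i)).1 m' 1)) =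
        fun i => (dualEquiv α h i : ℂ) •
          Φ i x (TorusBundle.AssocFib.mk (α (coordChar p i)).1 m 1) := by
      intro x m m' hm
      funext i
      refine (congrArg (Φ i x) ((TorusBundle.AssocFib.mk_smul_left _ hm 1).trans
        (TorusBundle.AssocFib.mk_smul _ _ _ _))).trans (map_smul _ _ _)
    have h4 : (⟨N.proj (h • n), c (h • n)⟩ : (directSum L).Total) =
        ⟨N.proj n, fun i => (dualEquiv α h i : ℂ) • c n i⟩ := by
      have h5 : ∀ (x : X) (hx : N.proj (h • n) = x) (hx' : N.proj n = x),
          (⟨N.proj (h • n), c (h • n)⟩ : (directSum L).Total) = ⟨x, fun i =>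
            Φ i x (TorusBundle.AssocFib.mk (α (coordChar p i)).1 ⟨h • n, hx⟩ 1)⟩ := by
        rintro x rfl -
        rfl
      rw [h5 (N.proj n) (N.proj_smul h n) rfl]
      exact congrArg (TotalSpace.mk (N.proj n)) (h3 (N.proj n) ⟨n, rfl⟩ ⟨h • n, N.proj_smul h n⟩ rfl)
    exact Subtype.ext h4

/-- A principal bundle whose character map is an isomorphism is a twist of
`L₁ˣ ⊕ ⋯ ⊕ L_pˣ`. -/
theorem isomUpToTwist_of_charMapIsIso {L : Fin p → HolLineBundle E X} (hL : IsPicBasis L)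
    {N : TorusBundle E p X} (hN : N.CharMapIsIso) : N.IsomUpToTwist (sumTimes L) := by
  obtain ⟨f, hf⟩ := charMapIsIso_sumTimes hL
  obtain ⟨g, hg⟩ := hN
  -- The automorphism is $\lambda_N^{-1}\circ\lambda_M$.
  refine isomUpToTwist_sumTimes N L (f.trans g.symm) fun i => ?_
  rw [← hg, ← charMap_sumTimes_coordChar, ← hf]
  exact g.apply_symm_apply _

end Uniqueness

/-! ### Determinants, volume forms and Jacobians -/

section Determinants

/-- The determinant of a block triangular endomorphism of a product. -/
theorem det_blockTriangular {V V' : Type*} [AddCommGroup V] [Module ℂ V] [FiniteDimensional ℂ V]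
    [AddCommGroup V'] [Module ℂ V'] [FiniteDimensional ℂ V'] (A : V →ₗ[ℂ] V) (B : V →ₗ[ℂ] V')
    (C : V' →ₗ[ℂ] V') {f : V × V' →ₗ[ℂ] V × V'} (hf : ∀ v w, f (v, w) = (A v, B v + C w)) :
    LinearMap.det f = LinearMap.det A * LinearMap.det C := by
  classical
  let b := Module.Free.chooseBasis ℂ V
  let b' := Module.Free.chooseBasis ℂ V'
  have h : LinearMap.toMatrix (b.prod b') (b.prod b') f =
      Matrix.fromBlocks (LinearMap.toMatrix b b A) 0 (LinearMap.toMatrix b b' B)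
        (LinearMap.toMatrix b' b' C) := by
    ext (i | i) (j | j) <;> simp [LinearMap.toMatrix_apply, hf]
  rw [← LinearMap.det_toMatrix (b.prod b'), h, Matrix.det_fromBlocks_zero₁₂,
    LinearMap.det_toMatrix, LinearMap.det_toMatrix]

/-- By the Leibniz formula the determinant is a polynomial in the matrix entries. -/
theorem contDiff_det {V : Type*} [NormedAddCommGroup V] [NormedSpace ℂ V]
    [FiniteDimensional ℂ V] {n : WithTop ℕ∞} :
    ContDiff ℂ n (fun A : V →L[ℂ] V => A.det) := by
  classical
  let b := Module.finBasis ℂ V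
  have h : (fun A : V →L[ℂ] V => A.det) = fun A =>
      ∑ σ : Equiv.Perm (Fin (Module.finrank ℂ V)), (Equiv.Perm.sign σ : ℂ) *
        ∏ i, b.repr (A (b i)) (σ i) := by
    funext A
    rw [ContinuousLinearMap.det, ← LinearMap.det_toMatrix b, Matrix.det_apply']
    simp [LinearMap.toMatrix_apply]
  rw [h]
  refine ContDiff.sum fun σ _ => contDiff_const.mul (contDiff_prod fun i _ => ?_)
  exact ((LinearMap.toContinuousLinearMap (b.coord (σ i))).contDiff).comp
    (contDiff_id.clm_apply contDiff_const)

/-- The determinant of a basis as a continuous alternating form. -/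
def volForm {V : Type*} [NormedAddCommGroup V] [NormedSpace ℂ V] {n : ℕ}
    (b : Module.Basis (Fin n) ℂ V) : V [⋀^Fin n]→L[ℂ] ℂ :=
  { b.det with
    cont := by
      have : FiniteDimensional ℂ V := b.finiteDimensional_of_finite
      have h : ∀ i, Continuous fun v : V => b.repr v i := fun i =>
        LinearMap.continuous_of_finiteDimensional (b.coord i)
      change Continuous fun v : Fin n → V => Matrix.det (b.toMatrix v)
      refine Continuous.matrix_det (continuous_matrix fun i j => ?_)
      exact (h i).comp (continuous_apply j) }

theorem volForm_ne_zero {V : Type*} [NormedAddCommGroup V] [NormedSpace ℂ V] {n : ℕ}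
    (b : Module.Basis (Fin n) ℂ V) : volForm b ≠ 0 := by
  intro h
  have h1 : volForm b b = 1 := b.det_self
  rw [h] at h1
  exact zero_ne_one h1

theorem volForm_compContinuousLinearMap {V : Type*} [NormedAddCommGroup V] [NormedSpace ℂ V] {n : ℕ}
    (b : Module.Basis (Fin n) ℂ V) (A : V →L[ℂ] V) :
    (volForm b).compContinuousLinearMap A = A.det • volForm b := by
  ext v
  exact b.det_comp (A : V →ₗ[ℂ] V) v

variable {W : Type*} [NormedAddCommGroup W] [NormedSpace ℂ W]
  {H : Type*} [TopologicalSpace H]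
  {Y : Type*} [TopologicalSpace Y] [ChartedSpace H Y]

/-- The Jacobian determinant of a map from a manifold to its model vector space. -/
def jac (I : ModelWithCorners ℂ W H) (f : Y → W) (y : Y) : ℂ :=
  ContinuousLinearMap.det (mfderiv I 𝓘(ℂ, W) f y : W →L[ℂ] W)

variable {I : ModelWithCorners ℂ W H}

theorem jac_congr {f g : Y → W} {y : Y} (h : f =ᶠ[𝓝 y] g) : jac I f y = jac I g y := by
  have h1 : (mfderiv I 𝓘(ℂ, W) f y : W →L[ℂ] W) = mfderiv I 𝓘(ℂ, W) g y := h.mfderiv_eq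
  rw [jac, jac, h1]

/-- This and the next two lemmas are the chain rule combined with multiplicativity of the
determinant: for a map after the coordinates, a self-map of the manifold before them, and a
parametrization before them. Tangent spaces are identified with `W` by the preferred charts, so a
Jacobian alone may jump from point to point; only combinations free of this choice are holomorphic.
-/
theorem jac_comp {f : Y → W} {g : W → W} {y : Y} (hg : DifferentiableAt ℂ g (f y))
    (hf : MDifferentiableAt I 𝓘(ℂ, W) f y) :
    jac I (g ∘ f) y = (fderiv ℂ g (f y)).det * jac I f y := by
  have h1 : (mfderiv I 𝓘(ℂ, W) (g ∘ f) y : W →L[ℂ] W) =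
      (fderiv ℂ g (f y)).comp (mfderiv I 𝓘(ℂ, W) f y : W →L[ℂ] W) := by
    have h2 := mfderiv_comp y hg.mdifferentiableAt hf
    rw [mfderiv_eq_fderiv] at h2
    exact h2
  rw [jac, h1]
  exact LinearMap.det_comp _ _

theorem jac_comp_left {k : Y → Y} {f : Y → W} {y : Y} (hf : MDifferentiableAt I 𝓘(ℂ, W) f (k y))
    (hk : MDifferentiableAt I I k y) :
    jac I (f ∘ k) y = jac I f (k y) *
      ContinuousLinearMap.det (mfderiv I I k y : W →L[ℂ] W) := by
  have h1 : (mfderiv I 𝓘(ℂ, W) (f ∘ k) y : W →L[ℂ] W) =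
      (mfderiv I 𝓘(ℂ, W) f (k y) : W →L[ℂ] W).comp (mfderiv I I k y : W →L[ℂ] W) :=
    mfderiv_comp y hf hk
  rw [jac, h1]
  exact LinearMap.det_comp _ _

theorem jac_mul_det {k : W → Y} {f : Y → W} {z : W} (hf : MDifferentiableAt I 𝓘(ℂ, W) f (k z))
    (hk : MDifferentiableAt 𝓘(ℂ, W) I k z) :
    (fderiv ℂ (f ∘ k) z).det = jac I f (k z) *
      ContinuousLinearMap.det (mfderiv 𝓘(ℂ, W) I k z : W →L[ℂ] W) := by
  have h1 : fderiv ℂ (f ∘ k) z =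
      (mfderiv I 𝓘(ℂ, W) f (k z) : W →L[ℂ] W).comp (mfderiv 𝓘(ℂ, W) I k z : W →L[ℂ] W) := by
    rw [← mfderiv_eq_fderiv]
    exact mfderiv_comp z hf hk
  rw [h1]
  exact LinearMap.det_comp _ _

/-- A local left inverse suffices, because the two determinants multiply to 1. -/
theorem jac_ne_zero {f : Y → W} {k : W → Y} {y : Y} (hf : MDifferentiableAt I 𝓘(ℂ, W) f y)
    (hk : MDifferentiableAt 𝓘(ℂ, W) I k (f y)) (hkf : k ∘ f =ᶠ[𝓝 y] id) : jac I f y ≠ 0 := by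
  have h1 : (mfderiv 𝓘(ℂ, W) I k (f y) : W →L[ℂ] W).comp
      (mfderiv I 𝓘(ℂ, W) f y : W →L[ℂ] W) = ContinuousLinearMap.id ℂ W := by
    have h2 := mfderiv_comp y hk hf
    rw [hkf.mfderiv_eq, mfderiv_id] at h2
    exact h2.symm
  have h3 : ContinuousLinearMap.det (mfderiv 𝓘(ℂ, W) I k (f y) : W →L[ℂ] W) * jac I f y = 1 := by
    refine (LinearMap.det_comp _ _).symm.trans ?_
    exact (congrArg ContinuousLinearMap.det h1).trans LinearMap.det_id
  exact right_ne_zero_of_mul_eq_one h3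

end Determinants

/-! ### The canonical bundle of the base -/

section Canonical

variable {E : Type v} [NormedAddCommGroup E] [NormedSpace ℂ E]
  {X : Type u} [TopologicalSpace X] [ChartedSpace E X] [IsManifold 𝓘(ℂ, E) ω X]

/-- The Jacobian determinant at `x` of the change from the chart at `a` to the chart at `b`. -/
def tdet (a b x : X) : ℂ := (tangentCoordChange 𝓘(ℂ, E) a b x).det

theorem tdet_self {a x : X} (h : x ∈ (chartAt E a).source) : tdet (E := E) a a x = 1 := by
  have h1 : tangentCoordChange 𝓘(ℂ, E) a a x = ContinuousLinearMap.id ℂ E := by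
    ext v
    exact tangentCoordChange_self (by rwa [extChartAt_source])
  rw [tdet, h1]
  exact LinearMap.det_id

theorem tdet_mul {a b c x : X} (ha : x ∈ (chartAt E a).source) (hb : x ∈ (chartAt E b).source)
    (hc : x ∈ (chartAt E c).source) :
    tdet (E := E) b c x * tdet (E := E) a b x = tdet (E := E) a c x := by
  have h1 : (tangentCoordChange 𝓘(ℂ, E) b c x : E →ₗ[ℂ] E) ∘ₗ
      (tangentCoordChange 𝓘(ℂ, E) a b x : E →ₗ[ℂ] E) =
      (tangentCoordChange 𝓘(ℂ, E) a c x : E →ₗ[ℂ] E) := by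
    ext v
    exact tangentCoordChange_comp (by simp only [extChartAt_source]; exact ⟨⟨ha, hb⟩, hc⟩)
  rw [tdet, tdet, tdet, ContinuousLinearMap.det, ContinuousLinearMap.det, ← LinearMap.det_comp, h1,
    ContinuousLinearMap.det]

theorem tdet_ne_zero {a b x : X} (ha : x ∈ (chartAt E a).source) (hb : x ∈ (chartAt E b).source) :
    tdet (E := E) a b x ≠ 0 := by
  have := tdet_mul ha hb ha
  rw [tdet_self ha] at this
  exact right_ne_zero_of_mul_eq_one this

theorem contMDiffOn_tdet [FiniteDimensional ℂ E] (a b : X) :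
    ContMDiffOn 𝓘(ℂ, E) 𝓘(ℂ, ℂ) ω (tdet (E := E) a b)
      ((chartAt E a).source ∩ (chartAt E b).source) := by
  have : IsManifold 𝓘(ℂ, E) (ω + 1) X := ‹IsManifold 𝓘(ℂ, E) ω X›
  have h1 : (tangentBundleCore 𝓘(ℂ, E) X).IsContMDiff 𝓘(ℂ, E) ω :=
    tangentBundleCore.isContMDiff
  exact (contDiff_det (n := ω)).contMDiff.comp_contMDiffOn
    (h1.contMDiffOn_coordChange (achart E a) (achart E b))

variable (E X) in
/-- The trivializations of the canonical bundle: the coordinate of a top form with respect to the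
chart at `a`. The fibre at `x` is identified with `ℂ` by means of the preferred chart at `x`. -/
def canonicalData [FiniteDimensional ℂ E] :
    LocalTrivData (E := E) (F := ℂ) (fun _ : X => ULift.{u} ℂ) :=
  HolLineBundle.lineData _ (fun a => (chartAt E a).source) (fun a => (chartAt E a).open_source)
    (fun a => mem_chart_source E a)
    (fun a x h => ULift.moduleEquiv.trans (LinearEquiv.smulOfUnit
      (Units.mk0 (tdet (E := E) a x x) (tdet_ne_zero h (mem_chart_source E x)))))
    (fun a b => by
      -- Coordinates of top forms transform by the inverse Jacobian, so the passage from `a` to `b`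
      -- involves the chart change from `b` to `a`.
      refine ⟨tdet (E := E) b a, (contMDiffOn_tdet b a).mono fun x hx => ⟨hx.2, hx.1⟩, ?_⟩
      intro x ha hb
      have hx := mem_chart_source E x
      have h0 := tdet_ne_zero (E := E) ha hx
      have e : (LinearEquiv.smulOfUnit (Units.mk0 (tdet (E := E) a x x) h0) : ℂ ≃ₗ[ℂ] ℂ).symm 1 =
          (tdet (E := E) a x x)⁻¹ := by
        rw [LinearEquiv.symm_apply_eq]
        exact (mul_inv_cancel₀ h0).symm
      simp only [LinearEquiv.trans_symm, LinearEquiv.trans_apply, e]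
      change tdet (E := E) b x x * (tdet (E := E) a x x)⁻¹ = _
      rw [← tdet_mul hb ha hx, mul_comm, inv_mul_cancel_left₀ h0])

variable (E X) in
/-- The canonical bundle of `X`. -/
def canonical [FiniteDimensional ℂ E] : HolLineBundle E X := (canonicalData E X).toBundle

end Canonical

/-! ### The equivariant holomorphic top form -/

section CalabiYau

variable {E : Type v} [NormedAddCommGroup E] [NormedSpace ℂ E] {p : ℕ}
  {X : Type u} [TopologicalSpace X] [ChartedSpace E X]

theorem det_pi_smul (g : Fin p → ℂ) :
    LinearMap.det (LinearMap.pi fun i => g i • (LinearMap.proj i : (Fin p → ℂ) →ₗ[ℂ] ℂ)) =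
      ∏ i, g i := by
  have h := LinearMap.det_pi (fun i => g i • (LinearMap.id : ℂ →ₗ[ℂ] ℂ))
  simp only [LinearMap.smul_comp, LinearMap.id_comp] at h
  rw [h]
  simp

namespace TorusBundle

variable {M : TorusBundle E p X}

/-- In a local trivialization the action multiplies the fibre coordinates by constants. -/
theorem contMDiff_smul (h : Torus p) :
    ContMDiff (totModel E p) (totModel E p) ω (fun m : M.Tot => h • m) := by
  intro m
  let a := M.proj m
  have ha : a ∈ M.dom a := (M.triv_spec a).2.1
  have hm : M.proj (h • m) ∈ M.dom a := by rwa [M.proj_smul]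
  have h1 : ContMDiffAt (totModel E p) (𝓘(ℂ, E).prod 𝓘(ℂ, Fin p → ℂ)) ω
      (fun y : M.Tot => ((M.proj y, fun i => (M.triv a y).2 i * h i) : X × (Fin p → ℂ))) m := by
    refine (contMDiffAt_proj m).prodMk (contMDiffAt_pi_space.2 fun i => ?_)
    have h2 := contMDiff_snd.contMDiffAt.comp m (contMDiffAt_triv (a := a) ha)
    exact (contMDiffAt_pi_space.1 h2 i).mul contMDiffAt_const
  have h3 : ∀ y : M.Tot, M.proj y ∈ M.dom a →
      ((M.proj y, fun i => (M.triv a y).2 i * h i) : X × (Fin p → ℂ)) = M.triv a (h • y) := by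
    intro y hy
    have hs := (M.triv_spec a).2.2.2.2.2.2
    refine Prod.ext ?_ (funext fun i => ?_)
    · rw [hs.1 _ (mem_triv_source (by rwa [M.proj_smul])), M.proj_smul]
    · exact (hs.2 h y (mem_triv_source hy) i).symm
  have h4 := (M.triv_spec a).2.2.2.2.2.1.contMDiffAt ((M.triv a).open_target.mem_nhds
    ((M.triv a).map_source (mem_triv_source hm)))
  rw [← h3 m ha] at h4
  refine (h4.comp m h1).congr_of_eventuallyEq ?_
  filter_upwards [eventually_proj_mem ha] with y hy
  rw [Function.comp_apply, h3 y hy, (M.triv a).left_inv (mem_triv_source (by rwa [M.proj_smul]))]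

/-- The coordinates on `M` given by the chart of `X` at `a` and the local trivialization at `a`. -/
def adapted (M : TorusBundle E p X) (a : X) (m : M.Tot) : E × (Fin p → ℂ) :=
  (extChartAt 𝓘(ℂ, E) a (M.proj m), (M.triv a m).2)

/-- The domain in `X` of the coordinates `adapted`. -/
def adaptedDom (M : TorusBundle E p X) (a : X) : Set X := M.dom a ∩ (chartAt E a).source

theorem isOpen_adaptedDom (a : X) : IsOpen (M.adaptedDom a) :=
  (M.triv_spec a).1.inter (chartAt E a).open_source

theorem mem_adaptedDom (a : X) : a ∈ M.adaptedDom a :=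
  ⟨(M.triv_spec a).2.1, mem_chart_source E a⟩

theorem eventually_mem_adaptedDom {a : X} {m : M.Tot} (hm : M.proj m ∈ M.adaptedDom a) :
    ∀ᶠ y in 𝓝 m, M.proj y ∈ M.adaptedDom a :=
  (contMDiffAt_proj m).continuousAt.eventually ((isOpen_adaptedDom a).mem_nhds hm)

/-- The product of the fibre coordinates. -/
def fibProd (M : TorusBundle E p X) (a : X) (m : M.Tot) : ℂ := ∏ i, (M.triv a m).2 i

theorem fibProd_ne_zero {a : X} {m : M.Tot} (hm : M.proj m ∈ M.dom a) : M.fibProd a m ≠ 0 :=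
  Finset.prod_ne_zero_iff.2 fun i _ => triv_mem hm i

theorem contMDiffAt_triv_snd {a : X} {m : M.Tot} (hm : M.proj m ∈ M.dom a) (i : Fin p) :
    ContMDiffAt (totModel E p) 𝓘(ℂ, ℂ) ω (fun y => (M.triv a y).2 i) m :=
  contMDiffAt_pi_space.1 (contMDiff_snd.contMDiffAt.comp m (contMDiffAt_triv hm)) i

theorem contMDiffAt_fibProd {a : X} {m : M.Tot} (hm : M.proj m ∈ M.dom a) :
    ContMDiffAt (totModel E p) 𝓘(ℂ, ℂ) ω (M.fibProd a) m :=
  contMDiffAt_finsetProd fun i _ => contMDiffAt_triv_snd hm i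

/-- The fibre coordinates of two local trivializations differ by a factor depending on the base
point only. -/
theorem triv_snd_eq {a b : X} {m : M.Tot} (ha : M.proj m ∈ M.dom a) (hb : M.proj m ∈ M.dom b)
    (i : Fin p) : (M.triv b m).2 i =
      (M.triv b ((M.triv a).symm (M.proj m, fun _ => 1))).2 i * (M.triv a m).2 i := by
  have h1 : m = M.comp a m • (M.localSec a (M.proj m) ha).1 := by
    refine eq_of_comp_eq ha ?_ ?_
    · rw [M.proj_smul]
      exact (M.localSec a (M.proj m) ha).2
    · rw [comp_smul ((M.localSec a (M.proj m) ha).2.symm ▸ ha), comp_localSec, mul_one]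
  have h2 : M.proj (M.localSec a (M.proj m) ha).1 ∈ M.dom b :=
    (M.localSec a (M.proj m) ha).2.symm ▸ hb
  have h3 := (M.triv_spec b).2.2.2.2.2.2.2 (M.comp a m) _ (mem_triv_source h2) i
  rw [← h1, comp, val_toTorus (triv_mem ha)] at h3
  exact h3

variable [IsManifold 𝓘(ℂ, E) ω X]

theorem contMDiffAt_adapted {a : X} {m : M.Tot} (hm : M.proj m ∈ M.adaptedDom a) :
    ContMDiffAt (totModel E p) 𝓘(ℂ, E × (Fin p → ℂ)) ω (M.adapted a) m := by
  refine ContMDiffAt.prodMk_space ?_ ?_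
  · exact (contMDiffAt_extChartAt' hm.2).comp m (contMDiffAt_proj m)
  · exact contMDiff_snd.contMDiffAt.comp m (contMDiffAt_triv hm.1)

theorem mdifferentiableAt_adapted {a : X} {m : M.Tot} (hm : M.proj m ∈ M.adaptedDom a) :
    MDifferentiableAt (totModel E p) 𝓘(ℂ, E × (Fin p → ℂ)) (M.adapted a) m :=
  (contMDiffAt_adapted hm).mdifferentiableAt (by simp)

theorem jac_adapted_ne_zero {a : X} {m : M.Tot} (hm : M.proj m ∈ M.adaptedDom a) :
    jac (totModel E p) (M.adapted a) m ≠ 0 := by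
  let k : E × (Fin p → ℂ) → M.Tot := fun z =>
    (M.triv a).symm ((extChartAt 𝓘(ℂ, E) a).symm z.1, z.2)
  have hk : ∀ y, M.proj y ∈ M.adaptedDom a → ((extChartAt 𝓘(ℂ, E) a).symm (M.adapted a y).1,
      (M.adapted a y).2) = M.triv a y := by
    intro y hy
    refine Prod.ext ?_ rfl
    rw [(M.triv_spec a).2.2.2.2.2.2.1 y (mem_triv_source hy.1)]
    exact (extChartAt 𝓘(ℂ, E) a).left_inv (by rw [extChartAt_source]; exact hy.2)
  refine jac_ne_zero (k := k) (mdifferentiableAt_adapted hm) ?_ ?_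
  · refine ContMDiffAt.mdifferentiableAt (n := ω) ?_ (by simp)
    have h1 := (M.triv_spec a).2.2.2.2.2.1.contMDiffAt ((M.triv a).open_target.mem_nhds
      ((M.triv a).map_source (mem_triv_source hm.1)))
    rw [← hk m hm] at h1
    have h2 : ContMDiffAt 𝓘(ℂ, E × (Fin p → ℂ)) (𝓘(ℂ, E).prod 𝓘(ℂ, Fin p → ℂ)) ω
        (fun z : E × (Fin p → ℂ) => (((extChartAt 𝓘(ℂ, E) a).symm z.1, z.2) : X × (Fin p → ℂ)))
        (M.adapted a m) := by
      refine ContMDiffAt.prodMk ?_ contDiff_snd.contDiffAt.contMDiffAt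
      have h3 : (M.adapted a m).1 ∈ (extChartAt 𝓘(ℂ, E) a).target :=
        (extChartAt 𝓘(ℂ, E) a).map_source (by rw [extChartAt_source]; exact hm.2)
      exact ((contMDiffOn_extChartAt_symm a).contMDiffAt
        ((isOpen_extChartAt_target a).mem_nhds h3)).comp _ contDiff_fst.contDiffAt.contMDiffAt
    exact ContMDiffAt.comp (M.adapted a m) (g := (M.triv a).symm) (f := fun z : E × (Fin p → ℂ) =>
      (((extChartAt 𝓘(ℂ, E) a).symm z.1, z.2) : X × (Fin p → ℂ))) h1 h2
  · filter_upwards [eventually_mem_adaptedDom hm] with y hy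
    change (M.triv a).symm _ = y
    rw [hk y hy, (M.triv a).left_inv (mem_triv_source hy.1)]

/-- The local invariant volume densities `dx ∧ dt₁/t₁ ∧ ⋯ ∧ dt_p/t_p`. -/
def dens (M : TorusBundle E p X) (a : X) (m : M.Tot) : ℂ :=
  jac (totModel E p) (M.adapted a) m / M.fibProd a m

theorem dens_ne_zero {a : X} {m : M.Tot} (hm : M.proj m ∈ M.adaptedDom a) : M.dens a m ≠ 0 :=
  div_ne_zero (jac_adapted_ne_zero hm) (fibProd_ne_zero hm.1)

variable [FiniteDimensional ℂ E]

/-- In adapted coordinates the change from `a` to `b` is a chart change on the base together with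
scaling of the fibre coordinates by functions `g i` of the base point. Its derivative is block
triangular, with determinant `tdet` times the product of the `g i`, and this product cancels against
the change of `fibProd`. Hence `dens` changes only by a Jacobian of the base. -/
theorem dens_change {a b : X} {m : M.Tot} (ha : M.proj m ∈ M.adaptedDom a)
    (hb : M.proj m ∈ M.adaptedDom b) :
    M.dens b m = tdet (E := E) a b (M.proj m) * M.dens a m := by
  let x := M.proj m
  let ca := extChartAt 𝓘(ℂ, E) a
  let cb := extChartAt 𝓘(ℂ, E) b
  let g : Fin p → X → ℂ := fun i x => (M.triv b ((M.triv a).symm (x, fun _ => 1))).2 i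
  let t := (M.triv a m).2
  have hxa : x ∈ ca.source := by rw [extChartAt_source]; exact ha.2
  have hxb : x ∈ cb.source := by rw [extChartAt_source]; exact hb.2
  have hx : ca.symm (ca x) = x := ca.left_inv hxa
  let τ : E × (Fin p → ℂ) → E × (Fin p → ℂ) := fun z =>
    (cb (ca.symm z.1), fun i => g i (ca.symm z.1) * z.2 i)
  have hτ : M.adapted b =ᶠ[𝓝 m] τ ∘ M.adapted a := by
    filter_upwards [eventually_mem_adaptedDom ha, eventually_mem_adaptedDom hb] with y hya hyb
    have h1 : ca.symm (ca (M.proj y)) = M.proj y :=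
      ca.left_inv (by rw [extChartAt_source]; exact hya.2)
    refine Prod.ext ?_ (funext fun i => ?_)
    · change cb (M.proj y) = cb (ca.symm (ca (M.proj y)))
      rw [h1]
    · change (M.triv b y).2 i = g i (ca.symm (ca (M.proj y))) * (M.triv a y).2 i
      rw [h1]
      exact triv_snd_eq hya.1 hyb.1 i
  have hA : HasFDerivAt (cb ∘ ca.symm) (tangentCoordChange 𝓘(ℂ, E) a b x) (ca x) := by
    have := hasFDerivWithinAt_tangentCoordChange (I := 𝓘(ℂ, E)) (x := a) (y := b) (z := x)
      ⟨hxa, hxb⟩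
    rw [ModelWithCorners.range_eq_univ, hasFDerivWithinAt_univ] at this
    exact this
  have hg : ∀ i, ∃ γ : E →L[ℂ] ℂ, HasFDerivAt (fun u => g i (ca.symm u)) γ (ca x) := by
    intro i
    have h1 : M.proj ((M.triv a).symm (x, fun _ => 1)) ∈ M.dom b :=
      (M.localSec a x ha.1).2.symm ▸ hb.1
    have h2 : ContMDiffAt 𝓘(ℂ, E) 𝓘(ℂ, ℂ) ω (g i) x :=
      (contMDiffAt_triv_snd h1 i).comp x (contMDiffAt_localSec ha.1)
    have h3 : ContMDiffAt 𝓘(ℂ, E) 𝓘(ℂ, E) ω ca.symm (ca x) :=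
      (contMDiffOn_extChartAt_symm a).contMDiffAt
        ((isOpen_extChartAt_target a).mem_nhds (ca.map_source hxa))
    rw [← hx] at h2
    have h4 := (h2.comp (ca x) h3).contDiffAt
    exact ⟨_, (h4.differentiableAt (by simp)).hasFDerivAt⟩
  choose γ hγ using hg
  -- The derivatives `γ i` of the factors in base directions fill only the off-diagonal block and do
  -- not affect the determinant.
  let T : E × (Fin p → ℂ) →L[ℂ] E × (Fin p → ℂ) :=
    ((tangentCoordChange 𝓘(ℂ, E) a b x).comp (ContinuousLinearMap.fst ℂ E (Fin p → ℂ))).prod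
      (ContinuousLinearMap.pi fun i =>
        g i x • ((ContinuousLinearMap.proj i).comp (ContinuousLinearMap.snd ℂ E (Fin p → ℂ))) +
          t i • ((γ i).comp (ContinuousLinearMap.fst ℂ E (Fin p → ℂ))))
  have hT : HasFDerivAt τ T (M.adapted a m) := by
    have hf : HasFDerivAt (fun z : E × (Fin p → ℂ) => z.1)
      (ContinuousLinearMap.fst ℂ E (Fin p → ℂ)) (M.adapted a m) := hasFDerivAt_fst
    refine HasFDerivAt.prodMk ?_ (hasFDerivAt_pi.2 fun i => ?_)
    · exact HasFDerivAt.comp (M.adapted a m) (g := cb ∘ ca.symm) hA hf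
    · have h1 : HasFDerivAt (fun z : E × (Fin p → ℂ) => g i (ca.symm z.1))
          ((γ i).comp (ContinuousLinearMap.fst ℂ E (Fin p → ℂ))) (M.adapted a m) :=
        HasFDerivAt.comp (M.adapted a m) (g := fun u => g i (ca.symm u)) (hγ i) hf
      have h2 : HasFDerivAt (fun z : E × (Fin p → ℂ) => z.2 i)
          ((ContinuousLinearMap.proj i).comp (ContinuousLinearMap.snd ℂ E (Fin p → ℂ)))
          (M.adapted a m) := ContinuousLinearMap.hasFDerivAt
        ((ContinuousLinearMap.proj i).comp (ContinuousLinearMap.snd ℂ E (Fin p → ℂ)))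
      have h3 := h1.mul h2
      have h4 : g i (ca.symm (M.adapted a m).1) = g i x := congrArg (g i) hx
      rw [h4] at h3
      exact h3
  have hdet : T.det = tdet (E := E) a b x * ∏ i, g i x := by
    refine (det_blockTriangular (tangentCoordChange 𝓘(ℂ, E) a b x : E →ₗ[ℂ] E)
      (LinearMap.pi fun i => t i • (γ i : E →ₗ[ℂ] ℂ))
      (LinearMap.pi fun i => g i x • LinearMap.proj i) ?_).trans ?_
    · intro u s
      refine Prod.ext rfl (funext fun i => ?_)
      exact add_comm _ _
    · rw [det_pi_smul]
      rfl
  have h5 : jac (totModel E p) (M.adapted b) m =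
      tdet (E := E) a b x * (∏ i, g i x) * jac (totModel E p) (M.adapted a) m := by
    rw [jac_congr hτ, jac_comp hT.differentiableAt (mdifferentiableAt_adapted ha), hT.fderiv, hdet]
  have h6 : M.fibProd b m = (∏ i, g i x) * M.fibProd a m := by
    rw [fibProd, fibProd, ← Finset.prod_mul_distrib]
    exact Finset.prod_congr rfl fun i _ => triv_snd_eq ha.1 hb.1 i
  have h7 := fibProd_ne_zero ha.1
  have h8 := fibProd_ne_zero hb.1
  rw [h6] at h8
  have h9 := left_ne_zero_of_mul h8
  rw [dens, dens, h5, h6]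
  change tdet (E := E) a b x * _ * _ / _ = tdet (E := E) a b x * _
  field_simp

/-- This is the invariance of `dtᵢ / tᵢ` under scaling: the product of the `h i` occurs both in the
Jacobian and in `fibProd`. -/
theorem dens_smul (h : Torus p) {a : X} {m : M.Tot} (ha : M.proj m ∈ M.adaptedDom a) :
    M.dens a (h • m) * ContinuousLinearMap.det (mfderiv (totModel E p) (totModel E p)
      (fun y : M.Tot => h • y) m : E × (Fin p → ℂ) →L[ℂ] E × (Fin p → ℂ)) = M.dens a m := by
  have ha' : M.proj (h • m) ∈ M.adaptedDom a := by rwa [M.proj_smul]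
  have hs : ∀ y : M.Tot, M.proj y ∈ M.dom a → ∀ i, (M.triv a (h • y)).2 i =
      (M.triv a y).2 i * h i :=
    fun y hy i => (M.triv_spec a).2.2.2.2.2.2.2 h y (mem_triv_source hy) i
  let T : E × (Fin p → ℂ) →L[ℂ] E × (Fin p → ℂ) := (ContinuousLinearMap.fst ℂ E (Fin p → ℂ)).prod
    (ContinuousLinearMap.pi fun i => (h i : ℂ) •
      ((ContinuousLinearMap.proj i).comp (ContinuousLinearMap.snd ℂ E (Fin p → ℂ))))
  have hT : M.adapted a ∘ (fun y : M.Tot => h • y) =ᶠ[𝓝 m] T ∘ M.adapted a := by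
    filter_upwards [eventually_mem_adaptedDom ha] with y hy
    refine Prod.ext ?_ (funext fun i => ?_)
    · change extChartAt 𝓘(ℂ, E) a (M.proj (h • y)) = extChartAt 𝓘(ℂ, E) a (M.proj y)
      rw [M.proj_smul]
    · exact (hs y hy.1 i).trans (mul_comm _ _)
  have hdet : T.det = ∏ i, (h i : ℂ) := by
    refine (det_blockTriangular LinearMap.id 0
      (LinearMap.pi fun i => (h i : ℂ) • LinearMap.proj i) ?_).trans ?_
    · intro u s
      refine Prod.ext rfl (funext fun i => ?_)
      exact (zero_add _).symm
    · rw [det_pi_smul, LinearMap.det_id, one_mul]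
  have h1 := jac_comp_left (mdifferentiableAt_adapted ha')
    ((contMDiff_smul h).contMDiffAt.mdifferentiableAt (x := m) (by simp))
  rw [jac_congr hT, jac_comp T.differentiableAt (mdifferentiableAt_adapted ha), T.fderiv, hdet] at h1
  have h2 : M.fibProd a (h • m) = M.fibProd a m * ∏ i, (h i : ℂ) := by
    rw [fibProd, fibProd, ← Finset.prod_mul_distrib]
    exact Finset.prod_congr rfl fun i _ => hs m ha.1 i
  have h3 := fibProd_ne_zero ha.1
  have h4 : ∏ i, (h i : ℂ) ≠ 0 := Finset.prod_ne_zero_iff.2 fun i _ => (h i).ne_zero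
  rw [dens, dens, div_mul_eq_mul_div, ← h1, h2]
  field_simp

/-- A nowhere vanishing section of the pullback of the canonical bundle defines a top form on
`M`. -/
def cyForm (M : TorusBundle E p X) (κ : M.Tot → ℂ) : M.TopForm := fun m =>
  (κ m * M.dens (M.proj m) m) • volForm ((Module.finBasis ℂ (E × (Fin p → ℂ))).reindex
    (finCongr (by simp)))

/-- The number `κ m` is a coordinate in the preferred chart at `M.proj m`, which varies with `m`.
Rewritten at a fixed `a`, it enters only through `tdet * κ`, the coordinate in the trivialization of
the canonical bundle at `a`. -/
theorem cyForm_coeff (κ : M.Tot → ℂ) {a : X} {m : M.Tot} (hm : M.proj m ∈ M.adaptedDom a) :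
    κ m * M.dens (M.proj m) m =
      tdet (E := E) a (M.proj m) (M.proj m) * κ m * M.dens a m := by
  rw [dens_change hm (mem_adaptedDom _)]
  ring

theorem cyForm_ne_zero {κ : M.Tot → ℂ} {m : M.Tot} (hκ : κ m ≠ 0) : M.cyForm κ m ≠ 0 :=
  smul_ne_zero (mul_ne_zero hκ (dens_ne_zero (mem_adaptedDom _))) (volForm_ne_zero _)

/-- The density is invariant by `dens_smul`, so the whole weight comes from `κ`. -/
theorem cyForm_translate {κ : M.Tot → ℂ} {h : Torus p} {c : ℂ} {m : M.Tot}
    (hκ : κ (h • m) = c * κ m) : (M.cyForm κ).translate h m = c • M.cyForm κ m := by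
  have ha := mem_adaptedDom (M := M) (M.proj m)
  have h1 := volForm_compContinuousLinearMap ((Module.finBasis ℂ (E × (Fin p → ℂ))).reindex
    (finCongr (by simp : Module.finrank ℂ (E × (Fin p → ℂ)) = M.topDegree)))
    (mfderiv (totModel E p) (totModel E p) (fun y : M.Tot => h • y) m)
  have h2 : (M.cyForm κ).translate h m = (κ (h • m) * M.dens (M.proj (h • m)) (h • m)) •
      (volForm ((Module.finBasis ℂ (E × (Fin p → ℂ))).reindex (finCongr (by simp :
        Module.finrank ℂ (E × (Fin p → ℂ)) = M.topDegree)))).compContinuousLinearMap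
        (mfderiv (totModel E p) (totModel E p) (fun y : M.Tot => h • y) m) := rfl
  refine h2.trans ((congrArg ((κ (h • m) * M.dens (M.proj (h • m)) (h • m)) • ·) h1).trans ?_)
  refine (smul_smul _ _ _).trans (Eq.trans (congrArg (· • volForm _) ?_) (smul_smul _ _ _).symm)
  rw [hκ, M.proj_smul]
  exact (mul_assoc _ _ _).trans ((congrArg (c * κ m * ·) (dens_smul h ha)).trans (mul_assoc _ _ _))

/-- Pulled back by the inverse chart, the Jacobian in `dens` combines with the derivative of that
inverse into the determinant of an ordinary derivative, that of `M.adapted a ∘ φ.symm`. The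
preferred charts of `M` drop out, and every remaining factor is holomorphic. -/
theorem cyForm_isHolomorphic {κ : M.Tot → ℂ} (hκ : ∀ m₀, ContMDiffAt (totModel E p) 𝓘(ℂ, ℂ) ω
    (fun m => tdet (E := E) (M.proj m₀) (M.proj m) (M.proj m) * κ m) m₀) :
    (M.cyForm κ).IsHolomorphic := by
  intro m₀ z₁ hz₁
  refine ContDiffAt.contDiffWithinAt ?_
  let φ := extChartAt (totModel E p) m₀
  let y₁ := φ.symm z₁
  -- Adapted coordinates are taken around the point under consideration and not around `m₀`, since
  -- the chart at `m₀` may leave their domain.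
  let a := M.proj y₁
  have ha : M.proj y₁ ∈ M.adaptedDom a := mem_adaptedDom a
  have hφ : ∀ z ∈ φ.target, ContMDiffAt 𝓘(ℂ, E × (Fin p → ℂ)) (totModel E p) ω φ.symm z :=
    fun z hz => (contMDiffOn_extChartAt_symm m₀).contMDiffAt
      ((isOpen_extChartAt_target m₀).mem_nhds hz)
  let G : E × (Fin p → ℂ) → E × (Fin p → ℂ) := M.adapted a ∘ φ.symm
  have hG : ContDiffAt ℂ ω G z₁ := ((contMDiffAt_adapted ha).comp z₁ (hφ z₁ hz₁)).contDiffAt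
  have h1 : ContDiffAt ℂ ω (fun z => (fderiv ℂ G z).det) z₁ :=
    (contDiff_det (n := ω)).contDiffAt.comp z₁ (hG.fderiv_right (m := ω) (by simp))
  have h2 : ContDiffAt ℂ ω (fun z => tdet (E := E) a (M.proj (φ.symm z)) (M.proj (φ.symm z)) *
      κ (φ.symm z)) z₁ := ((hκ y₁).comp z₁ (hφ z₁ hz₁)).contDiffAt
  have h3 : ContDiffAt ℂ ω (fun z => M.fibProd a (φ.symm z)) z₁ :=
    ((contMDiffAt_fibProd ha.1).comp z₁ (hφ z₁ hz₁)).contDiffAt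
  have h4 := ((h2.mul h1).div h3 (fibProd_ne_zero ha.1)).smul (contDiffAt_const
    (c := volForm ((Module.finBasis ℂ (E × (Fin p → ℂ))).reindex
      (finCongr (by simp : Module.finrank ℂ (E × (Fin p → ℂ)) = M.topDegree)))))
  refine h4.congr_of_eventuallyEq ?_
  filter_upwards [(isOpen_extChartAt_target m₀).mem_nhds hz₁,
    (hφ z₁ hz₁).continuousAt.eventually (eventually_mem_adaptedDom ha)] with z hz hza
  have h5 := volForm_compContinuousLinearMap ((Module.finBasis ℂ (E × (Fin p → ℂ))).reindex
    (finCongr (by simp : Module.finrank ℂ (E × (Fin p → ℂ)) = M.topDegree)))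
    (mfderiv 𝓘(ℂ, E × (Fin p → ℂ)) (totModel E p) φ.symm z)
  have h6 : (M.cyForm κ).inChart m₀ z = (κ (φ.symm z) * M.dens (M.proj (φ.symm z)) (φ.symm z)) •
      (volForm ((Module.finBasis ℂ (E × (Fin p → ℂ))).reindex (finCongr (by simp :
        Module.finrank ℂ (E × (Fin p → ℂ)) = M.topDegree)))).compContinuousLinearMap
        (mfderiv 𝓘(ℂ, E × (Fin p → ℂ)) (totModel E p) φ.symm z) := rfl
  have h7 := jac_mul_det (mdifferentiableAt_adapted hza) ((hφ z hz).mdifferentiableAt (by simp))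
  refine h6.trans ((congrArg ((κ (φ.symm z) * M.dens (M.proj (φ.symm z)) (φ.symm z)) • ·)
    h5).trans ((smul_smul _ _ _).trans (congrArg (· • volForm _) ?_)))
  change _ = tdet (E := E) a (M.proj (φ.symm z)) (M.proj (φ.symm z)) * κ (φ.symm z) *
    (fderiv ℂ G z).det / M.fibProd a (φ.symm z)
  rw [cyForm_coeff κ hza, dens]
  refine Eq.trans ?_ (congrArg (fun d => tdet (E := E) a (M.proj (φ.symm z)) (M.proj (φ.symm z)) *
    κ (φ.symm z) * d / M.fibProd a (φ.symm z)) h7.symm)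
  have h8 : ∀ t j f d : ℂ, t * (j / f) * d = t * (j * d) / f := fun t j f d => by ring
  exact h8 _ _ _ _

/-- A principal bundle is Calabi-Yau if the canonical bundle of the base is associated with a
character. -/
theorem isCY_of_charMap_eq_canonical {χ : CharGroup p}
    (hχ : M.charMap χ = Pic.mk (canonical E X)) : M.IsCY := by
  obtain ⟨Φ, hΦ, -⟩ : (M.assoc χ).Isom (canonical E X) := Quotient.exact hχ
  -- The tautological section `m ↦ [m, 1]`, transported to the pullback of the canonical bundle; it
  -- vanishes nowhere and has weight `χ`.
  let s : ∀ m : M.Tot, ULift.{u} ℂ := fun m => Φ (M.proj m) (AssocFib.mk χ.1 ⟨m, rfl⟩ 1)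
  have hs : ContMDiff (totModel E p) (𝓘(ℂ, E).prod 𝓘(ℂ, ℂ)) ω
      (fun m => (⟨M.proj m, s m⟩ : (canonical E X).Total)) := hΦ.comp (contMDiff_assocMk χ)
  have hs0 : ∀ m, (s m).down ≠ 0 := fun m h0 => by
    have h1 : Φ (M.proj m) (AssocFib.mk χ.1 ⟨m, rfl⟩ 1) = 0 := ULift.ext _ _ h0
    exact AssocFib.mk_one_ne_zero χ.1 ⟨m, rfl⟩ ((map_eq_zero_iff _ (Φ (M.proj m)).injective).1 h1)
  have hsm : ∀ (h : Torus p) m, s (h • m) = (χ.1 h : ℂ) • s m := by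
    intro h m
    have h1 : ∀ (x : X) (hx : M.proj (h • m) = x),
        s (h • m) = (Φ x (AssocFib.mk χ.1 ⟨h • m, hx⟩ 1) : ULift.{u} ℂ) := by
      rintro x rfl
      rfl
    refine (h1 (M.proj m) (M.proj_smul h m)).trans ?_
    refine (congrArg (Φ (M.proj m)) ((AssocFib.mk_smul_left χ.1 (m := ⟨m, rfl⟩) rfl 1).trans
      (AssocFib.mk_smul _ _ _ _))).trans (map_smul (Φ (M.proj m)) _ _)
  refine ⟨χ, M.cyForm fun m => (s m).down, cyForm_isHolomorphic fun m₀ => ?_,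
    fun m => cyForm_ne_zero (hs0 m), fun h m => cyForm_translate ?_⟩
  -- Holomorphy of the section, read in the trivialization of the canonical bundle at `M.proj m₀`,
  -- is the condition on `tdet * κ` to be shown.
  · have h1 := hs.contMDiffAt (x := m₀)
    rw [contMDiffAt_totalSpace] at h1
    refine h1.2.congr_of_eventuallyEq ?_
    filter_upwards [eventually_mem_adaptedDom (mem_adaptedDom (M.proj m₀))] with m hm
    exact (congrArg Prod.snd
      ((canonicalData E X).toBundle_trivializationAt (M.proj m₀) hm.2 (s m))).symm
  · rw [hsm]
    rfl

end TorusBundle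

end CalabiYau

end CYBundle

end

/-! ### The main theorem -/

theorem mainTheorem2 {E : Type v} [NormedAddCommGroup E] [NormedSpace ℂ E] [FiniteDimensional ℂ E]
    {X : Type u} [TopologicalSpace X] [T2Space X] [CompactSpace X] [ChartedSpace E X]
    [IsManifold 𝓘(ℂ, E) ω X]
    (hfree : Module.Free ℤ (Additive (CYBundle.Pic E X))) :
    (∃ (p : ℕ) (L : Fin p → CYBundle.HolLineBundle E X), CYBundle.IsPicBasis L) ∧
    ∀ (p : ℕ) (L : Fin p → CYBundle.HolLineBundle E X), CYBundle.IsPicBasis L →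
      (CYBundle.sumTimes L).IsCY ∧
      (CYBundle.sumTimes L).CharMapIsIso ∧
      ∀ N : CYBundle.TorusBundle E p X, N.CharMapIsIso →
        N.IsomUpToTwist (CYBundle.sumTimes L) := by
  have := hfree
  refine ⟨CYBundle.exists_isPicBasis, fun p L hL => ⟨?_, CYBundle.charMapIsIso_sumTimes hL,
    fun N hN => CYBundle.isomUpToTwist_of_charMapIsIso hL hN⟩⟩
  -- The weight of the form is the preimage of the canonical class under the character map.
  obtain ⟨f, hf⟩ := CYBundle.charMapIsIso_sumTimes hL
  exact CYBundle.TorusBundle.isCY_of_charMap_eq_canonical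
    (χ := f.symm (CYBundle.Pic.mk (CYBundle.canonical E X)))
    (by rw [← hf]; exact f.apply_symm_apply _)
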